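/- Let $(M,I,g)$ be an almost complex Hermitian manifold: a smooth (not necessarily compact) manifold $M$ with a smooth almost complex structure $I$ ($I^2=-1$) and a smooth Riemannian metric $g$ with $g(IX,IY)=g(X,Y)$. Let $\omega(X,Y)=g(IX,Y)$ be its Hermitian form. Let $\Lambda^*(M)=\bigoplus_{p,q}\Lambda^{p,q}(M)$ be the space of smooth complex-valued differential forms on $M$ with its Hodge decomposition, where $\Lambda^{1,0}(M)$ consists of the 1-forms $\theta$ with $\theta\circ I=\sqrt{-1}\,\theta$. Let $\partial:\Lambda^{p,q}(M)\to\Lambda^{p+1,q}(M)$ and $\bar\partial:\Lambda^{p,q}(M)\to\Lambda^{p,q+1}(M)$ be the components of type $(1,0)$ and $(0,1)$ of the de Rham differential $d$, extended to $\Lambda^*(M)$ by linearity. Put $L_\omega(\eta)=\omega\wedge\eta$, and let $\Lambda_\omega$, $\partial^*$, $\bar\partial^*$ be the Hermitian adjoints of $L_\omega$, $\partial$, $\bar\partial$, that is, the operators $D^*$ on $\Lambda^*(M)$ determined by $\int_M\langle D\alpha,\beta\rangle\,d\mathrm{vol}_g=\int_M\langle\alpha,D^*\beta\rangle\,d\mathrm{vol}_g$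 for all smooth forms $\alpha,\beta$ with $\alpha$ compactly supported. Assume that $\partial\omega=\bar\partial\omega=0$, that is, $d\omega\in\Lambda^{3,0}(M)\oplus\Lambda^{0,3}(M)$. Then these adjoints exist, and on $\Lambda^*(M)$ $$[\Lambda_\omega,\partial]=\sqrt{-1}\,\bar\partial^*,\qquad [\Lambda_\omega,\bar\partial]=-\sqrt{-1}\,\partial^*,$$ and, equivalently, $$[L_\omega,\partial^*]=\sqrt{-1}\,\bar\partial,\qquad [L_\omega,\bar\partial^*]=-\sqrt{-1}\,\partial .$$ -/

import Mathlib

open scoped Manifold ContDiff ComplexConjugate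

noncomputable section

/-! ### Alternating forms on one real vector space -/

section LinearAlgebra

variable {V : Type*} [AddCommGroup V] [Module ℝ V] [TopologicalSpace V]
  [IsTopologicalAddGroup V] [ContinuousConstSMul ℝ V]

/-- The multilinear map `v ↦ a (v₀, …, v_{p-1}) * b (v_p, …, v_{n-1})`, where `n = p + q`. -/
def formTensor {p q n : ℕ} (h : p + q = n) (a : V [⋀^Fin p]→L[ℝ] ℂ) (b : V [⋀^Fin q]→L[ℝ] ℂ) :
    ContinuousMultilinearMap ℝ (fun _ : Fin n => V) ℂ where
  toFun v := a (fun i => v (Fin.cast h (Fin.castAdd q i))) *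
    b (fun j => v (Fin.cast h (Fin.natAdd p j)))
  map_update_add' := by
    subst h
    intro inst v i x y
    obtain rfl : inst = instDecidableEqFin _ := Subsingleton.elim _ _
    induction i using Fin.addCases with
    | left i =>
      have h1 : ∀ z : V, (fun l => Function.update v (Fin.castAdd q i) z (Fin.castAdd q l)) =
          Function.update (fun l => v (Fin.castAdd q l)) i z := by
        intro z; ext l
        simp [Function.update_apply]
      have h2 : ∀ z : V, (fun l => Function.update v (Fin.castAdd q i) z (Fin.natAdd p l)) =
          (fun l => v (Fin.natAdd p l)) := by
        intro z; ext l
        rw [Function.update_of_ne]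
        intro hh
        have := congrArg Fin.val hh
        simp at this
        omega
      simp only [Fin.cast_refl, id, h1, h2, a.map_update_add, add_mul]
    | right i =>
      have h1 : ∀ z : V, (fun l => Function.update v (Fin.natAdd p i) z (Fin.natAdd p l)) =
          Function.update (fun l => v (Fin.natAdd p l)) i z := by
        intro z; ext l
        simp [Function.update_apply]
      have h2 : ∀ z : V, (fun l => Function.update v (Fin.natAdd p i) z (Fin.castAdd q l)) =
          (fun l => v (Fin.castAdd q l)) := by
        intro z; ext l
        rw [Function.update_of_ne]
        intro hh
        have := congrArg Fin.val hh
        simp at this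
        omega
      simp only [Fin.cast_refl, id, h1, h2, b.map_update_add, mul_add]
  map_update_smul' := by
    subst h
    intro inst v i c x
    obtain rfl : inst = instDecidableEqFin _ := Subsingleton.elim _ _
    induction i using Fin.addCases with
    | left i =>
      have h1 : ∀ z : V, (fun l => Function.update v (Fin.castAdd q i) z (Fin.castAdd q l)) =
          Function.update (fun l => v (Fin.castAdd q l)) i z := by
        intro z; ext l
        simp [Function.update_apply]
      have h2 : ∀ z : V, (fun l => Function.update v (Fin.castAdd q i) z (Fin.natAdd p l)) =
          (fun l => v (Fin.natAdd p l)) := by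
        intro z; ext l
        rw [Function.update_of_ne]
        intro hh
        have := congrArg Fin.val hh
        simp at this
        omega
      simp only [Fin.cast_refl, id, h1, h2, a.map_update_smul, smul_mul_assoc]
    | right i =>
      have h1 : ∀ z : V, (fun l => Function.update v (Fin.natAdd p i) z (Fin.natAdd p l)) =
          Function.update (fun l => v (Fin.natAdd p l)) i z := by
        intro z; ext l
        simp [Function.update_apply]
      have h2 : ∀ z : V, (fun l => Function.update v (Fin.natAdd p i) z (Fin.castAdd q l)) =
          (fun l => v (Fin.castAdd q l)) := by
        intro z; ext l
        rw [Function.update_of_ne]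
        intro hh
        have := congrArg Fin.val hh
        simp at this
        omega
      simp only [Fin.cast_refl, id, h1, h2, b.map_update_smul, mul_smul_comm]
  cont := (a.cont.comp (continuous_pi fun _ => continuous_apply _)).mul
    (b.cont.comp (continuous_pi fun _ => continuous_apply _))

/-- The wedge product of complex-valued alternating forms,
`(a ∧ b) v = 1 / (p! q!) ∑ σ, sign σ * a (v_{σ 0}, …, v_{σ (p-1)}) * b (v_{σ p}, …)`;
for covectors this is `(a ∧ b) (v, w) = a v * b w - a w * b v`. -/
def formWedge {p q n : ℕ} (h : p + q = n) (a : V [⋀^Fin p]→L[ℝ] ℂ) (b : V [⋀^Fin q]→L[ℝ] ℂ) :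
    V [⋀^Fin n]→L[ℝ] ℂ :=
  ((Nat.factorial p * Nat.factorial q : ℂ)⁻¹) •
    ContinuousMultilinearMap.alternatization (formTensor h a b)

/-- The component of type `(p, k - p)` of a complex-valued `k`-form `a`, with respect to a complex
structure `J`. If `a_ℂ` is the complex multilinear extension of `a` to `V ⊗ ℂ`, it is
`v ↦ ∑ S, a_ℂ (w₁, …, w_k)`, the sum being over the sets `S` of `p` slots, where
`w_i = v_i^{1,0} = ½ v_i - √-1 ½ J v_i` for `i ∈ S` and
`w_i = v_i^{0,1} = ½ v_i + √-1 ½ J v_i` for `i ∉ S`.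
The complex extension is written out: `a_ℂ (x₁ + √-1 y₁, …, x_k + √-1 y_k)` is the sum over the
sets `T` of slots of `√-1 ^ |T|` times the value of `a` at `y_i` (`i ∈ T`), `x_i` (`i ∉ T`). -/
def typePart (J : V →L[ℝ] V) {k : ℕ} (p : ℕ) (a : V [⋀^Fin k]→L[ℝ] ℂ) : V [⋀^Fin k]→L[ℝ] ℂ where
  toContinuousMultilinearMap :=
    ∑ S ∈ Finset.powersetCard p (Finset.univ : Finset (Fin k)), ∑ T : Finset (Fin k),
      Complex.I ^ T.card • a.toContinuousMultilinearMap.compContinuousLinearMap (fun i =>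
        if i ∈ T then (if i ∈ S then (-(1 / 2) : ℝ) else (1 / 2 : ℝ)) • J
        else (1 / 2 : ℝ) • ContinuousLinearMap.id ℝ V)
  map_eq_zero_of_eq' := by
    intro v i j hv hij
    set F : Finset (Fin k) → Finset (Fin k) → ℂ := fun S T =>
      Complex.I ^ T.card * a (fun i => (if i ∈ T then
        (if i ∈ S then (-(1 / 2) : ℝ) else (1 / 2 : ℝ)) • J
        else (1 / 2 : ℝ) • ContinuousLinearMap.id ℝ V) (v i)) with hF
    have hvs : ∀ l, v (Equiv.swap i j l) = v l := by
      intro l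
      rcases eq_or_ne l i with rfl | h1
      · simp [hv]
      · rcases eq_or_ne l j with rfl | h2
        · simp [hv]
        · rw [Equiv.swap_apply_of_ne_of_ne h1 h2]
    have hneg : ∀ S T, F (S.map (Equiv.swap i j).toEmbedding) (T.map (Equiv.swap i j).toEmbedding)
        = - F S T := by
      intro S T
      have hm : ∀ (U : Finset (Fin k)) (l : Fin k),
          l ∈ U.map (Equiv.swap i j).toEmbedding ↔ Equiv.swap i j l ∈ U := by
        intro U l
        simp [Finset.mem_map_equiv]
      simp only [hF, Finset.card_map, hm, ← mul_neg]
      congr 1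
      have := a.toAlternatingMap.map_swap (fun l => (if l ∈ T then
        (if l ∈ S then (-(1 / 2) : ℝ) else (1 / 2 : ℝ)) • J
        else (1 / 2 : ℝ) • ContinuousLinearMap.id ℝ V) (v l)) hij
      simp only [ContinuousAlternatingMap.coe_toAlternatingMap, Function.comp_def, hvs] at this
      exact this
    have hre : ∑ S ∈ Finset.powersetCard p (Finset.univ : Finset (Fin k)),
          ∑ T : Finset (Fin k), F S T =
        ∑ S ∈ Finset.powersetCard p (Finset.univ : Finset (Fin k)),
          ∑ T : Finset (Fin k), - F S T := by
      refine Finset.sum_equiv (Equiv.swap i j).finsetCongr ?_ ?_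
      · intro S
        simp [Finset.mem_powersetCard]
      · intro S _
        refine Finset.sum_equiv (Equiv.swap i j).finsetCongr (by simp) ?_
        intro T _
        rw [Equiv.finsetCongr_apply, Equiv.finsetCongr_apply, hneg, neg_neg]
    simp only [Finset.sum_neg_distrib] at hre
    have h0 := CharZero.eq_neg_self_iff.mp hre
    simpa [hF] using h0

/-- The `2`-form `(v, w) ↦ g (J v, w)` on a vector space with a scalar product `g` and a compatible
complex structure `J`. -/
def hermitianTwoForm (g : V →L[ℝ] V →L[ℝ] ℝ) (J : V →L[ℝ] V)
    (hg : Continuous fun v : V × V => g v.1 v.2) (hJ : ∀ v, g (J v) v = 0) :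
    V [⋀^Fin 2]→L[ℝ] ℂ where
  toFun v := (g (J (v 0)) (v 1) : ℂ)
  map_update_add' := by
    intro inst v i x y
    fin_cases i <;> simp
  map_update_smul' := by
    intro inst v i c x
    fin_cases i <;> simp
  cont := Complex.continuous_ofReal.comp (hg.comp
    ((J.continuous.comp (continuous_apply 0)).prodMk (continuous_apply 1)))
  map_eq_zero_of_eq' := by
    intro v i j hv hij
    have h01 : v 0 = v 1 := by
      fin_cases i <;> fin_cases j <;> simp_all
    simp [h01, hJ]

/-- The Gram matrix `(g (b_i, b_j))` of a frame `b`. -/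
def gramMatrix (g : V →L[ℝ] V →L[ℝ] ℝ) {m : ℕ} (b : Fin m → V) : Matrix (Fin m) (Fin m) ℝ :=
  Matrix.of fun i j => g (b i) (b j)

/-- The Hermitian product of complex-valued `k`-forms induced by a scalar product `g`, computed in
a basis `b` (on which it does not depend): with `g^{ij}` the inverse Gram matrix,
`⟨α, β⟩ = 1 / k! ∑ g^{i₁ j₁} ⋯ g^{i_k j_k} α (b_{i₁}, …, b_{i_k}) conj (β (b_{j₁}, …, b_{j_k}))`.
For an orthonormal basis `b` the products of distinct vectors of the dual basis, indices
increasing, are orthonormal. -/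
def formInner (g : V →L[ℝ] V →L[ℝ] ℝ) {m : ℕ} (b : Fin m → V) {k : ℕ}
    (α β : V [⋀^Fin k]→L[ℝ] ℂ) : ℂ :=
  (Nat.factorial k : ℂ)⁻¹ * ∑ i : Fin k → Fin m, ∑ j : Fin k → Fin m,
    ((∏ s, (gramMatrix g b)⁻¹ (i s) (j s) : ℝ) : ℂ) *
      (α (fun s => b (i s)) * conj (β (fun s => b (j s))))

end LinearAlgebra

/-! ### Differential forms on a manifold -/

section Manifold

variable (m : ℕ) (M : Type*) [TopologicalSpace M] [ChartedSpace (EuclideanSpace ℝ (Fin m)) M]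

/-- Complex-valued (not necessarily smooth) differential `k`-forms on the `m`-manifold `M`. -/
abbrev DiffForm (k : ℕ) : Type _ := (x : M) → TangentSpace (𝓡 m) x [⋀^Fin k]→L[ℝ] ℂ

/-- Inhomogeneous differential forms `α = (α₀, α₁, …)`, with `α_k` a `k`-form. As `α_k = 0` for
`k > m`, this is the direct sum of the spaces of `k`-forms. -/
abbrev TotalForm : Type _ := (k : ℕ) → DiffForm m M k

variable {m M}

/-- A `k`-form in the chart `e`: its pull-back under the inverse of `e`. -/
def DiffForm.inChart (e : OpenPartialHomeomorph M (EuclideanSpace ℝ (Fin m))) {k : ℕ}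
    (α : DiffForm m M k) (y : EuclideanSpace ℝ (Fin m)) :
    EuclideanSpace ℝ (Fin m) [⋀^Fin k]→L[ℝ] ℂ :=
  (α (e.symm y)).compContinuousLinearMap (mfderiv (𝓡 m) (𝓡 m) e.symm y)

/-- The exterior derivative of a `k`-form, computed at each point in the preferred chart there. -/
def DiffForm.extD {k : ℕ} (α : DiffForm m M k) : DiffForm m M (k + 1) := fun x =>
  (extDeriv (α.inChart (chartAt (EuclideanSpace ℝ (Fin m)) x))
    (chartAt (EuclideanSpace ℝ (Fin m)) x x)).compContinuousLinearMap
      (mfderiv (𝓡 m) (𝓡 m) (chartAt (EuclideanSpace ℝ (Fin m)) x) x)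

/-- Smoothness of an inhomogeneous form: every component is smooth in every smooth chart. -/
def TotalForm.IsSmooth (α : TotalForm m M) : Prop :=
  ∀ k, ∀ e ∈ IsManifold.maximalAtlas (𝓡 m) ∞ M, ContDiffOn ℝ ∞ ((α k).inChart e) e.target

/-- `α` vanishes outside a compact subset of `U`. -/
def TotalForm.HasCompactSupportIn (α : TotalForm m M) (U : Set M) : Prop :=
  ∃ K : Set M, IsCompact K ∧ K ⊆ U ∧ ∀ k, ∀ x ∉ K, α k x = 0

/-- The coordinate frame of the chart `e` at the point with coordinates `y`. -/
def coordFrame (e : OpenPartialHomeomorph M (EuclideanSpace ℝ (Fin m)))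
    (y : EuclideanSpace ℝ (Fin m)) (i : Fin m) : TangentSpace (𝓡 m) (e.symm y) :=
  mfderiv (𝓡 m) (𝓡 m) e.symm y (EuclideanSpace.single i (1 : ℝ))

variable (m M) in
/-- The structure of an almost complex Hermitian manifold: a smooth Riemannian metric `g` and a
smooth almost complex structure `J` (a section of the endomorphisms of the tangent bundle with
`J² = -1`) which preserves `g`. -/
structure AlmostHermitianStructure [IsManifold (𝓡 m) ∞ M] where
  g : Bundle.ContMDiffRiemannianMetric (𝓡 m) ∞ (EuclideanSpace ℝ (Fin m))
    (fun x : M => TangentSpace (𝓡 m) x)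
  J : (x : M) → TangentSpace (𝓡 m) x →L[ℝ] TangentSpace (𝓡 m) x
  contMDiff_J : ContMDiff (𝓡 m)
    ((𝓡 m).prod 𝓘(ℝ, EuclideanSpace ℝ (Fin m) →L[ℝ] EuclideanSpace ℝ (Fin m))) ∞
    (fun x => Bundle.TotalSpace.mk' (EuclideanSpace ℝ (Fin m) →L[ℝ] EuclideanSpace ℝ (Fin m))
      (E := fun x : M => TangentSpace (𝓡 m) x →L[ℝ] TangentSpace (𝓡 m) x) x (J x))
  J_J : ∀ x v, J x (J x v) = -v
  g_J_J : ∀ x v w, g.inner x (J x v) (J x w) = g.inner x v w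

namespace AlmostHermitianStructure

variable [IsManifold (𝓡 m) ∞ M] (H : AlmostHermitianStructure m M)

theorem continuous_inner (x : M) :
    Continuous fun v : TangentSpace (𝓡 m) x × TangentSpace (𝓡 m) x => H.g.inner x v.1 v.2 :=
  ContinuousLinearMap.continuous₂ (E := EuclideanSpace ℝ (Fin m)) (F := EuclideanSpace ℝ (Fin m))
    (H.g.inner x : EuclideanSpace ℝ (Fin m) →L[ℝ] EuclideanSpace ℝ (Fin m) →L[ℝ] ℝ)

theorem inner_J_self (x : M) (v : TangentSpace (𝓡 m) x) : H.g.inner x (H.J x v) v = 0 := by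
  have h1 := H.g_J_J x v (H.J x v)
  have h2 := H.g.symm x (H.J x v) v
  rw [H.J_J, map_neg] at h1
  linarith

/-- The Hermitian form `ω (v, w) = g (J v, w)`. -/
def omega : DiffForm m M 2 := fun x =>
  hermitianTwoForm (H.g.inner x) (H.J x) (H.continuous_inner x) (H.inner_J_self x)

/-- The operator `∂` on `k`-forms: on forms of type `(p, q)` it is the component of type
`(p + 1, q)` of the exterior derivative. -/
def delForm {k : ℕ} (α : DiffForm m M k) : DiffForm m M (k + 1) := fun x =>
  ∑ p ∈ Finset.range (k + 1),
    typePart (H.J x) (p + 1) (DiffForm.extD (fun y => typePart (H.J y) p (α y)) x)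

/-- The operator `∂̄` on `k`-forms: on forms of type `(p, q)` it is the component of type
`(p, q + 1)` of the exterior derivative. -/
def delbarForm {k : ℕ} (α : DiffForm m M k) : DiffForm m M (k + 1) := fun x =>
  ∑ p ∈ Finset.range (k + 1),
    typePart (H.J x) p (DiffForm.extD (fun y => typePart (H.J y) p (α y)) x)

/-- `∂` on inhomogeneous forms. -/
def del (α : TotalForm m M) : TotalForm m M
  | 0 => 0
  | k + 1 => H.delForm (α k)

/-- `∂̄` on inhomogeneous forms. -/
def delbar (α : TotalForm m M) : TotalForm m M
  | 0 => 0
  | k + 1 => H.delbarForm (α k)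

/-- The operator `L_ω`, `η ↦ ω ∧ η`. -/
def lefschetz (α : TotalForm m M) : TotalForm m M
  | 0 => 0
  | 1 => 0
  | k + 2 => fun x => formWedge (Nat.add_comm 2 k) (H.omega x) (α k x)

/-- The `L²` product `∫ ⟨α, β⟩ dvol` over the domain of the chart `e`, where
`dvol = √(det g_{ij}) dy` is the Riemannian volume and forms of different degrees are orthogonal. -/
def l2Pairing (e : OpenPartialHomeomorph M (EuclideanSpace ℝ (Fin m))) (α β : TotalForm m M) : ℂ :=
  ∫ y in e.target,
    ((√(gramMatrix (H.g.inner (e.symm y)) (coordFrame e y)).det : ℝ) : ℂ) *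
      ∑ k ∈ Finset.range (m + 1),
        formInner (H.g.inner (e.symm y)) (coordFrame e y) (α k (e.symm y)) (β k (e.symm y))

/-- `γ` is a value at `β` of the Hermitian adjoint of `D`: it is a smooth form such that
`∫ ⟨D α, β⟩ dvol = ∫ ⟨α, γ⟩ dvol` for all smooth test forms `α` with compact support in the domain
of a chart. (By a partition of unity, every smooth form with compact support is a finite sum of such
test forms.) -/
def IsAdjointAt (D : TotalForm m M → TotalForm m M) (β γ : TotalForm m M) : Prop :=
  γ.IsSmooth ∧ ∀ e ∈ IsManifold.maximalAtlas (𝓡 m) ∞ M, ∀ α : TotalForm m M, α.IsSmooth →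
    α.HasCompactSupportIn e.source → H.l2Pairing e (D α) β = H.l2Pairing e α γ

/-- `D'` is the Hermitian (formal `L²`) adjoint of `D` on smooth forms. -/
def IsAdjoint (D D' : TotalForm m M → TotalForm m M) : Prop :=
  ∀ β : TotalForm m M, β.IsSmooth → H.IsAdjointAt D β (D' β)

open scoped Classical in
/-- The Hermitian adjoint of `D`; zero on those forms at which no adjoint exists. -/
def adjoint (D : TotalForm m M → TotalForm m M) (β : TotalForm m M) : TotalForm m M :=
  if h : ∃ γ, H.IsAdjointAt D β γ then h.choose else 0

/-- The operator `Λ_ω`, the Hermitian adjoint of `L_ω`. -/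
def lambda : TotalForm m M → TotalForm m M := H.adjoint H.lefschetz

/-- The operator `∂*`, the Hermitian adjoint of `∂`. -/
def delStar : TotalForm m M → TotalForm m M := H.adjoint H.del

/-- The operator `∂̄*`, the Hermitian adjoint of `∂̄`. -/
def delbarStar : TotalForm m M → TotalForm m M := H.adjoint H.delbar

end AlmostHermitianStructure

end Manifold

end

/-! Forms are graded by the weight p - q. Let W be the derivation of the algebra of forms induced by
J; it acts on forms of type (p, q) as √-1 (p - q). Let δ_s be the part of d that raises the weight
by s. As d raises the degree by one, δ_1 = ∂ and δ_{-1} = ∂̄.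

In a chart let ∇ be the Levi-Civita connection. Then d is the alternation of ∇, and its formal
adjoint d* is minus the metric contraction of ∇. Expanding d*(ω ∧ α) by the Leibniz rule and
comparing with dW - Wd gives [L, d*] = [d, W] + T, where T is an algebraic operator, linear in ∇J
(`wedgeOmega_dstar`, `tors`). On a Kähler manifold T = 0. In general the hypothesis on dω controls T
in two steps.

First, dω is the cyclic sum of g((∇_X J) Y, Z). If it has type (3,0) + (0,3), then ∇_{Jv} J = (∇_v
J) ∘ J (`HermAt.covEnd_comp`, `cov_J_of_type`): the failure of this relation is a trilinear form
symmetric in its first two arguments and skew in its last two, hence zero. Second, with this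
relation each place where ∇J enters T contributes equally to the commutator with W, and there are
three such places, so that [W, [W, T]] = -9 T (`der_tors`). Hence T shifts the weight by 3 or -3
only (`weight_tors`).

Now take s = ±1 and the part of the identity that lowers the weight by s. L preserves the weight, T
drops out, and on this part [d, W] is √-1 s δ_{-s}. The result is the pointwise identity [L, δ_s*] =
√-1 s δ_{-s} (`HermAt.wedgeOmega_delStarS`), where δ_s* is the corresponding part of d*, known only
through a formula in a chart.

These local formulas are not glued. Taking adjoints in the identity suggests √-1 s [δ_s, Λ] as the
adjoint of δ_{-s}, and this operator is globally defined because δ_s and Λ are. In a chart the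
defect of adjointness is the divergence of a vector field (`HermAt.divergence_adjFlux`), supported
where the test form is, so it integrates to zero (`IsDelS.l2Pairing`). This yields the existence of
∂* and ∂̄* and the first pair of identities at once, since adjoints are unique
(`eq_zero_of_l2Pairing_eq_zero`). The second pair follows by pairing with compactly supported forms
(`IsDelS.lefschetz_adjoint`).

The algebra at a point is done by contractions: a form of positive degree is determined by its
contractions with vectors, and all operators in use have simple commutation rules with them. Most
identities thus become inductions on the degree. -/

noncomputable section

/-! ### The algebra of forms at a point -/

/-- The model space. -/
abbrev Euc (m : ℕ) : Type := EuclideanSpace ℝ (Fin m)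

/-- Inhomogeneous complex-valued forms on `ℝᵐ` at a point. -/
abbrev GForm (m : ℕ) : Type := (k : ℕ) → Euc m [⋀^Fin k]→L[ℝ] ℂ

/-- The standard basis of `ℝᵐ`. -/
abbrev stdVec {m : ℕ} (i : Fin m) : Euc m := EuclideanSpace.single i (1 : ℝ)

namespace GForm

open ContinuousAlternatingMap

variable {m : ℕ}

theorem sum_coord (v : Euc m) : ∑ i, v i • stdVec i = v := by
  ext j
  simp [Finset.sum_apply, Pi.single_apply]

theorem _root_.IsLinearMap.sum_coord {X : Type*} [AddCommGroup X] [Module ℝ X] {F : Euc m → X}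
    (hF : IsLinearMap ℝ F) (v : Euc m) : ∑ i, v i • F (stdVec i) = F v := by
  conv_rhs => rw [← GForm.sum_coord v]
  change _ = hF.mk' F _
  simp

theorem radd_smul (a b : ℝ) (α : GForm m) : (a + b) • α = a • α + b • α := add_smul a b α

theorem rmul_smul (a b : ℝ) (α : GForm m) : (a * b) • α = a • b • α := mul_smul a b α

theorem rneg_smul (a : ℝ) (α : GForm m) : (-a) • α = -(a • α) := neg_smul a α

theorem rzero_smul (α : GForm m) : (0 : ℝ) • α = 0 := zero_smul ℝ α

theorem cadd_smul (a b : ℂ) (α : GForm m) : (a + b) • α = a • α + b • α := add_smul a b α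

theorem cmul_smul (a b : ℂ) (α : GForm m) : (a * b) • α = a • b • α := mul_smul a b α

theorem cneg_smul (a : ℂ) (α : GForm m) : (-a) • α = -(a • α) := neg_smul a α

theorem cone_smul (α : GForm m) : (1 : ℂ) • α = α := one_smul ℂ α

theorem czero_smul (α : GForm m) : (0 : ℂ) • α = 0 := zero_smul ℂ α

theorem real_smul_eq (c : ℝ) (α : GForm m) : c • α = (c : ℂ) • α := by
  funext k; ext u; simp

/-- Contraction with a vector. -/
def contr (v : Euc m) : GForm m →ₗ[ℂ] GForm m where
  toFun α := fun k => (α (k + 1)).curryLeft v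
  map_add' α β := by ext; simp
  map_smul' c α := by ext; simp

theorem contr_apply (v : Euc m) (α : GForm m) (k : ℕ) :
    contr v α k = (α (k + 1)).curryLeft v := rfl

theorem contr_apply_apply (v : Euc m) (α : GForm m) (k : ℕ) (u : Fin k → Euc m) :
    contr v α k u = α (k + 1) (Fin.cons v u) := rfl

@[simp] theorem contr_add_left (v w : Euc m) (α : GForm m) :
    contr (v + w) α = contr v α + contr w α := by
  funext k; simp [contr_apply]

@[simp] theorem contr_smul_left (c : ℝ) (v : Euc m) (α : GForm m) :
    contr (c • v) α = c • contr v α := by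
  funext k; simp [contr_apply]

@[simp] theorem contr_neg_left (v : Euc m) (α : GForm m) :
    contr (-v) α = -contr v α := by
  funext k; simp [contr_apply]

@[simp] theorem contr_sub_left (v w : Euc m) (α : GForm m) :
    contr (v - w) α = contr v α - contr w α := by
  funext k; simp [contr_apply]

theorem map_real_smul (A : GForm m →ₗ[ℂ] GForm m) (c : ℝ) (α : GForm m) :
    A (c • α) = c • A α := by
  rw [real_smul_eq, real_smul_eq, map_smul]

/-- Polarization of the vanishing of the square of a contraction. -/
theorem contr_contr (v w : Euc m) (α : GForm m) :
    contr v (contr w α) = -contr w (contr v α) := by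
  have h : ∀ x, contr x (contr x α) = 0 := fun x => by
    funext k
    exact curryLeft_same (α (k + 2)) x
  have h1 := h (v + w)
  simp only [contr_add_left, map_add, h, zero_add, add_zero] at h1
  exact eq_neg_of_add_eq_zero_right h1

theorem isLinear_contr (α : GForm m) : IsLinearMap ℝ fun v => contr v α :=
  ⟨fun _ _ => contr_add_left _ _ _, fun _ _ => contr_smul_left _ _ _⟩

/-- The principle behind the inductions on the degree below: two operators agree in degree k + 1 as
soon as their contractions agree in degree k. -/
theorem ext_succ {k : ℕ} {α β : GForm m} (h : ∀ v, contr v α k = contr v β k) :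
    α (k + 1) = β (k + 1) := by
  ext u
  have := congrArg (fun f => f (Fin.tail u)) (h (u 0))
  simpa [contr_apply_apply] using this

/-- The continuous linear extension of a function on the standard basis. -/
def linExt {X : Type*} [NormedAddCommGroup X] [NormedSpace ℝ X] (F : Fin m → X) :
    Euc m →L[ℝ] X :=
  ∑ i, (EuclideanSpace.proj i : Euc m →L[ℝ] ℝ).smulRight (F i)

theorem linExt_apply {X : Type*} [NormedAddCommGroup X] [NormedSpace ℝ X] (F : Fin m → X)
    (v : Euc m) : linExt F v = ∑ i, v i • F i := by
  simp [linExt]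

/-- The form `∑ i, e^i ∧ F (e_i)`. -/
def alt (F : Euc m → GForm m) : GForm m
  | 0 => 0
  | k + 1 => alternatizeUncurryFin (linExt fun i => F (stdVec i) k)

theorem alt_zero (F : Euc m → GForm m) : alt F 0 = 0 := rfl

theorem alt_succ (F : Euc m → GForm m) (k : ℕ) :
    alt F (k + 1) = alternatizeUncurryFin (linExt fun i => F (stdVec i) k) := rfl

theorem isLinear_apply {F : Euc m → GForm m} (hF : IsLinearMap ℝ F) (k : ℕ) :
    IsLinearMap ℝ fun v => F v k :=
  ⟨fun x y => by rw [hF.map_add]; rfl, fun c x => by rw [hF.map_smul]; rfl⟩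

theorem linExt_eq {F : Euc m → GForm m} (hF : IsLinearMap ℝ F) (k : ℕ) (v : Euc m) :
    linExt (fun i => F (stdVec i) k) v = F v k := by
  rw [linExt_apply]
  exact (isLinear_apply hF k).sum_coord v

theorem alt_apply {F : Euc m → GForm m} (hF : IsLinearMap ℝ F) (k : ℕ) (u : Fin (k + 1) → Euc m) :
    alt F (k + 1) u = ∑ i : Fin (k + 1), (-1) ^ (i : ℕ) * F (u i) k (i.removeNth u) := by
  simp [alt_succ, alternatizeUncurryFin_apply, linExt_eq hF]

theorem alt_eq_alternatize {F : Euc m → GForm m} {k : ℕ} (f : Euc m →L[ℝ] Euc m [⋀^Fin k]→L[ℝ] ℂ)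
    (h : ∀ i, F (stdVec i) k = f (stdVec i)) : alt F (k + 1) = alternatizeUncurryFin f := by
  rw [alt_succ]
  congr 1
  ext1 v
  rw [linExt_apply]
  simp only [h]
  exact IsLinearMap.sum_coord (F := fun v => f v) ⟨map_add f, fun c x => map_smul f c x⟩ v

theorem alt_congr {F G : Euc m → GForm m} (h : ∀ i, F (stdVec i) = G (stdVec i)) :
    alt F = alt G := by
  funext k
  cases k with
  | zero => rfl
  | succ k => simp [alt_succ, h]

theorem alt_add (F G : Euc m → GForm m) : alt (fun v => F v + G v) = alt F + alt G := by
  funext k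
  cases k with
  | zero => simp [alt_zero]
  | succ k =>
    rw [Pi.add_apply]
    simp only [alt_succ]
    rw [← alternatizeUncurryFin_add]
    congr 1
    ext1 v
    simp [linExt_apply, Finset.sum_add_distrib]

theorem alt_smul {S : Type*} [Monoid S] [DistribMulAction S ℂ] [ContinuousConstSMul S ℂ]
    [SMulCommClass ℝ S ℂ] (c : S) (F : Euc m → GForm m) :
    alt (fun v => c • F v) = c • alt F := by
  funext k
  cases k with
  | zero => simp only [alt_zero, Pi.smul_apply]; ext u; simp
  | succ k =>
    rw [Pi.smul_apply]
    simp only [alt_succ]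
    rw [← alternatizeUncurryFin_smul]
    congr 1
    ext1 v
    simp only [linExt_apply, Pi.smul_apply, _root_.smul_apply, Finset.smul_sum]
    exact Finset.sum_congr rfl fun i _ => smul_comm _ _ _

theorem alt_neg (F : Euc m → GForm m) : alt (fun v => -F v) = -alt F := by
  have := alt_smul (-1 : ℂ) F
  simpa only [cneg_smul, cone_smul] using this

theorem alt_sub (F G : Euc m → GForm m) : alt (fun v => F v - G v) = alt F - alt G := by
  simp only [sub_eq_add_neg, alt_add, alt_neg]

theorem alt_zero_fun : alt (fun _ : Euc m => (0 : GForm m)) = 0 := by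
  have := alt_smul (0 : ℂ) (fun _ : Euc m => (0 : GForm m))
  simpa only [czero_smul] using this

theorem alt_sum {ι : Type*} (s : Finset ι) (F : ι → Euc m → GForm m) :
    alt (fun v => ∑ i ∈ s, F i v) = ∑ i ∈ s, alt (F i) := by
  classical
  induction s using Finset.induction_on with
  | empty => simp [alt_zero_fun]
  | insert a s ha ih => simp only [Finset.sum_insert ha, alt_add, ih]

/-- Contraction is an antiderivation. -/
theorem contr_alt {F : Euc m → GForm m} (hF : IsLinearMap ℝ F) (v : Euc m) :
    contr v (alt F) = F v - alt fun w => contr v (F w) := by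
  have hF' : IsLinearMap ℝ fun w => contr v (F w) :=
    ⟨fun x y => by rw [hF.map_add, map_add], fun c x => by rw [hF.map_smul, map_real_smul]⟩
  funext k
  ext u
  rw [contr_apply_apply, alt_apply hF, Fin.sum_univ_succ]
  cases k with
  | zero => simp [alt_zero]
  | succ k =>
    rw [Pi.sub_apply, ContinuousAlternatingMap.sub_apply, alt_apply hF', sub_eq_add_neg,
      ← Finset.sum_neg_distrib]
    congr 1
    · simp [Fin.removeNth_zero]
    · refine Finset.sum_congr rfl fun i _ => ?_
      rw [contr_apply_apply]
      have : i.succ.removeNth (Fin.cons v u : Fin (k + 2) → Euc m) =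
          Fin.cons v (i.removeNth u) := by
        funext j
        refine Fin.cases ?_ (fun j => ?_) j <;> simp [Fin.removeNth]
      rw [this]
      simp [pow_succ]

theorem isLinear_contr_comp (v : Euc m) {F : Euc m → GForm m} (hF : IsLinearMap ℝ F) :
    IsLinearMap ℝ fun w => contr v (F w) :=
  ⟨fun x y => by rw [hF.map_add, map_add], fun c x => by rw [hF.map_smul, map_real_smul]⟩

theorem isLinear_contr_lin (K : Euc m →ₗ[ℝ] Euc m) (α : GForm m) :
    IsLinearMap ℝ fun v => contr (K v) α :=
  ⟨fun x y => by simp, fun c x => by simp⟩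

/-- The derivation of the algebra of forms defined by an endomorphism,
`α ↦ ∑ i, α (v₁, …, K v_i, …)`. -/
def der (K : Euc m →ₗ[ℝ] Euc m) : GForm m →ₗ[ℂ] GForm m where
  toFun α := alt fun v => contr (K v) α
  map_add' α β := by simp only [map_add, alt_add]
  map_smul' c α := by simp only [map_smul, alt_smul, RingHom.id_apply]

theorem der_def (K : Euc m →ₗ[ℝ] Euc m) (α : GForm m) :
    der K α = alt fun v => contr (K v) α := rfl

theorem der_zero_apply (K : Euc m →ₗ[ℝ] Euc m) (α : GForm m) : der K α 0 = 0 := rfl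

theorem contr_der (K : Euc m →ₗ[ℝ] Euc m) (v : Euc m) (α : GForm m) :
    contr v (der K α) = contr (K v) α + der K (contr v α) := by
  rw [der_def, contr_alt (isLinear_contr_lin K α), der_def, sub_eq_add_neg, ← alt_neg]
  congr 2
  funext w
  rw [contr_contr v, neg_neg]

theorem der_add (K K' : Euc m →ₗ[ℝ] Euc m) (α : GForm m) :
    der (K + K') α = der K α + der K' α := by
  simp [der_def, alt_add]

theorem der_smul (c : ℝ) (K : Euc m →ₗ[ℝ] Euc m) (α : GForm m) :
    der (c • K) α = c • der K α := by
  simp [der_def, alt_smul]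

theorem der_sub (K K' : Euc m →ₗ[ℝ] Euc m) (α : GForm m) :
    der (K - K') α = der K α - der K' α := by
  simp [der_def, alt_sub]

theorem isLinear_der_comp (K : Euc m →ₗ[ℝ] Euc m) {F : Euc m → GForm m} (hF : IsLinearMap ℝ F) :
    IsLinearMap ℝ fun w => der K (F w) :=
  ⟨fun x y => by rw [hF.map_add, map_add], fun c x => by rw [hF.map_smul, map_real_smul]⟩

theorem isLinear_comp (K : Euc m →ₗ[ℝ] Euc m) {F : Euc m → GForm m} (hF : IsLinearMap ℝ F) :
    IsLinearMap ℝ fun w => F (K w) :=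
  ⟨fun x y => by rw [map_add, hF.map_add], fun c x => by rw [map_smul, hF.map_smul]⟩

theorem isLinear_add {F G : Euc m → GForm m} (hF : IsLinearMap ℝ F) (hG : IsLinearMap ℝ G) :
    IsLinearMap ℝ fun w => F w + G w :=
  (hF.mk' F + hG.mk' G).isLinear

/-- Leibniz rule for ∑ e^i ∧ F (e_i). The endomorphism acts on the covector e^i by transposition,
which moves K into the argument of F. -/
theorem der_alt (K : Euc m →ₗ[ℝ] Euc m) {F : Euc m → GForm m} (hF : IsLinearMap ℝ F) :
    der K (alt F) = alt fun w => der K (F w) + F (K w) := by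
  funext k
  induction k generalizing F with
  | zero => rfl
  | succ k ih =>
    refine ext_succ fun v => ?_
    rw [contr_der, contr_alt hF, contr_alt hF, map_sub, contr_alt
      (isLinear_add (isLinear_der_comp K hF) (isLinear_comp K hF))]
    simp only [Pi.add_apply, Pi.sub_apply, ih (isLinear_contr_comp v hF), map_add, contr_der,
      alt_add]
    abel

/-- Endomorphisms act on covectors by transposition, whence the reversed order of the commutator on
the right. -/
theorem der_comm (K K' : Euc m →ₗ[ℝ] Euc m) (α : GForm m) :
    der K (der K' α) - der K' (der K α) = der (K' ∘ₗ K - K ∘ₗ K') α := by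
  have h : ∀ w, der K (contr (K' w) α) = contr (K' w) (der K α) - contr (K (K' w)) α := fun w => by
    rw [contr_der]; abel
  rw [der_def K' α, der_alt K (isLinear_contr_lin K' α)]
  simp only [h, alt_add, alt_sub, der_sub]
  simp only [der_def, LinearMap.comp_apply]
  abel

/-- The reason why the Christoffel terms of a torsion-free connection drop out of the exterior
derivative. In a contraction with u, the alternations of `contr (Γ u w) α` and of `contr (Γ w u) α`
cancel, and the same sum for `contr u α` remains. -/
theorem alt_der_of_symm (Γ : Euc m →ₗ[ℝ] Euc m →ₗ[ℝ] Euc m) (hΓ : ∀ v w, Γ v w = Γ w v)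
    (α : GForm m) : alt (fun v => der (Γ v) α) = 0 := by
  have hl : ∀ α, IsLinearMap ℝ fun v => der (Γ v) α := fun α =>
    ⟨fun x y => by rw [map_add, der_add], fun c x => by rw [map_smul, der_smul]⟩
  funext k
  induction k generalizing α with
  | zero => rfl
  | succ k ih =>
    refine ext_succ fun u => ?_
    rw [contr_alt (hl α)]
    simp only [contr_der, alt_add, Pi.sub_apply, Pi.add_apply, ih, Pi.zero_apply]
    rw [der_def]
    simp [hΓ u]

/-- Left multiplication with the two-form `A`. -/
def wedgeTwo (A : Euc m →ₗ[ℝ] Euc m →ₗ[ℝ] ℝ) : GForm m →ₗ[ℂ] GForm m where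
  toFun α := (1 / 2 : ℂ) • alt fun v => alt fun w => A v w • α
  map_add' α β := by simp only [smul_add, alt_add]
  map_smul' c α := by
    have : ∀ (r : ℝ) (β : GForm m), r • c • β = c • r • β := fun r β => smul_comm _ _ _
    simp only [this, alt_smul, RingHom.id_apply]
    rw [smul_comm]

theorem wedgeTwo_def (A : Euc m →ₗ[ℝ] Euc m →ₗ[ℝ] ℝ) (α : GForm m) :
    wedgeTwo A α = (1 / 2 : ℂ) • alt fun v => alt fun w => A v w • α := rfl

theorem isLinear_smul (θ : Euc m →ₗ[ℝ] ℝ) (α : GForm m) : IsLinearMap ℝ fun v => θ v • α :=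
  ⟨fun x y => by rw [map_add, radd_smul], fun c x => by rw [map_smul, smul_eq_mul, rmul_smul]⟩

theorem isLinear_alt {A : Euc m → Euc m → GForm m} (hA : ∀ w, IsLinearMap ℝ fun v => A v w) :
    IsLinearMap ℝ fun v => alt (A v) := by
  refine ⟨fun x y => ?_, fun c x => ?_⟩
  · rw [← alt_add]; congr 1; funext w; exact (hA w).map_add x y
  · rw [← alt_smul]; congr 1; funext w; exact (hA w).map_smul c x

theorem isLinear_alt_smul (A : Euc m →ₗ[ℝ] Euc m →ₗ[ℝ] ℝ) (α : GForm m) :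
    IsLinearMap ℝ fun v => alt fun w => A v w • α :=
  isLinear_alt fun w => isLinear_smul (A.flip w) α

/-- The two slots of the skew form A contribute equally, which absorbs the factor 1/2 of the
definition. -/
theorem contr_wedgeTwo (A : Euc m →ₗ[ℝ] Euc m →ₗ[ℝ] ℝ) (hA : ∀ v w, A v w = -A w v) (v : Euc m)
    (α : GForm m) :
    contr v (wedgeTwo A α) = alt (fun w => A v w • α) + wedgeTwo A (contr v α) := by
  rw [wedgeTwo_def, map_smul, contr_alt (isLinear_alt_smul A α)]
  simp only [contr_alt (isLinear_smul (A _) α), alt_sub, map_real_smul]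
  rw [wedgeTwo_def, smul_sub, smul_sub]
  have : alt (fun w => A w v • α) = -alt fun w => A v w • α := by
    rw [← alt_neg]; congr 1; funext w; rw [hA, rneg_smul]
  rw [this, smul_neg]
  have h2 : alt (fun w => A v w • α) = (1 / 2 : ℂ) • alt (fun w => A v w • α) +
      (1 / 2 : ℂ) • alt (fun w => A v w • α) := by
    module
  conv_rhs => rw [h2]
  abel

theorem wedgeTwo_add (A B : Euc m →ₗ[ℝ] Euc m →ₗ[ℝ] ℝ) (α : GForm m) :
    wedgeTwo (A + B) α = wedgeTwo A α + wedgeTwo B α := by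
  simp only [wedgeTwo_def, LinearMap.add_apply, radd_smul, alt_add, smul_add]

theorem wedgeTwo_smul (c : ℝ) (A : Euc m →ₗ[ℝ] Euc m →ₗ[ℝ] ℝ) (α : GForm m) :
    wedgeTwo (c • A) α = c • wedgeTwo A α := by
  simp only [wedgeTwo_def, LinearMap.smul_apply, smul_eq_mul, rmul_smul, alt_smul]
  exact smul_comm _ _ _

theorem der_wedgeTwo (K : Euc m →ₗ[ℝ] Euc m) (A : Euc m →ₗ[ℝ] Euc m →ₗ[ℝ] ℝ) (α : GForm m) :
    der K (wedgeTwo A α) =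
      wedgeTwo (A.compl₁₂ K .id + A.compl₁₂ .id K) α + wedgeTwo A (der K α) := by
  rw [wedgeTwo_def, map_smul, der_alt K (isLinear_alt_smul A α)]
  simp only [der_alt K (isLinear_smul (A _) α), alt_add, map_real_smul, wedgeTwo_add]
  simp only [wedgeTwo_def, LinearMap.compl₁₂_apply, LinearMap.id_apply, smul_add]
  abel

end GForm

/-! ### The wedge product with a two-form as an iterated alternation -/

namespace GForm

open ContinuousAlternatingMap

variable {m : ℕ}

/-- A permutation of `Fin (n + 1)` is the choice of the image of `0` and a permutation of the
other elements. -/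
theorem sum_perm_succ {X : Type*} [AddCommMonoid X] {n : ℕ} (F : Equiv.Perm (Fin (n + 1)) → X) :
    ∑ σ, F σ = ∑ i : Fin (n + 1), ∑ τ : Equiv.Perm (Fin n),
      F (i.cycleRange.symm * Equiv.Perm.decomposeFin.symm (0, τ)) := by
  rw [← Fintype.sum_prod_type']
  symm
  have happ : ∀ (i : Fin (n + 1)) (τ : Equiv.Perm (Fin n)),
      (i.cycleRange.symm * Equiv.Perm.decomposeFin.symm (0, τ)) 0 = i := by
    intro i τ
    simp
  refine Fintype.sum_bijective (fun p : Fin (n + 1) × Equiv.Perm (Fin n) =>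
    p.1.cycleRange.symm * Equiv.Perm.decomposeFin.symm (0, p.2)) ?_ _ _ fun _ => rfl
  rw [Fintype.bijective_iff_injective_and_card]
  constructor
  · rintro ⟨i, τ⟩ ⟨j, ρ⟩ h
    have hij : i = j := by
      have := congrArg (fun σ : Equiv.Perm (Fin (n + 1)) => σ 0) h
      simpa only [happ] using this
    subst hij
    have h2 := mul_left_cancel h
    have h3 := Equiv.Perm.decomposeFin.symm.injective h2
    simpa using h3
  · simp [Fintype.card_perm, Nat.factorial_succ]

/-- Expansion along the first slot: the inverse of `i.cycleRange` brings the i-th argument to the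
front at the cost of the sign (-1)^i. -/
theorem alternatization_succ {n : ℕ} (f : ContinuousMultilinearMap ℝ (fun _ : Fin (n + 1) => Euc m) ℂ)
    (v : Fin (n + 1) → Euc m) :
    ContinuousMultilinearMap.alternatization f v =
      ∑ i : Fin (n + 1), (-1) ^ (i : ℕ) * ∑ τ : Equiv.Perm (Fin n),
        Equiv.Perm.sign τ • f (Fin.cons (v i) (i.removeNth v ∘ τ)) := by
  rw [ContinuousMultilinearMap.alternatization_apply_apply, sum_perm_succ]
  refine Finset.sum_congr rfl fun i _ => ?_
  rw [Finset.mul_sum]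
  refine Finset.sum_congr rfl fun τ _ => ?_
  have h1 : v ∘ (i.cycleRange.symm * Equiv.Perm.decomposeFin.symm (0, τ) : Equiv.Perm _) =
      Fin.cons (v i) (i.removeNth v ∘ τ) := by
    funext j
    refine Fin.cases ?_ (fun j => ?_) j
    · simp
    · simp [Fin.removeNth]
  rw [h1, Equiv.Perm.sign_mul, Equiv.Perm.sign_symm, Fin.sign_cycleRange,
    Equiv.Perm.decomposeFin.symm_sign]
  simp [mul_smul, Units.smul_def]

/-- Two expansions along the first slot use up the arguments of η. The remaining k! permutations act
on the arguments of the alternating form a and give equal terms, so that only 1/2! is left of the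
normalization. -/
theorem formWedge_two_apply {k : ℕ} (h : 2 + k = k + 2) (η : Euc m [⋀^Fin 2]→L[ℝ] ℂ)
    (a : Euc m [⋀^Fin k]→L[ℝ] ℂ) (v : Fin (k + 2) → Euc m) :
    formWedge h η a v = (1 / 2 : ℂ) * ∑ i : Fin (k + 2), (-1) ^ (i : ℕ) *
      ∑ j : Fin (k + 1), (-1) ^ (j : ℕ) *
        (η ![v i, i.removeNth v j] * a (j.removeNth (i.removeNth v))) := by
  have key : ∀ τ : Equiv.Perm (Fin k), ∀ u : Fin k → Euc m,
      (Equiv.Perm.sign τ : ℤˣ) • a (u ∘ τ) = a u := by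
    intro τ u
    have := a.toAlternatingMap.map_perm u τ
    simp only [coe_toAlternatingMap] at this
    have h2 : u ∘ τ = fun i => u (τ i) := rfl
    rw [h2]
    change _ • a.toAlternatingMap (fun i => u (τ i)) = _
    have h3 : a.toAlternatingMap (fun i => u (τ i)) =
      Equiv.Perm.sign τ • a.toAlternatingMap u := this
    rw [h3, smul_smul, Int.units_mul_self, one_smul]
    rfl
  have hT : ∀ (x y : Euc m) (u : Fin k → Euc m),
      formTensor h η a (Fin.cons x (Fin.cons y u)) = η ![x, y] * a u := by
    intro x y u
    change η _ * a _ = _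
    congr 2
    · funext i
      fin_cases i <;> rfl
    · funext i
      have : Fin.cast h (Fin.natAdd 2 i) = i.succ.succ := by
        ext; simp
      rw [this]; simp
  rw [formWedge]
  simp only [ContinuousAlternatingMap.smul_apply]
  rw [alternatization_succ]
  simp only [sum_perm_succ (n := k)]
  have hk : (Nat.factorial k : ℂ) ≠ 0 := by exact_mod_cast Nat.factorial_ne_zero k
  rw [smul_eq_mul, Finset.mul_sum, Finset.mul_sum]
  refine Finset.sum_congr rfl fun i _ => ?_
  have : ∀ j : Fin (k + 1), ∑ τ : Equiv.Perm (Fin k),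
      Equiv.Perm.sign (j.cycleRange.symm * Equiv.Perm.decomposeFin.symm (0, τ)) •
        formTensor h η a (Fin.cons (v i) (i.removeNth v ∘
          (j.cycleRange.symm * Equiv.Perm.decomposeFin.symm (0, τ) : Equiv.Perm _))) =
      (Nat.factorial k : ℂ) * ((-1) ^ (j : ℕ) *
        (η ![v i, i.removeNth v j] * a (j.removeNth (i.removeNth v)))) := by
    intro j
    have hτ : ∀ τ : Equiv.Perm (Fin k),
      Equiv.Perm.sign (j.cycleRange.symm * Equiv.Perm.decomposeFin.symm (0, τ)) •
        formTensor h η a (Fin.cons (v i) (i.removeNth v ∘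
          (j.cycleRange.symm * Equiv.Perm.decomposeFin.symm (0, τ) : Equiv.Perm _))) =
      ((-1) ^ (j : ℕ) * (η ![v i, i.removeNth v j] * a (j.removeNth (i.removeNth v)))) := by
      intro τ
      have h1 : i.removeNth v ∘ (j.cycleRange.symm * Equiv.Perm.decomposeFin.symm (0, τ) :
          Equiv.Perm _) = Fin.cons (i.removeNth v j) (j.removeNth (i.removeNth v) ∘ τ) := by
        funext l
        refine Fin.cases ?_ (fun l => ?_) l
        · simp
        · simp [Fin.removeNth]
      rw [h1, hT, Equiv.Perm.sign_mul, Equiv.Perm.sign_symm, Fin.sign_cycleRange,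
        Equiv.Perm.decomposeFin.symm_sign, ← key τ (j.removeNth (i.removeNth v))]
      simp [mul_smul, Units.smul_def]
      ring
    rw [Finset.sum_congr rfl fun τ _ => hτ τ]
    simp [Fintype.card_perm]
  rw [Finset.sum_congr rfl fun j _ => this j, ← Finset.mul_sum]
  simp only [Nat.factorial]
  field_simp
  push_cast
  ring

/-- The wedge product with a two-form. -/
theorem formWedge_eq_wedgeTwo {k : ℕ} (h : 2 + k = k + 2) (η : Euc m [⋀^Fin 2]→L[ℝ] ℂ)
    (A : Euc m →ₗ[ℝ] Euc m →ₗ[ℝ] ℝ) (hA : ∀ v w, η ![v, w] = A v w) (α : GForm m) :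
    formWedge h η (α k) = wedgeTwo A α (k + 2) := by
  ext v
  rw [formWedge_two_apply, wedgeTwo_def, Pi.smul_apply, ContinuousAlternatingMap.smul_apply,
    alt_apply (isLinear_alt_smul A α), smul_eq_mul]
  simp only [alt_apply (isLinear_smul (A _) α), Pi.smul_apply, ContinuousAlternatingMap.smul_apply,
    hA, Complex.real_smul]

end GForm

/-! ### Components of type (p, q) and contractions -/

namespace GForm

open ContinuousAlternatingMap

variable {m : ℕ}

theorem sum_finset_fin_succ {X : Type*} [AddCommMonoid X] {k : ℕ} (f : Finset (Fin (k + 1)) → X) :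
    ∑ T, f T = ∑ T : Finset (Fin k), (f (T.map (Fin.succEmb k)) +
      f (insert 0 (T.map (Fin.succEmb k)))) := by
  have h : Function.Bijective (fun p : Finset (Fin k) × Bool =>
      if p.2 then insert 0 (p.1.map (Fin.succEmb k)) else p.1.map (Fin.succEmb k)) := by
    rw [Fintype.bijective_iff_injective_and_card]
    constructor
    · rintro ⟨S, b⟩ ⟨T, c⟩ h
      have hmem : ∀ i : Fin (k + 1), (i ∈ if b then insert 0 (S.map (Fin.succEmb k)) else
          S.map (Fin.succEmb k)) ↔ (i ∈ if c then insert 0 (T.map (Fin.succEmb k)) else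
          T.map (Fin.succEmb k)) := fun i => by
        have h' := h
        simp only at h'
        rw [h']
      have h0 : b = c := by
        have := hmem 0
        cases b <;> cases c <;> simp at this ⊢
      subst h0
      have : S = T := by
        ext i
        have := hmem i.succ
        cases b <;> simpa using this
      rw [this]
    · simp [pow_succ]
  rw [← h.sum_comp f, Fintype.sum_prod_type]
  refine Finset.sum_congr rfl fun T _ => ?_
  rw [Fintype.sum_bool, add_comm]
  simp

/-- Contraction with the `(1,0)`-part of `v`. -/
def contrHol (J : Euc m →L[ℝ] Euc m) (v : Euc m) : GForm m →ₗ[ℂ] GForm m :=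
  (1 / 2 : ℂ) • (contr v - Complex.I • contr (J v))

/-- Contraction with the `(0,1)`-part of `v`. -/
def contrAnti (J : Euc m →L[ℝ] Euc m) (v : Euc m) : GForm m →ₗ[ℂ] GForm m :=
  (1 / 2 : ℂ) • (contr v + Complex.I • contr (J v))

theorem contrHol_apply (J : Euc m →L[ℝ] Euc m) (v : Euc m) (α : GForm m) :
    contrHol J v α = (1 / 2 : ℂ) • (contr v α - Complex.I • contr (J v) α) := rfl

theorem contrAnti_apply (J : Euc m →L[ℝ] Euc m) (v : Euc m) (α : GForm m) :
    contrAnti J v α = (1 / 2 : ℂ) • (contr v α + Complex.I • contr (J v) α) := rfl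

/-- The sum over `T` in the definition of `typePart`. -/
def typeSummand (J : Euc m →L[ℝ] Euc m) {k : ℕ} (S : Finset (Fin k))
    (a : Euc m [⋀^Fin k]→L[ℝ] ℂ) (v : Fin k → Euc m) : ℂ :=
  ∑ T : Finset (Fin k), Complex.I ^ T.card * a fun i => (if i ∈ T then
    (if i ∈ S then (-(1 / 2) : ℝ) else (1 / 2 : ℝ)) • J
    else (1 / 2 : ℝ) • ContinuousLinearMap.id ℝ (Euc m)) (v i)

theorem typePart_apply (J : Euc m →L[ℝ] Euc m) {k : ℕ} (p : ℕ) (a : Euc m [⋀^Fin k]→L[ℝ] ℂ)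
    (v : Fin k → Euc m) :
    typePart J p a v = ∑ S : Finset (Fin k), if S.card = p then typeSummand J S a v else 0 := by
  rw [← Finset.sum_filter]
  change (∑ S ∈ Finset.powersetCard p (Finset.univ : Finset (Fin k)), ∑ T : Finset (Fin k),
      Complex.I ^ T.card • a.toContinuousMultilinearMap.compContinuousLinearMap (fun i =>
        if i ∈ T then (if i ∈ S then (-(1 / 2) : ℝ) else (1 / 2 : ℝ)) • J
        else (1 / 2 : ℝ) • ContinuousLinearMap.id ℝ (Euc m))) v = _
  rw [Finset.powersetCard_eq_filter, Finset.powerset_univ, _root_.sum_apply]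
  refine Finset.sum_congr rfl fun S _ => ?_
  rw [_root_.sum_apply]
  rfl

/-- The sets T without and with the slot 0 put v/2 and ∓√-1 J v/2 into this slot; together these are
the (1,0)- or the (0,1)-part of v, according to whether 0 lies in S. -/
theorem typeSummand_succ (J : Euc m →L[ℝ] Euc m) {k : ℕ} (S : Finset (Fin (k + 1)))
    (S' : Finset (Fin k)) (hS : ∀ i : Fin k, i.succ ∈ S ↔ i ∈ S')
    (α : GForm m) (v : Euc m) (u : Fin k → Euc m) :
    typeSummand J S (α (k + 1)) (Fin.cons v u) =
      typeSummand J S' ((if 0 ∈ S then contrHol J v α else contrAnti J v α) k) u := by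
  have hmem0 : ∀ T : Finset (Fin k), (0 : Fin (k + 1)) ∉ T.map (Fin.succEmb k) := by simp
  have hmem : ∀ (T : Finset (Fin k)) (i : Fin k), i.succ ∈ T.map (Fin.succEmb k) ↔ i ∈ T := by
    simp
  rw [typeSummand, sum_finset_fin_succ, typeSummand]
  refine Finset.sum_congr rfl fun T _ => ?_
  set w : Fin k → Euc m := fun i => (if i ∈ T then
    (if i ∈ S' then (-(1 / 2) : ℝ) else (1 / 2 : ℝ)) • J
    else (1 / 2 : ℝ) • ContinuousLinearMap.id ℝ (Euc m)) (u i) with hw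
  have h1 : (fun i : Fin (k + 1) => (if i ∈ T.map (Fin.succEmb k) then
      (if i ∈ S then (-(1 / 2) : ℝ) else (1 / 2 : ℝ)) • J
      else (1 / 2 : ℝ) • ContinuousLinearMap.id ℝ (Euc m))
        ((Fin.cons v u : Fin (k + 1) → Euc m) i)) = Fin.cons ((1 / 2 : ℝ) • v) w := by
    funext i
    refine Fin.cases ?_ (fun i => ?_) i
    · simp
    · simp only [hmem, hS, Fin.cons_succ, hw]
  have h2 : (fun i : Fin (k + 1) => (if i ∈ insert 0 (T.map (Fin.succEmb k)) then
      (if i ∈ S then (-(1 / 2) : ℝ) else (1 / 2 : ℝ)) • J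
      else (1 / 2 : ℝ) • ContinuousLinearMap.id ℝ (Euc m))
        ((Fin.cons v u : Fin (k + 1) → Euc m) i)) =
        Fin.cons ((if 0 ∈ S then (-(1 / 2) : ℝ) else (1 / 2 : ℝ)) • J v) w := by
    funext i
    refine Fin.cases ?_ (fun i => ?_) i
    · by_cases h0 : (0 : Fin (k + 1)) ∈ S <;> simp [h0]
    · have : i.succ ∈ insert 0 (T.map (Fin.succEmb k)) ↔ i ∈ T := by
        simp [Fin.succ_ne_zero]
      simp only [this, hS, Fin.cons_succ, hw]
  rw [h1, h2, Finset.card_insert_of_notMem (hmem0 T), Finset.card_map]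
  rw [← contr_apply_apply, ← contr_apply_apply]
  simp only [contr_smul_left, Pi.smul_apply, ContinuousAlternatingMap.smul_apply]
  by_cases h0 : (0 : Fin (k + 1)) ∈ S
  · simp only [h0, if_true, contrHol_apply, Pi.smul_apply, Pi.sub_apply, smul_sub,
      ContinuousAlternatingMap.sub_apply, ContinuousAlternatingMap.smul_apply, smul_eq_mul,
      Complex.real_smul]
    push_cast
    ring
  · simp only [h0, if_false, contrAnti_apply, Pi.smul_apply, Pi.add_apply, smul_add,
      ContinuousAlternatingMap.add_apply, ContinuousAlternatingMap.smul_apply, smul_eq_mul,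
      Complex.real_smul]
    push_cast
    ring

/-- Recursion in the degree: either slot 0 takes a (0,1)-part and p of the other slots take
(1,0)-parts, or slot 0 takes a (1,0)-part and p - 1 of the others do. In natural numbers p - 1 needs
the separate case p = 0. -/
theorem typePart_cons (J : Euc m →L[ℝ] Euc m) {k : ℕ} (p : ℕ) (α : GForm m) (v : Euc m)
    (u : Fin k → Euc m) :
    typePart J p (α (k + 1)) (Fin.cons v u) = typePart J p (contrAnti J v α k) u +
      if p = 0 then 0 else typePart J (p - 1) (contrHol J v α k) u := by
  rw [typePart_apply, sum_finset_fin_succ, Finset.sum_add_distrib, typePart_apply]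
  congr 1
  · refine Finset.sum_congr rfl fun S _ => ?_
    rw [Finset.card_map, typeSummand_succ J _ S (by simp)]
    simp
  · rcases p with _ | p
    · simp
    · rw [if_neg (by simp), typePart_apply]
      refine Finset.sum_congr rfl fun S _ => ?_
      rw [Finset.card_insert_of_notMem (by simp), typeSummand_succ J _ S (by simp)]
      simp

theorem typePart_eq_zero (J : Euc m →L[ℝ] Euc m) {k p : ℕ} (hp : k < p)
    (a : Euc m [⋀^Fin k]→L[ℝ] ℂ) : typePart J p a = 0 := by
  ext v
  rw [typePart_apply]
  refine Finset.sum_eq_zero fun S _ => if_neg ?_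
  have := S.card_le_univ
  simp at this
  omega

end GForm

/-! ### The grading by the weight p - q -/

namespace GForm

open ContinuousAlternatingMap

variable {m : ℕ} (J : Euc m →L[ℝ] Euc m)

theorem eq_zero_of_lt {k : ℕ} (hk : m < k) (a : Euc m [⋀^Fin k]→L[ℝ] ℂ) : a = 0 := by
  ext v
  have h : ¬LinearIndependent ℝ v := fun h => by
    have := h.fintype_card_le_finrank
    simp at this
    omega
  exact a.toAlternatingMap.map_linearDependent v h

theorem typePart_degree_zero (a : Euc m [⋀^Fin 0]→L[ℝ] ℂ) : typePart J 0 a = a := by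
  ext v
  rw [typePart_apply]
  simp only [Fintype.sum_unique, typeSummand]
  simp only [show (default : Finset (Fin 0)) = ∅ from rfl, Finset.card_empty, pow_zero, one_mul,
    if_true]
  exact congrArg a (Subsingleton.elim _ _)

/-- `contrHol` and `contrAnti` add up to the contraction. -/
theorem contrHol_add_contrAnti (v : Euc m) (α : GForm m) :
    contrHol J v α + contrAnti J v α = contr v α := by
  rw [contrHol_apply, contrAnti_apply]; module

theorem typePart_add {k : ℕ} (p : ℕ) (a b : Euc m [⋀^Fin k]→L[ℝ] ℂ) :
    typePart J p (a + b) = typePart J p a + typePart J p b := by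
  ext v
  simp only [ContinuousAlternatingMap.add_apply, typePart_apply, ← Finset.sum_add_distrib]
  refine Finset.sum_congr rfl fun S _ => ?_
  split_ifs
  · simp [typeSummand, mul_add, Finset.sum_add_distrib]
  · simp

theorem typePart_smul {k : ℕ} (p : ℕ) (c : ℂ) (a : Euc m [⋀^Fin k]→L[ℝ] ℂ) :
    typePart J p (c • a) = c • typePart J p a := by
  ext v
  simp only [ContinuousAlternatingMap.smul_apply, typePart_apply, Finset.smul_sum]
  refine Finset.sum_congr rfl fun S _ => ?_
  split_ifs
  · simp only [typeSummand, ContinuousAlternatingMap.smul_apply, smul_eq_mul, Finset.mul_sum]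
    exact Finset.sum_congr rfl fun _ _ => by ring
  · simp

theorem sum_typePart (α : GForm m) (k : ℕ) :
    ∑ p ∈ Finset.range (k + 1), typePart J p (α k) = α k := by
  induction k generalizing α with
  | zero => simp [typePart_degree_zero]
  | succ k ih =>
    ext u
    rw [ContinuousAlternatingMap.sum_apply, ← Fin.cons_self_tail u]
    simp only [typePart_cons, Finset.sum_add_distrib]
    -- The term p = k + 1 of the first sum and the term p = 0 of the second vanish; the rest are the
    -- full decompositions of the two contractions in degree k.
    rw [Finset.sum_range_succ, typePart_eq_zero J (Nat.lt_succ_self k),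
      Finset.sum_range_succ' (fun p => if p = 0 then (0 : ℂ) else _)]
    simp only [if_true, if_neg (Nat.succ_ne_zero _), Nat.add_sub_cancel]
    rw [← ContinuousAlternatingMap.sum_apply, ← ContinuousAlternatingMap.sum_apply, ih, ih,
      ← contr_apply_apply, ← contrHol_add_contrAnti J (u 0) α]
    simp [add_comm]

/-- The component of weight `w`: the sum of the components of type `(p, q)` with `p - q = w`. -/
def weight (w : ℤ) : GForm m →ₗ[ℂ] GForm m where
  toFun α := fun k =>
    ∑ p ∈ Finset.range (k + 1), if 2 * (p : ℤ) - k = w then typePart J p (α k) else 0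
  map_add' α β := by
    funext k
    simp only [Pi.add_apply, typePart_add, ← Finset.sum_add_distrib]
    refine Finset.sum_congr rfl fun p _ => ?_
    split_ifs <;> simp
  map_smul' c α := by
    funext k
    simp only [Pi.smul_apply, typePart_smul, RingHom.id_apply, Finset.smul_sum]
    refine Finset.sum_congr rfl fun p _ => ?_
    split_ifs <;> simp

theorem weight_apply (w : ℤ) (α : GForm m) (k : ℕ) : weight J w α k =
    ∑ p ∈ Finset.range (k + 1), if 2 * (p : ℤ) - k = w then typePart J p (α k) else 0 := rfl

theorem weight_apply_apply (w : ℤ) (α : GForm m) (k : ℕ)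
    (u : Fin k → Euc m) : weight J w α k u =
      ∑ p ∈ Finset.range (k + 1), if 2 * (p : ℤ) - k = w then typePart J p (α k) u else 0 := by
  rw [weight_apply, ContinuousAlternatingMap.sum_apply]
  refine Finset.sum_congr rfl fun p _ => ?_
  split_ifs <;> simp

/-- A removed slot of type (1,0) lowers p - q by one, a removed slot of type (0,1) raises it by one.
-/
theorem contr_weight (v : Euc m) (w : ℤ) (α : GForm m) :
    contr v (weight J w α) = weight J (w - 1) (contrHol J v α) +
      weight J (w + 1) (contrAnti J v α) := by
  funext k
  ext u
  rw [contr_apply_apply, weight_apply_apply]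
  simp only [typePart_cons]
  rw [Pi.add_apply, ContinuousAlternatingMap.add_apply, weight_apply_apply, weight_apply_apply,
    Finset.sum_range_succ']
  simp only [if_true, add_zero]
  rw [add_comm (Finset.sum _ _), add_comm, Finset.sum_range_succ]
  have e0 : (2 * ((0 : ℕ) : ℤ) - ((k + 1 : ℕ) : ℤ) = w) ↔ (2 * ((0 : ℕ) : ℤ) - k = w + 1) := by
    push_cast; constructor <;> intro h <;> linarith
  have e1 : ∀ p : ℕ, (2 * ((p + 1 : ℕ) : ℤ) - ((k + 1 : ℕ) : ℤ) = w) ↔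
      (2 * ((p + 1 : ℕ) : ℤ) - k = w + 1) := fun p => by
    push_cast; constructor <;> intro h <;> linarith
  have e2 : ∀ p : ℕ, (2 * ((p + 1 : ℕ) : ℤ) - ((k + 1 : ℕ) : ℤ) = w) ↔
      (2 * (p : ℤ) - k = w - 1) := fun p => by
    push_cast; constructor <;> intro h <;> linarith
  have s1 : ∀ p : ℕ, (if 2 * ((p + 1 : ℕ) : ℤ) - ((k + 1 : ℕ) : ℤ) = w then
      (typePart J (p + 1) (contrAnti J v α k) u +
        if p + 1 = 0 then 0 else typePart J (p + 1 - 1) (contrHol J v α k) u) else 0) =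
      (if 2 * ((p + 1 : ℕ) : ℤ) - k = w + 1 then typePart J (p + 1) (contrAnti J v α k) u else 0) +
      (if 2 * (p : ℤ) - k = w - 1 then typePart J p (contrHol J v α k) u else 0) := fun p => by
    by_cases h : 2 * ((p + 1 : ℕ) : ℤ) - ((k + 1 : ℕ) : ℤ) = w
    · rw [if_pos h, if_pos ((e1 p).1 h), if_pos ((e2 p).1 h), if_neg (Nat.succ_ne_zero p)]
      rfl
    · rw [if_neg h, if_neg (mt (e1 p).2 h), if_neg (mt (e2 p).2 h), add_zero]
  simp only [s1, Finset.sum_add_distrib, e0]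
  rw [Finset.sum_range_succ' (fun p : ℕ => if 2 * (p : ℤ) - k = w + 1 then
    typePart J p (contrAnti J v α k) u else 0) k, typePart_eq_zero J (Nat.lt_succ_self k)]
  rw [Finset.sum_range_succ]
  simp
  ring

theorem weight_degree_zero (w : ℤ) (α : GForm m) :
    weight J w α 0 = if w = 0 then α 0 else 0 := by
  simp [weight_apply, typePart_degree_zero, eq_comm]

theorem weight_eq_zero {w : ℤ} (hw : (m : ℤ) < |w|) (α : GForm m) : weight J w α = 0 := by
  funext k
  by_cases hk : m < k
  · exact eq_zero_of_lt hk _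
  · rw [weight_apply]
    refine Finset.sum_eq_zero fun p hp => if_neg fun h => ?_
    rw [Finset.mem_range] at hp
    rcases abs_cases w with h' | h' <;> omega

theorem sum_weight (N : ℤ) (hN : (m : ℤ) ≤ N) (α : GForm m) :
    ∑ w ∈ Finset.Icc (-N) N, weight J w α = α := by
  funext k
  by_cases hk : m < k
  · rw [eq_zero_of_lt hk (α k)]; exact eq_zero_of_lt hk _
  · rw [Finset.sum_apply]
    conv_rhs => rw [← sum_typePart J α k]
    simp only [weight_apply]
    rw [Finset.sum_comm]
    refine Finset.sum_congr rfl fun p hp => ?_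
    rw [Finset.mem_range] at hp
    rw [Finset.sum_ite_eq, if_pos]
    rw [Finset.mem_Icc]
    omega

variable {J}

theorem contrHol_J (hJ : ∀ v, J (J v) = -v) (v : Euc m) (α : GForm m) :
    contrHol J (J v) α = Complex.I • contrHol J v α := by
  rw [contrHol_apply, contrHol_apply, hJ, contr_neg_left, smul_neg, sub_neg_eq_add,
    smul_comm Complex.I (1 / 2 : ℂ), smul_sub Complex.I, ← cmul_smul, Complex.I_mul_I]
  module

theorem contrAnti_J (hJ : ∀ v, J (J v) = -v) (v : Euc m) (α : GForm m) :
    contrAnti J (J v) α = -Complex.I • contrAnti J v α := by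
  rw [contrAnti_apply, contrAnti_apply, hJ, contr_neg_left, smul_neg, 
    smul_comm (-Complex.I) (1 / 2 : ℂ), smul_add (-Complex.I), ← cmul_smul, neg_mul,
    Complex.I_mul_I]
  module

theorem contrHol_der (hJ : ∀ v, J (J v) = -v) (v : Euc m) (α : GForm m) :
    contrHol J v (der J α) = Complex.I • contrHol J v α + der J (contrHol J v α) := by
  rw [← contrHol_J hJ]
  simp only [contrHol_apply, contr_der, _root_.map_smul, _root_.map_sub, ContinuousLinearMap.coe_coe]
  module

theorem contrAnti_der (hJ : ∀ v, J (J v) = -v) (v : Euc m) (α : GForm m) :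
    contrAnti J v (der J α) = -Complex.I • contrAnti J v α + der J (contrAnti J v α) := by
  rw [← contrAnti_J hJ]
  simp only [contrAnti_apply, contr_der, _root_.map_smul, _root_.map_add, ContinuousLinearMap.coe_coe]
  module

/-- In the induction the contraction with a (1,0)- or (0,1)-vector has weight shifted by one, and
the additional term `contr (J v)` of the Leibniz rule supplies the missing ±√-1. -/
theorem der_weight (hJ : ∀ v, J (J v) = -v) (w : ℤ) (α : GForm m) :
    der J (weight J w α) = (Complex.I * w) • weight J w α := by
  funext k
  induction k generalizing α w with
  | zero =>
    rw [der_zero_apply, Pi.smul_apply, weight_degree_zero]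
    split_ifs with h <;> ext u <;> simp [h]
  | succ k ih =>
    refine ext_succ fun v => ?_
    rw [contr_der, _root_.map_smul, ContinuousLinearMap.coe_coe, contr_weight J v, contr_weight,
      _root_.map_add, contrHol_J hJ, contrAnti_J hJ]
    simp only [_root_.map_smul, Pi.add_apply, Pi.smul_apply, ih]
    push_cast
    module

theorem weight_der (hJ : ∀ v, J (J v) = -v) (w : ℤ) (α : GForm m) :
    weight J w (der J α) = (Complex.I * w) • weight J w α := by
  funext k
  induction k generalizing α w with
  | zero =>
    rw [weight_degree_zero, Pi.smul_apply, weight_degree_zero, der_zero_apply]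
    split_ifs with h <;> ext u <;> simp [h]
  | succ k ih =>
    refine ext_succ fun v => ?_
    rw [_root_.map_smul, contr_weight, contr_weight, contrHol_der hJ, contrAnti_der hJ]
    simp only [_root_.map_add, _root_.map_smul, Pi.add_apply, Pi.smul_apply, ih]
    push_cast
    module

theorem eq_zero_of_smul_eq_zero {c : ℂ} (hc : c ≠ 0) {α : GForm m} (h : c • α = 0) : α = 0 := by
  rw [← cone_smul α, ← inv_mul_cancel₀ hc, cmul_smul, h]
  module

/-- An operator commuting with `der J` cannot map into an eigenspace with another eigenvalue. -/
theorem weight_comm_off (hJ : ∀ v, J (J v) = -v) (A : GForm m →ₗ[ℂ] GForm m)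
    (hA : ∀ α, der J (A α) = A (der J α)) {w w' : ℤ} (hw : w ≠ w') (α : GForm m) :
    weight J w (A (weight J w' α)) = 0 := by
  have h1 := congrArg (weight J w) (hA (weight J w' α))
  rw [weight_der hJ, der_weight hJ, _root_.map_smul, _root_.map_smul] at h1
  refine eq_zero_of_smul_eq_zero (c := Complex.I * (w - w' : ℂ))
    (mul_ne_zero Complex.I_ne_zero (sub_ne_zero.2 (by exact_mod_cast hw))) ?_
  rw [mul_sub, sub_eq_add_neg, cadd_smul, cneg_smul, h1]
  abel

/-- Operators which commute with `der J` preserve the weight. -/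
theorem weight_comm_of_comm (hJ : ∀ v, J (J v) = -v) (A : GForm m →ₗ[ℂ] GForm m)
    (hA : ∀ α, der J (A α) = A (der J α)) (w : ℤ) (α : GForm m) :
    weight J w (A α) = A (weight J w α) := by
  have hN : (m : ℤ) ≤ max (m : ℤ) |w| := le_max_left _ _
  have hw : w ∈ Finset.Icc (-max (m : ℤ) |w|) (max (m : ℤ) |w|) :=
    Finset.mem_Icc.2 (abs_le.1 (le_max_right _ _))
  calc weight J w (A α) = weight J w (A (∑ w' ∈ Finset.Icc (-max (m : ℤ) |w|) (max (m : ℤ) |w|),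
        weight J w' α)) := by rw [sum_weight J _ hN]
    _ = ∑ w' ∈ Finset.Icc (-max (m : ℤ) |w|) (max (m : ℤ) |w|),
        weight J w (A (weight J w' α)) := by
      rw [_root_.map_sum, _root_.map_sum]
    _ = weight J w (A (weight J w α)) :=
      Finset.sum_eq_single_of_mem w hw fun w' _ h => weight_comm_off hJ A hA h.symm α
    _ = ∑ w' ∈ Finset.Icc (-max (m : ℤ) |w|) (max (m : ℤ) |w|),
        weight J w' (A (weight J w α)) :=
      (Finset.sum_eq_single_of_mem w hw fun w' _ h => weight_comm_off hJ A hA h α).symm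
    _ = A (weight J w α) := sum_weight J _ hN _

end GForm

/-- A scalar product on `ℝᵐ`. -/
structure IsMetric {m : ℕ} (g : Euc m →L[ℝ] Euc m →L[ℝ] ℝ) : Prop where
  symm : ∀ v w, g v w = g w v
  pos : ∀ v, v ≠ 0 → 0 < g v v

/-! ### Traces with respect to a scalar product -/

namespace GForm

variable {m : ℕ} {g : Euc m →L[ℝ] Euc m →L[ℝ] ℝ} {X Y : Type*}
  [AddCommGroup X] [Module ℝ X] [AddCommGroup Y] [Module ℝ Y]

theorem gram_posDef (hg : IsMetric g) : (gramMatrix g (stdVec (m := m))).PosDef := by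
  refine Matrix.PosDef.of_dotProduct_mulVec_pos ?_ fun x hx => ?_
  · ext i j
    simp [gramMatrix, hg.symm (stdVec i)]
  · have h0 : (WithLp.toLp 2 x : Euc m) ≠ 0 := fun h => hx (by
      simpa using congrArg WithLp.ofLp h)
    have := hg.pos _ h0
    rw [← sum_coord (WithLp.toLp 2 x : Euc m)] at this
    have h1 : star x ⬝ᵥ (gramMatrix g (stdVec (m := m))).mulVec x =
        g (∑ i, x i • stdVec i) (∑ i, x i • stdVec i) := by
      simp only [dotProduct, Matrix.mulVec, gramMatrix, Finset.mul_sum, map_sum, map_smul,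
        sum_apply, smul_apply, smul_eq_mul, Matrix.of_apply, star_trivial]
      refine Finset.sum_congr rfl fun i _ => Finset.sum_congr rfl fun j _ => ?_
      rw [hg.symm]
      ring
    rw [h1]
    exact this

variable (g) in
/-- The trace of a bilinear map with respect to the scalar product `g`. -/
def tr (B : Euc m → Euc m → X) : X :=
  ∑ i, ∑ j, (gramMatrix g (stdVec (m := m)))⁻¹ i j • B (stdVec i) (stdVec j)

theorem tr_congr {B C : Euc m → Euc m → X} (h : ∀ i j, B (stdVec i) (stdVec j) =
    C (stdVec i) (stdVec j)) : tr g B = tr g C := by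
  simp [tr, h]

theorem tr_add (B C : Euc m → Euc m → X) : tr g (fun u v => B u v + C u v) = tr g B + tr g C := by
  simp [tr, Finset.sum_add_distrib]

theorem tr_neg (B : Euc m → Euc m → X) : tr g (fun u v => -B u v) = -tr g B := by
  simp [tr]

theorem tr_sub (B C : Euc m → Euc m → X) : tr g (fun u v => B u v - C u v) = tr g B - tr g C := by
  simp [tr, Finset.sum_sub_distrib, smul_sub]

theorem map_tr (A : X →ₗ[ℝ] Y) (B : Euc m → Euc m → X) :
    A (tr g B) = tr g fun u v => A (B u v) := by
  simp [tr]

theorem tr_tr_comm (B : Euc m → Euc m → Euc m → Euc m → X) :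
    tr g (fun u v => tr g fun a b => B u v a b) = tr g (fun a b => tr g fun u v => B u v a b) := by
  have h : ∀ C : Euc m → Euc m → X, tr g C = ∑ p : Fin m × Fin m,
      (gramMatrix g (stdVec (m := m)))⁻¹ p.1 p.2 • C (stdVec p.1) (stdVec p.2) := fun C => by
    rw [tr, Fintype.sum_prod_type]
  simp only [h, Finset.smul_sum]
  rw [Finset.sum_comm]
  exact Finset.sum_congr rfl fun p _ => Finset.sum_congr rfl fun q _ => smul_comm _ _ _

theorem gram_inv_symm (hg : IsMetric g) (i j : Fin m) :
    (gramMatrix g (stdVec (m := m)))⁻¹ i j = (gramMatrix g (stdVec (m := m)))⁻¹ j i := by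
  have h : (gramMatrix g (stdVec (m := m)))⁻¹.IsHermitian := (gram_posDef hg).1.inv
  have := h.apply j i
  simpa using this

theorem tr_swap (hg : IsMetric g) (B : Euc m → Euc m → X) :
    tr g (fun u v => B v u) = tr g B := by
  rw [tr, Finset.sum_comm, tr]
  refine Finset.sum_congr rfl fun i _ => Finset.sum_congr rfl fun j _ => ?_
  rw [gram_inv_symm hg]

theorem gram_mul_inv (hg : IsMetric g) (i j : Fin m) :
    ∑ k, g (stdVec i) (stdVec k) * (gramMatrix g (stdVec (m := m)))⁻¹ k j =
      if i = j then 1 else 0 := by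
  have h : IsUnit (gramMatrix g (stdVec (m := m))).det := (gram_posDef hg).det_pos.ne'.isUnit
  have := congrFun (congrFun (Matrix.mul_nonsing_inv _ h) i) j
  rwa [Matrix.mul_apply, Matrix.one_apply] at this

/-- The reproducing property g^{ij} g(x, e_i) f(e_j) = f(x). Most later identities between traces
are derived from it by inserting and removing dummy traces, without handling inverse matrices. -/
theorem tr_contract (hg : IsMetric g) {f : Euc m → X} (hf : IsLinearMap ℝ f) (x : Euc m) :
    tr g (fun u v => g x u • f v) = f x := by
  have h1 : ∀ i, g x (stdVec i) = ∑ k, x k * g (stdVec k) (stdVec i) := fun i => by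
    conv_lhs => rw [← sum_coord x]
    simp
  rw [tr, Finset.sum_comm]
  conv_rhs => rw [← hf.sum_coord x]
  refine Finset.sum_congr rfl fun j _ => ?_
  simp only [smul_smul]
  rw [← Finset.sum_smul]
  congr 1
  simp only [h1, Finset.mul_sum]
  rw [Finset.sum_comm]
  have h2 : ∀ k, ∑ i, (gramMatrix g (stdVec (m := m)))⁻¹ i j * (x k * g (stdVec k) (stdVec i)) =
      x k * if k = j then 1 else 0 := fun k => by
    rw [← gram_mul_inv hg k j, Finset.mul_sum]
    exact Finset.sum_congr rfl fun i _ => by ring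
  simp [h2]

theorem tr_contract' (hg : IsMetric g) {f : Euc m → X} (hf : IsLinearMap ℝ f) (x : Euc m) :
    tr g (fun u v => g x v • f u) = f x := by
  rw [← tr_contract hg hf x, ← tr_swap hg]

/-- A skew endomorphism can be moved to the other argument. -/
theorem tr_skew (hg : IsMetric g) {K : Euc m → Euc m} (hK : ∀ v w, g (K v) w = -g v (K w))
    {B : Euc m → Euc m → X} (h1 : ∀ v, IsLinearMap ℝ fun u => B u v)
    (h2 : ∀ u, IsLinearMap ℝ fun v => B u v) :
    tr g (fun u v => B (K u) v) = -tr g fun u v => B u (K v) := by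
  -- A dummy trace carries K in a scalar factor, where skewness moves it to the other vector; after
  -- exchanging the two traces the reproducing property is applied to the other argument of B.
  have e1 : tr g (fun u v => B (K u) v) =
      tr g fun u v => tr g fun a b => -g (K a) u • B b v := by
    refine tr_congr fun i j => ?_
    rw [← tr_contract hg (h1 (stdVec j)) (K (stdVec i))]
    refine tr_congr fun a b => ?_
    rw [hK, hg.symm]
  rw [e1, tr_tr_comm, ← tr_neg, ← tr_swap hg (fun u v => -B u (K v))]
  refine tr_congr fun a b => ?_
  rw [← tr_contract hg (h2 (stdVec b)) (K (stdVec a)), ← tr_neg]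
  exact tr_congr fun i j => neg_smul _ _

/-! ### The Hermitian product of forms -/

variable (g) in
/-- The Hermitian product of the components of degree `k`. -/
def innDeg (k : ℕ) (α β : GForm m) : ℂ := formInner g stdVec (α k) (β k)

theorem innDeg_congr {k : ℕ} {α α' β β' : GForm m} (h : α k = α' k) (h' : β k = β' k) :
    innDeg g k α β = innDeg g k α' β' := by
  rw [innDeg, h, h']; rfl

theorem innDeg_zero (α β : GForm m) : innDeg g 0 α β = α 0 ![] * conj (β 0 ![]) := by
  simp only [innDeg, formInner, Fintype.sum_unique, Nat.factorial]
  simp only [Finset.univ_eq_empty, Finset.prod_empty]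
  have h : ∀ a : Euc m [⋀^Fin 0]→L[ℝ] ℂ, ∀ u, a u = a ![] := fun a u =>
    congrArg a (Subsingleton.elim _ _)
  rw [h (α 0), h (β 0)]
  simp

/-- The first index is split off from both multi-indices. Adjointness, skewness, positivity,
smoothness and differentiation of the product are all proved by this recursion. -/
theorem innDeg_succ (k : ℕ) (α β : GForm m) :
    innDeg g (k + 1) α β = (k + 1 : ℂ)⁻¹ * tr g fun u v => innDeg g k (contr u α) (contr v β) := by
  have hs : ∀ F : (Fin (k + 1) → Fin m) → ℂ, ∑ i, F i = ∑ a, ∑ i, F (Fin.cons a i) := fun F => by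
    rw [← (Fin.consEquiv fun _ : Fin (k + 1) => Fin m).sum_comp, Fintype.sum_prod_type]
    rfl
  have hc : ∀ (a : Fin m) (i : Fin k → Fin m), (fun s => stdVec (m := m)
      ((Fin.cons a i : Fin (k + 1) → Fin m) s)) = Fin.cons (stdVec a) fun s => stdVec (i s) := by
    intro a i
    funext s
    refine Fin.cases ?_ (fun s => ?_) s <;> simp
  simp only [innDeg, formInner, tr]
  rw [hs]
  simp only [hs, Fin.prod_univ_succ, Fin.cons_zero, Fin.cons_succ, hc, ← contr_apply_apply]
  simp only [Complex.real_smul, Finset.mul_sum, Nat.factorial_succ]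
  refine Finset.sum_congr rfl fun a _ => ?_
  rw [Finset.sum_comm]
  refine Finset.sum_congr rfl fun b _ => Finset.sum_congr rfl fun i _ =>
    Finset.sum_congr rfl fun j _ => ?_
  push_cast
  rw [mul_inv]
  ring

theorem innDeg_add_left (k : ℕ) (α β γ : GForm m) :
    innDeg g k (α + β) γ = innDeg g k α γ + innDeg g k β γ := by
  simp [innDeg, formInner, add_mul, mul_add, Finset.sum_add_distrib]

theorem innDeg_smul_left (k : ℕ) (c : ℂ) (α β : GForm m) :
    innDeg g k (c • α) β = c * innDeg g k α β := by
  simp only [innDeg, formInner, Pi.smul_apply, ContinuousAlternatingMap.smul_apply, smul_eq_mul,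
    Finset.mul_sum]
  exact Finset.sum_congr rfl fun i _ => Finset.sum_congr rfl fun j _ => by ring

theorem innDeg_conj (hg : IsMetric g) (k : ℕ) (α β : GForm m) :
    conj (innDeg g k α β) = innDeg g k β α := by
  simp only [innDeg, formInner, map_mul, map_sum, map_inv₀, Complex.conj_natCast,
    Complex.conj_ofReal, Complex.conj_conj]
  rw [Finset.sum_comm]
  congr 1
  refine Finset.sum_congr rfl fun i _ => Finset.sum_congr rfl fun j _ => ?_
  simp only [gram_inv_symm hg (j _)]
  rw [mul_comm (conj _)]

theorem innDeg_add_right (k : ℕ) (α β γ : GForm m) :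
    innDeg g k α (β + γ) = innDeg g k α β + innDeg g k α γ := by
  simp [innDeg, formInner, mul_add, Finset.sum_add_distrib]

theorem innDeg_smul_right (k : ℕ) (c : ℂ) (α β : GForm m) :
    innDeg g k α (c • β) = conj c * innDeg g k α β := by
  simp only [innDeg, formInner, Pi.smul_apply, ContinuousAlternatingMap.smul_apply, smul_eq_mul,
    Finset.mul_sum, map_mul]
  exact Finset.sum_congr rfl fun i _ => Finset.sum_congr rfl fun j _ => by ring

variable (g) in
/-- The Hermitian product on forms, linear in the first argument, as a sesquilinear map. -/
def inn : GForm m →ₗ[ℂ] GForm m →ₗ⋆[ℂ] ℂ :=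
  LinearMap.mk₂'ₛₗ (RingHom.id ℂ) (starRingEnd ℂ)
    (fun α β => ∑ k ∈ Finset.range (m + 1), innDeg g k α β)
    (fun α β γ => by simp only [innDeg_add_left, Finset.sum_add_distrib])
    (fun c α β => by simp only [innDeg_smul_left, ← Finset.mul_sum]; rfl)
    (fun α β γ => by simp only [innDeg_add_right, Finset.sum_add_distrib])
    (fun c α β => by simp only [innDeg_smul_right, ← Finset.mul_sum]; rfl)

theorem inn_def (α β : GForm m) : inn g α β = ∑ k ∈ Finset.range (m + 1), innDeg g k α β := rfl

theorem inn_conj (hg : IsMetric g) (α β : GForm m) : conj (inn g α β) = inn g β α := by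
  simp only [inn_def, map_sum, innDeg_conj hg]

theorem inn_real_smul_left (c : ℝ) (α β : GForm m) : inn g (c • α) β = c * inn g α β := by
  rw [real_smul_eq, map_smul]; rfl

theorem inn_real_smul_right (c : ℝ) (α β : GForm m) : inn g α (c • β) = c * inn g α β := by
  rw [real_smul_eq, LinearMap.map_smulₛₗ, Complex.conj_ofReal]; rfl

theorem innDeg_real_smul_left (k : ℕ) (c : ℝ) (α β : GForm m) :
    innDeg g k (c • α) β = c * innDeg g k α β := by
  rw [real_smul_eq, innDeg_smul_left]

theorem innDeg_real_smul_right (k : ℕ) (c : ℝ) (α β : GForm m) :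
    innDeg g k α (c • β) = c * innDeg g k α β := by
  rw [real_smul_eq, innDeg_smul_right, Complex.conj_ofReal]

theorem isLinear_innDeg_left {F : Euc m → GForm m} (hF : IsLinearMap ℝ F) (k : ℕ) (β : GForm m) :
    IsLinearMap ℝ fun u => innDeg g k (F u) β :=
  ⟨fun x y => by rw [hF.map_add, innDeg_add_left], fun c x => by
    rw [hF.map_smul, innDeg_real_smul_left, Complex.real_smul]⟩

theorem isLinear_innDeg_right {F : Euc m → GForm m} (hF : IsLinearMap ℝ F) (k : ℕ) (α : GForm m) :
    IsLinearMap ℝ fun u => innDeg g k α (F u) :=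
  ⟨fun x y => by rw [hF.map_add, innDeg_add_right], fun c x => by
    rw [hF.map_smul, innDeg_real_smul_right, Complex.real_smul]⟩

theorem innDeg_neg_left (k : ℕ) (α β : GForm m) : innDeg g k (-α) β = -innDeg g k α β := by
  have := innDeg_smul_left (g := g) k (-1) α β
  rwa [cneg_smul, cone_smul, neg_one_mul] at this

theorem innDeg_neg_right (k : ℕ) (α β : GForm m) : innDeg g k α (-β) = -innDeg g k α β := by
  have := innDeg_smul_right (g := g) k (-1) α β
  rwa [cneg_smul, cone_smul, map_neg, map_one, neg_one_mul] at this

theorem innDeg_sub_left (k : ℕ) (α β γ : GForm m) :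
    innDeg g k (α - β) γ = innDeg g k α γ - innDeg g k β γ := by
  rw [sub_eq_add_neg, innDeg_add_left, innDeg_neg_left, sub_eq_add_neg]

/-- Let S be the right-hand side in degree k + 1. In the recursion, the antiderivation rule produces
S once from F itself, and k + 1 more times from the induction hypothesis for the contractions of F.
The sum (k + 2) S cancels the factor of the recursion. -/
theorem innDeg_alt (k : ℕ) {F : Euc m → GForm m} (hF : IsLinearMap ℝ F)
    (β : GForm m) :
    innDeg g (k + 1) (alt F) β = tr g fun u v => innDeg g k (F u) (contr v β) := by
  induction k generalizing F β with
  | zero =>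
    rw [innDeg_succ, Nat.cast_zero, zero_add, inv_one, one_mul]
    refine tr_congr fun i j => innDeg_congr ?_ rfl
    rw [contr_alt hF, Pi.sub_apply, alt_zero, sub_zero]
  | succ k ih =>
    rw [innDeg_succ]
    set S := tr g fun u v => innDeg g (k + 1) (F u) (contr v β) with hS
    have h1 : (tr g fun u v => innDeg g (k + 1) (contr u (alt F)) (contr v β)) =
        S + (k + 1 : ℂ) * S := by
      simp only [contr_alt hF, innDeg_sub_left]
      rw [tr_sub, ← hS, sub_eq_add_neg]
      congr 1
      simp only [ih (isLinear_contr_comp _ hF)]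
      rw [tr_tr_comm, ← tr_neg]
      have h2 : ∀ a b, -(tr g fun u v => innDeg g k (contr u (F a)) (contr b (contr v β))) =
          (k + 1 : ℂ) * innDeg g (k + 1) (F a) (contr b β) := by
        intro a b
        rw [innDeg_succ, mul_inv_cancel_left₀ (by exact_mod_cast Nat.succ_ne_zero k), ← tr_neg]
        refine tr_congr fun i j => ?_
        rw [contr_contr b, innDeg_neg_right, neg_neg]
      simp only [h2]
      exact (map_tr (LinearMap.mulLeft ℝ (k + 1 : ℂ)) _).symm
    rw [h1]
    have h3 : ((k + 1 : ℕ) + 1 : ℂ) ≠ 0 := by exact_mod_cast Nat.succ_ne_zero (k + 1)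
    push_cast at h3 ⊢
    field_simp
    ring

theorem tr_sum {ι : Type*} (s : Finset ι) (B : ι → Euc m → Euc m → X) :
    tr g (fun u v => ∑ i ∈ s, B i u v) = ∑ i ∈ s, tr g (B i) := by
  classical
  induction s using Finset.induction_on with
  | empty => simp [tr]
  | insert a s ha ih => simp only [Finset.sum_insert ha, tr_add, ih]

/-- Exterior multiplication is adjoint to contraction. -/
theorem inn_alt {F : Euc m → GForm m} (hF : IsLinearMap ℝ F) (β : GForm m) :
    inn g (alt F) β = tr g fun u v => inn g (F u) (contr v β) := by
  simp only [inn_def, tr_sum]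
  -- The degrees on the two sides differ by one: `alt F` has no component of degree 0, and
  -- contractions have none of degree m because there are no forms of degree m + 1.
  rw [Finset.sum_range_succ', Finset.sum_range_succ]
  have h0 : innDeg g 0 (alt F) β = 0 := by simp [innDeg_zero, alt_zero]
  have h1 : (tr g fun u v => innDeg g m (F u) (contr v β)) = 0 := by
    have : ∀ v, contr v β m = 0 := fun v => by
      rw [contr_apply, eq_zero_of_lt (Nat.lt_succ_self m) (β (m + 1))]; simp
    have h2 : ∀ u v, innDeg g m (F u) (contr v β) = 0 := fun u v => by
      rw [innDeg, this]; simp [formInner]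
    simp [tr, h2]
  rw [h0, h1]
  congr 1
  exact Finset.sum_congr rfl fun k _ => innDeg_alt k hF β

/-- A skew endomorphism is an infinitesimal isometry, and so acts on forms by a skew operator. In
the recursion the first slot is `tr_skew`, and the others are the induction hypothesis. -/
theorem innDeg_der (hg : IsMetric g) (K : Euc m →ₗ[ℝ] Euc m)
    (hK : ∀ v w, g (K v) w = -g v (K w)) (k : ℕ) (α β : GForm m) :
    innDeg g k (der K α) β = -innDeg g k α (der K β) := by
  induction k generalizing α β with
  | zero => simp [innDeg_zero, der_zero_apply]
  | succ k ih =>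
    rw [innDeg_succ, innDeg_succ, ← mul_neg]
    congr 1
    simp only [contr_der, innDeg_add_left, innDeg_add_right, tr_add, ih, tr_neg, neg_add]
    congr 1
    exact tr_skew hg hK (B := fun u v => innDeg g k (contr u α) (contr v β))
      (fun v => isLinear_innDeg_left (isLinear_contr α) k _)
      (fun u => isLinear_innDeg_right (isLinear_contr β) k _)

theorem inn_der (hg : IsMetric g) (K : Euc m →ₗ[ℝ] Euc m)
    (hK : ∀ v w, g (K v) w = -g v (K w)) (α β : GForm m) :
    inn g (der K α) β = -inn g α (der K β) := by
  simp only [inn_def, innDeg_der hg K hK, Finset.sum_neg_distrib]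

/-- Since `der J` is skew-Hermitian, its eigenspaces for different weights are orthogonal, and the
projections onto them are self-adjoint. -/
theorem inn_weight (hg : IsMetric g) {J : Euc m →L[ℝ] Euc m} (hJ : ∀ v, J (J v) = -v)
    (hJg : ∀ v w, g (J v) w = -g v (J w)) (w : ℤ) (α β : GForm m) :
    inn g (weight J w α) β = inn g α (weight J w β) := by
  have hoff : ∀ (a b : ℤ), a ≠ b → ∀ α β, inn g (weight J a α) (weight J b β) = 0 := by
    intro a b hab α β
    have h := inn_der hg (J : Euc m →ₗ[ℝ] Euc m) hJg (weight J a α) (weight J b β)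
    rw [der_weight hJ, der_weight hJ, map_smul, LinearMap.map_smulₛₗ, LinearMap.smul_apply] at h
    simp only [smul_eq_mul, map_mul, Complex.conj_I, map_intCast] at h
    have h2 : Complex.I * (a - b : ℂ) * inn g (weight J a α) (weight J b β) = 0 := by
      linear_combination h
    refine (mul_eq_zero.1 h2).resolve_left (mul_ne_zero Complex.I_ne_zero (sub_ne_zero.2 ?_))
    exact_mod_cast hab
  have hw : w ∈ Finset.Icc (-max (m : ℤ) |w|) (max (m : ℤ) |w|) :=
    Finset.mem_Icc.2 (abs_le.1 (le_max_right _ _))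
  have e1 : inn g (weight J w α) β = inn g (weight J w α) (weight J w β) := by
    conv_lhs => rw [← sum_weight J _ (le_max_left (m : ℤ) |w|) β]
    rw [map_sum]
    exact Finset.sum_eq_single_of_mem w hw fun b _ hb => hoff w b hb.symm α β
  have e2 : inn g α (weight J w β) = inn g (weight J w α) (weight J w β) := by
    conv_lhs => rw [← sum_weight J _ (le_max_left (m : ℤ) |w|) α]
    rw [map_sum, LinearMap.sum_apply]
    exact Finset.sum_eq_single_of_mem w hw fun b _ hb => hoff b w hb α β
  rw [e1, e2]

theorem tr_smul_complex (c : ℂ) (B : Euc m → Euc m → GForm m) :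
    tr g (fun u v => c • B u v) = c • tr g B := by
  simp only [tr, Finset.smul_sum]
  exact Finset.sum_congr rfl fun i _ => Finset.sum_congr rfl fun j _ => smul_comm _ _ _

theorem map_tr_complex (A : GForm m →ₗ[ℂ] GForm m) (B : Euc m → Euc m → GForm m) :
    A (tr g B) = tr g fun u v => A (B u v) := by
  simp only [tr, map_sum, map_real_smul]

variable (g) in
/-- The adjoint of the multiplication with `g (J ·, ·)`. -/
def lam (J : Euc m →L[ℝ] Euc m) : GForm m →ₗ[ℂ] GForm m where
  toFun β := (1 / 2 : ℂ) • tr g fun u v => contr (J u) (contr v β)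
  map_add' α β := by simp only [map_add, tr_add, smul_add]
  map_smul' c α := by
    simp only [map_smul, tr_smul_complex, RingHom.id_apply]
    exact smul_comm _ _ _

theorem lam_def (J : Euc m →L[ℝ] Euc m) (β : GForm m) :
    lam g J β = (1 / 2 : ℂ) • tr g fun u v => contr (J u) (contr v β) := rfl

theorem inn_tr_right (α : GForm m) (B : Euc m → Euc m → GForm m) :
    inn g α (tr g B) = tr g fun u v => inn g α (B u v) := by
  simp only [tr, map_sum, inn_real_smul_right, Complex.real_smul]

theorem isLinear_inn_right {F : Euc m → GForm m} (hF : IsLinearMap ℝ F) (α : GForm m) :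
    IsLinearMap ℝ fun u => inn g α (F u) :=
  ⟨fun x y => by rw [hF.map_add, map_add], fun c x => by
    rw [hF.map_smul, inn_real_smul_right, Complex.real_smul]⟩

/-- The two-form of a metric and an endomorphism. -/
def kahlerForm (g : Euc m →L[ℝ] Euc m →L[ℝ] ℝ) (J : Euc m →L[ℝ] Euc m) :
    Euc m →ₗ[ℝ] Euc m →ₗ[ℝ] ℝ :=
  LinearMap.mk₂ ℝ (fun v w => g (J v) w) (by simp) (by simp) (by simp) (by simp)

theorem kahlerForm_apply (g : Euc m →L[ℝ] Euc m →L[ℝ] ℝ) (J : Euc m →L[ℝ] Euc m) (v w : Euc m) :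
    kahlerForm g J v w = g (J v) w := rfl

/-- Both covectors of ω pass to the other side as contractions, by `inn_alt` twice. The coefficient
g(J u, ·) is then absorbed by the reproducing property. -/
theorem inn_wedgeTwo (hg : IsMetric g) (J : Euc m →L[ℝ] Euc m) (α β : GForm m) :
    inn g (wedgeTwo (kahlerForm g J) α) β = inn g α (lam g J β) := by
  rw [wedgeTwo_def, map_smul, LinearMap.smul_apply, inn_alt (isLinear_alt_smul _ α),
    lam_def, LinearMap.map_smulₛₗ, inn_tr_right]
  rw [show conj (1 / 2 : ℂ) = 1 / 2 by rw [map_div₀, map_one, map_ofNat]]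
  refine congrArg (fun z => (1 / 2 : ℂ) • z) (tr_congr fun i j => ?_)
  rw [inn_alt (isLinear_smul _ α)]
  simp only [inn_real_smul_left, kahlerForm_apply, ← Complex.real_smul]
  exact tr_contract hg (f := fun v => inn g α (contr v (contr (stdVec j) β)))
    (isLinear_inn_right (isLinear_contr _) α) _

/-- The Hermitian product is positive definite. -/
theorem innDeg_self (hg : IsMetric g) (k : ℕ) (α : GForm m) :
    ∃ r : ℝ, 0 ≤ r ∧ innDeg g k α α = r ∧ (r = 0 → α k = 0) := by
  induction k generalizing α with
  | zero =>
    refine ⟨‖α 0 ![]‖ ^ 2, by positivity, ?_, fun h => ?_⟩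
    · rw [innDeg_zero, Complex.mul_conj']
      push_cast
      rfl
    · ext u
      rw [show u = ![] from Subsingleton.elim _ _]
      simpa using h
  | succ k ih =>
    -- The rows of a factor R with Rᵀ R = G⁻¹ are the coordinates of an orthonormal frame f; in it
    -- the trace of the recursion becomes a sum of squares.
    obtain ⟨R, hR⟩ : ∃ R : Matrix (Fin m) (Fin m) ℝ,
        (gramMatrix g (stdVec (m := m)))⁻¹ = R.conjTranspose * R := by
      open scoped MatrixOrder in
      exact CStarAlgebra.nonneg_iff_eq_star_mul_self.mp (gram_posDef hg).inv.posSemidef.nonneg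
    set f : Fin m → Euc m := fun l => ∑ i, R l i • stdVec i with hf
    have htr : (tr g fun u v => innDeg g k (contr u α) (contr v α)) =
        ∑ l, innDeg g k (contr (f l) α) (contr (f l) α) := by
      have h1 : ∀ l, innDeg g k (contr (f l) α) (contr (f l) α) = ∑ i, ∑ j,
          ((R l i * R l j : ℝ) : ℂ) * innDeg g k (contr (stdVec i) α) (contr (stdVec j) α) := by
        intro l
        have hl := isLinear_innDeg_left (g := g) (isLinear_contr α) k (contr (f l) α)
        have e1 : innDeg g k (contr (f l) α) (contr (f l) α) =
            ∑ i, R l i • innDeg g k (contr (stdVec i) α) (contr (f l) α) := by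
          conv_lhs => rw [hf]
          change hl.mk' _ _ = _
          rw [map_sum]
          exact Finset.sum_congr rfl fun i _ => map_smul _ _ _
        rw [e1]
        refine Finset.sum_congr rfl fun i _ => ?_
        have hr := isLinear_innDeg_right (g := g) (isLinear_contr α) k (contr (stdVec i) α)
        have e2 : innDeg g k (contr (stdVec i) α) (contr (f l) α) =
            ∑ j, R l j • innDeg g k (contr (stdVec i) α) (contr (stdVec j) α) := by
          change hr.mk' _ _ = _
          rw [hf, map_sum]
          exact Finset.sum_congr rfl fun i _ => map_smul _ _ _
        rw [e2, Finset.smul_sum]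
        refine Finset.sum_congr rfl fun j _ => ?_
        rw [smul_smul, Complex.real_smul]
      simp only [h1]
      rw [Finset.sum_comm, tr]
      refine Finset.sum_congr rfl fun i _ => ?_
      rw [Finset.sum_comm]
      refine Finset.sum_congr rfl fun j _ => ?_
      rw [← Finset.sum_mul, hR, Matrix.mul_apply, Complex.real_smul, Complex.ofReal_sum]
      simp
    choose r hr0 hr hr1 using fun l => ih (contr (f l) α)
    refine ⟨(k + 1 : ℝ)⁻¹ * ∑ l, r l, mul_nonneg (by positivity) (Finset.sum_nonneg fun l _ => hr0 l), ?_, ?_⟩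
    · rw [innDeg_succ, htr]
      push_cast
      simp only [hr]
    · intro h
      have hk : (k + 1 : ℝ)⁻¹ ≠ 0 := by positivity
      have h0 := (mul_eq_zero.1 h).resolve_left hk
      have h1 := (Finset.sum_eq_zero_iff_of_nonneg fun l _ => hr0 l).1 h0
      have h2 : ∀ l, contr (f l) α k = 0 := fun l => hr1 l (h1 l (Finset.mem_univ l))
      have hdet : IsUnit R.det := by
        have := (gram_posDef hg).inv.det_pos
        rw [hR, Matrix.det_mul] at this
        exact (right_ne_zero_of_mul this.ne').isUnit
      have h3 : ∀ i, contr (stdVec i) α k = 0 := by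
        intro i
        have e : stdVec i = ∑ l, R⁻¹ i l • f l := by
          simp only [hf, Finset.smul_sum, smul_smul]
          rw [Finset.sum_comm]
          simp only [← Finset.sum_smul, ← Matrix.mul_apply, Matrix.nonsing_inv_mul _ hdet]
          simp [Matrix.one_apply]
        have hl := isLinear_apply (isLinear_contr α) k
        have := map_sum (hl.mk' _) (fun l => R⁻¹ i l • f l) Finset.univ
        rw [← e] at this
        refine this.trans (Finset.sum_eq_zero fun l _ => ?_)
        rw [map_smul]
        change _ • contr (f l) α k = 0
        rw [h2]; ext u; simp
      have h4 : ∀ v, contr v α k = 0 := fun v => by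
        rw [← (isLinear_apply (isLinear_contr α) k).sum_coord v]
        refine Finset.sum_eq_zero fun i _ => ?_
        rw [h3]; ext u; simp
      have : α (k + 1) = (0 : GForm m) (k + 1) := ext_succ fun v => by
        rw [h4, map_zero]; rfl
      exact this

theorem eq_zero_of_inn_self (hg : IsMetric g) {α : GForm m} (h : inn g α α = 0) : α = 0 := by
  choose r h0 h1 h2 using fun k => innDeg_self hg k α
  rw [inn_def] at h
  simp only [h1] at h
  have h' : ∑ k ∈ Finset.range (m + 1), r k = 0 := by exact_mod_cast h
  rw [Finset.sum_eq_zero_iff_of_nonneg fun k _ => h0 k] at h'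
  funext k
  by_cases hk : m < k
  · exact eq_zero_of_lt hk _
  · exact h2 k (h' k (Finset.mem_range.2 (by omega)))

theorem inn_self_nonneg (hg : IsMetric g) (α : GForm m) : ∃ r : ℝ, 0 ≤ r ∧ inn g α α = r := by
  choose r h0 h1 h2 using fun k => innDeg_self hg k α
  refine ⟨∑ k ∈ Finset.range (m + 1), r k, Finset.sum_nonneg fun k _ => h0 k, ?_⟩
  rw [inn_def]
  push_cast
  exact Finset.sum_congr rfl fun k _ => h1 k

end GForm

namespace GForm

variable {m : ℕ}

/-! ### Smooth families of forms -/

section Smooth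

variable {V : Type*} [NormedAddCommGroup V] [NormedSpace ℝ V] {y : V}

/-- Smoothness at a point of a family of forms. -/
def SmoothAt (α : V → GForm m) (y : V) : Prop := ∀ k, ContDiffAt ℝ ∞ (fun z => α z k) y

theorem SmoothAt.congr {α β : V → GForm m} (hα : SmoothAt α y) (h : β =ᶠ[nhds y] α) :
    SmoothAt β y := fun k =>
  (hα k).congr_of_eventuallyEq (h.mono fun z hz => by simp only [hz])

theorem SmoothAt.const (α : GForm m) : SmoothAt (fun _ : V => α) y := fun _ => contDiffAt_const

theorem SmoothAt.add {α β : V → GForm m} (hα : SmoothAt α y) (hβ : SmoothAt β y) :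
    SmoothAt (fun z => α z + β z) y := fun k => (hα k).add (hβ k)

theorem SmoothAt.sub {α β : V → GForm m} (hα : SmoothAt α y) (hβ : SmoothAt β y) :
    SmoothAt (fun z => α z - β z) y := fun k => (hα k).sub (hβ k)

theorem SmoothAt.sum {ι : Type*} {s : Finset ι} {α : ι → V → GForm m}
    (hα : ∀ i ∈ s, SmoothAt (α i) y) : SmoothAt (fun z => ∑ i ∈ s, α i z) y := fun k => by
  simp only [Finset.sum_apply]
  exact ContDiffAt.sum fun i hi => hα i hi k

theorem SmoothAt.smul {c : V → ℝ} {α : V → GForm m} (hc : ContDiffAt ℝ ∞ c y)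
    (hα : SmoothAt α y) : SmoothAt (fun z => c z • α z) y := fun k => hc.smul (hα k)

theorem SmoothAt.const_smul {α : V → GForm m} (c : ℂ) (hα : SmoothAt α y) :
    SmoothAt (fun z => c • α z) y := fun k => (hα k).const_smul c

/-- The contraction of a `k + 1`-form, as a continuous linear map. -/
def contrCLM (m k : ℕ) : (Euc m [⋀^Fin (k + 1)]→L[ℝ] ℂ) →L[ℝ] Euc m →L[ℝ] Euc m [⋀^Fin k]→L[ℝ] ℂ :=
  (ContinuousAlternatingMap.curryLeftLI (𝕜 := ℝ) (E := Euc m) (F := ℂ)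
    (n := k)).toContinuousLinearMap

theorem contr_eq_clm (v : Euc m) (α : GForm m) (k : ℕ) :
    contr v α k = contrCLM m k (α (k + 1)) v := rfl

/-- The contraction with a fixed vector, as a continuous linear map. -/
def contrVecCLM (k : ℕ) (v : Euc m) :
    (Euc m [⋀^Fin (k + 1)]→L[ℝ] ℂ) →L[ℝ] Euc m [⋀^Fin k]→L[ℝ] ℂ :=
  (ContinuousLinearMap.apply ℝ (Euc m [⋀^Fin k]→L[ℝ] ℂ) v).comp (contrCLM m k)

/-- The exterior product of a `k`-form with the `i`-th coordinate, as a continuous linear map. -/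
def coordWedgeCLM (k : ℕ) (i : Fin m) :
    (Euc m [⋀^Fin k]→L[ℝ] ℂ) →L[ℝ] Euc m [⋀^Fin (k + 1)]→L[ℝ] ℂ :=
  (ContinuousAlternatingMap.alternatizeUncurryFinCLM ℝ (Euc m) ℂ).comp
    (ContinuousLinearMap.smulRightL ℝ (Euc m) (Euc m [⋀^Fin k]→L[ℝ] ℂ) (EuclideanSpace.proj i))

theorem SmoothAt.contr {u : V → Euc m} {α : V → GForm m} (hu : ContDiffAt ℝ ∞ u y)
    (hα : SmoothAt α y) : SmoothAt (fun z => contr (u z) (α z)) y := fun k => by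
  simp only [contr_eq_clm]
  exact ((contrCLM m k).contDiff.contDiffAt.comp y (hα (k + 1))).clm_apply hu

theorem alt_eq_clm (F : Euc m → GForm m) (k : ℕ) :
    alt F (k + 1) = ∑ i, coordWedgeCLM k i (F (stdVec i) k) := by
  have h : alt F (k + 1) = ContinuousAlternatingMap.alternatizeUncurryFinCLM ℝ (Euc m) ℂ
      (∑ i, (ContinuousLinearMap.smulRightL ℝ (Euc m) (Euc m [⋀^Fin k]→L[ℝ] ℂ)
        (EuclideanSpace.proj i)) (F (stdVec i) k)) := rfl
  rw [h, _root_.map_sum]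
  rfl

theorem SmoothAt.alt {F : V → Euc m → GForm m} (hF : ∀ i, SmoothAt (fun z => F z (stdVec i)) y) :
    SmoothAt (fun z => alt (F z)) y := fun k => by
  cases k with
  | zero => exact contDiffAt_const
  | succ k =>
    simp only [alt_eq_clm]
    exact ContDiffAt.sum fun i _ => (coordWedgeCLM k i).contDiff.contDiffAt.comp y (hF i k)

/-- Euler's relation. -/
theorem alt_contr (α : GForm m) (k : ℕ) :
    alt (fun v => contr v α) (k + 1) = ((k + 1 : ℕ) : ℂ) • α (k + 1) := by
  rw [alt_eq_alternatize (α (k + 1)).curryLeft fun i => rfl,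
    ContinuousAlternatingMap.alternatizeUncurryFin_curryLeft]
  ext u
  simp

/-- Euler's relation rebuilds a form from its contractions with the fixed basis. It is the
differentiable counterpart of `ext_succ` and gives smoothness of the weight components by induction
on the degree. -/
theorem smoothAt_of_contr {f : V → GForm m} {k : ℕ}
    (h : ∀ v, ContDiffAt ℝ ∞ (fun z => contr v (f z) k) y) :
    ContDiffAt ℝ ∞ (fun z => f z (k + 1)) y := by
  have h1 : ∀ z, f z (k + 1) = ((k + 1 : ℕ) : ℂ)⁻¹ • alt (fun v => contr v (f z)) (k + 1) := by
    intro z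
    rw [alt_contr]
    ext u
    have : ((k + 1 : ℕ) : ℂ) ≠ 0 := by exact_mod_cast Nat.succ_ne_zero k
    simp only [ContinuousAlternatingMap.smul_apply, smul_eq_mul]
    rw [inv_mul_cancel_left₀ this]
  simp only [h1]
  refine ContDiffAt.const_smul _ ?_
  simp only [alt_eq_clm]
  exact ContDiffAt.sum fun i _ => (coordWedgeCLM k i).contDiff.contDiffAt.comp y (h (stdVec i))

theorem SmoothAt.der {K : V → Euc m →L[ℝ] Euc m} {α : V → GForm m} (hK : ContDiffAt ℝ ∞ K y)
    (hα : SmoothAt α y) : SmoothAt (fun z => der (K z) (α z)) y := by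
  simp only [der_def]
  exact SmoothAt.alt (F := fun z w => GForm.contr (K z w) (α z)) fun i =>
    SmoothAt.contr (hK.clm_apply contDiffAt_const) hα

theorem SmoothAt.wedgeTwo {A : V → Euc m →ₗ[ℝ] Euc m →ₗ[ℝ] ℝ} {α : V → GForm m}
    (hA : ∀ i j, ContDiffAt ℝ ∞ (fun z => A z (stdVec i) (stdVec j)) y)
    (hα : SmoothAt α y) : SmoothAt (fun z => wedgeTwo (A z) (α z)) y :=
  (SmoothAt.alt fun i => SmoothAt.alt fun j => SmoothAt.smul (hA i j) hα).const_smul _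

theorem SmoothAt.contrHol {J : V → Euc m →L[ℝ] Euc m} {α : V → GForm m}
    (hJ : ContDiffAt ℝ ∞ J y) (hα : SmoothAt α y) (v : Euc m) :
    SmoothAt (fun z => contrHol (J z) v (α z)) y :=
  ((hα.contr contDiffAt_const).sub
    ((hα.contr (hJ.clm_apply contDiffAt_const)).const_smul _)).const_smul _

theorem SmoothAt.contrAnti {J : V → Euc m →L[ℝ] Euc m} {α : V → GForm m}
    (hJ : ContDiffAt ℝ ∞ J y) (hα : SmoothAt α y) (v : Euc m) :
    SmoothAt (fun z => contrAnti (J z) v (α z)) y :=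
  ((hα.contr contDiffAt_const).add
    ((hα.contr (hJ.clm_apply contDiffAt_const)).const_smul _)).const_smul _

theorem SmoothAt.weight {J : V → Euc m →L[ℝ] Euc m} {α : V → GForm m} (hJ : ContDiffAt ℝ ∞ J y)
    (hα : SmoothAt α y) (w : ℤ) : SmoothAt (fun z => weight (J z) w (α z)) y := fun k => by
  induction k generalizing α w with
  | zero =>
    simp only [weight_degree_zero]
    split_ifs
    · exact hα 0
    · exact contDiffAt_const
  | succ k ih =>
    refine smoothAt_of_contr fun v => ?_
    simp only [contr_weight]
    exact (ih (hα.contrHol hJ v) _).add (ih (hα.contrAnti hJ v) _)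

theorem contDiffAt_gram {g : V → Euc m →L[ℝ] Euc m →L[ℝ] ℝ} (hg : ContDiffAt ℝ ∞ g y)
    (i j : Fin m) : ContDiffAt ℝ ∞ (fun z => gramMatrix (g z) (stdVec (m := m)) i j) y :=
  (hg.clm_apply contDiffAt_const).clm_apply contDiffAt_const

theorem contDiffAt_det {n : ℕ} {A : V → Matrix (Fin n) (Fin n) ℝ}
    (hA : ∀ i j, ContDiffAt ℝ ∞ (fun z => A z i j) y) :
    ContDiffAt ℝ ∞ (fun z => (A z).det) y := by
  simp only [Matrix.det_apply]
  exact ContDiffAt.sum fun σ _ => (contDiffAt_prod fun i _ => hA _ _).const_smul _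

theorem contDiffAt_inv {n : ℕ} {A : V → Matrix (Fin n) (Fin n) ℝ}
    (hA : ∀ i j, ContDiffAt ℝ ∞ (fun z => A z i j) y) (hdet : (A y).det ≠ 0) (i j : Fin n) :
    ContDiffAt ℝ ∞ (fun z => (A z)⁻¹ i j) y := by
  simp only [Matrix.inv_def, Matrix.smul_apply, Matrix.adjugate_apply, Ring.inverse_eq_inv',
    smul_eq_mul]
  refine ((contDiffAt_det hA).inv hdet).mul (contDiffAt_det fun a b => ?_)
  simp only [Matrix.updateRow_apply]
  split_ifs
  · exact contDiffAt_const
  · exact hA a b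

theorem contDiffAt_gram_inv {g : V → Euc m →L[ℝ] Euc m →L[ℝ] ℝ} (hg : ContDiffAt ℝ ∞ g y)
    (hm : IsMetric (g y)) (i j : Fin m) :
    ContDiffAt ℝ ∞ (fun z => (gramMatrix (g z) (stdVec (m := m)))⁻¹ i j) y :=
  contDiffAt_inv (contDiffAt_gram hg) (gram_posDef hm).det_pos.ne' i j

theorem SmoothAt.tr {g : V → Euc m →L[ℝ] Euc m →L[ℝ] ℝ} (hg : ContDiffAt ℝ ∞ g y)
    (hm : IsMetric (g y)) {B : V → Euc m → Euc m → GForm m}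
    (hB : ∀ i j, SmoothAt (fun z => B z (stdVec i) (stdVec j)) y) :
    SmoothAt (fun z => tr (g z) (B z)) y :=
  SmoothAt.sum fun i _ => SmoothAt.sum fun j _ =>
    SmoothAt.smul (contDiffAt_gram_inv hg hm i j) (hB i j)

theorem SmoothAt.lam {g : V → Euc m →L[ℝ] Euc m →L[ℝ] ℝ} {J : V → Euc m →L[ℝ] Euc m}
    {α : V → GForm m} (hg : ContDiffAt ℝ ∞ g y) (hm : IsMetric (g y)) (hJ : ContDiffAt ℝ ∞ J y)
    (hα : SmoothAt α y) : SmoothAt (fun z => lam (g z) (J z) (α z)) y :=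
  (SmoothAt.tr hg hm fun _ _ => (hα.contr contDiffAt_const).contr
    (hJ.clm_apply contDiffAt_const)).const_smul _

theorem SmoothAt.innDeg {g : V → Euc m →L[ℝ] Euc m →L[ℝ] ℝ} (hg : ContDiffAt ℝ ∞ g y)
    (hm : IsMetric (g y)) {α β : V → GForm m} (hα : SmoothAt α y) (hβ : SmoothAt β y) (k : ℕ) :
    ContDiffAt ℝ ∞ (fun z => innDeg (g z) k (α z) (β z)) y := by
  induction k generalizing α β with
  | zero =>
    simp only [innDeg_zero]
    have h : ∀ {α : V → GForm m}, SmoothAt α y → ContDiffAt ℝ ∞ (fun z => α z 0 ![]) y :=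
      fun {α} hα => by
        exact ((ContinuousAlternatingMap.apply ℝ (Euc m) ℂ (![] : Fin 0 → Euc m)).contDiff.contDiffAt).comp y (hα 0)
    exact (h hα).mul (Complex.conjCLE.contDiff.contDiffAt.comp y (h hβ))
  | succ k ih =>
    simp only [innDeg_succ, GForm.tr]
    refine contDiffAt_const.mul (ContDiffAt.sum fun i _ => ContDiffAt.sum fun j _ => ?_)
    exact (contDiffAt_gram_inv hg hm i j).smul
      (ih (hα.contr contDiffAt_const) (hβ.contr contDiffAt_const))

theorem SmoothAt.inn {g : V → Euc m →L[ℝ] Euc m →L[ℝ] ℝ} (hg : ContDiffAt ℝ ∞ g y)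
    (hm : IsMetric (g y)) {α β : V → GForm m} (hα : SmoothAt α y) (hβ : SmoothAt β y) :
    ContDiffAt ℝ ∞ (fun z => inn (g z) (α z) (β z)) y := by
  simp only [inn_def]
  exact ContDiffAt.sum fun k _ => SmoothAt.innDeg hg hm hα hβ k

end Smooth

/-! ### Derivatives along curves -/

/-- `α'` is the derivative of the curve of forms `α` at `0`. -/
def HasD (α : ℝ → GForm m) (α' : GForm m) : Prop := ∀ k, HasDerivAt (fun t => α t k) (α' k) 0

theorem HasD.unique {α : ℝ → GForm m} {α' α'' : GForm m} (h : HasD α α') (h' : HasD α α'') :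
    α' = α'' := funext fun k => (h k).unique (h' k)

theorem HasD.const_smul {α : ℝ → GForm m} {α' : GForm m} (c : ℂ) (hα : HasD α α') :
    HasD (fun t => c • α t) (c • α') := fun k => (hα k).const_smul c

theorem HasD.smul {c : ℝ → ℝ} {c' : ℝ} {α : ℝ → GForm m} {α' : GForm m} (hc : HasDerivAt c c' 0)
    (hα : HasD α α') : HasD (fun t => c t • α t) (c 0 • α' + c' • α 0) :=
  fun k => hc.smul (hα k)

theorem HasD.sum {ι : Type*} {s : Finset ι} {α : ι → ℝ → GForm m} {α' : ι → GForm m}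
    (hα : ∀ i ∈ s, HasD (α i) (α' i)) : HasD (fun t => ∑ i ∈ s, α i t) (∑ i ∈ s, α' i) :=
  fun k => by
    simp only [Finset.sum_apply]
    exact HasDerivAt.fun_sum fun i hi => hα i hi k

theorem HasD.contr_const {α : ℝ → GForm m} {α' : GForm m} (u : Euc m) (hα : HasD α α') :
    HasD (fun t => GForm.contr u (α t)) (GForm.contr u α') := fun k =>
  (contrVecCLM k u).hasFDerivAt.comp_hasDerivAt (0 : ℝ) (hα (k + 1))

theorem HasD.contr {u : ℝ → Euc m} {u' : Euc m} {α : ℝ → GForm m} {α' : GForm m}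
    (hu : HasDerivAt u u' 0) (hα : HasD α α') :
    HasD (fun t => GForm.contr (u t) (α t)) (GForm.contr (u 0) α' + GForm.contr u' (α 0)) := by
  have hi : ∀ i, HasDerivAt (fun t => u t i) (u' i) 0 := fun i =>
    (EuclideanSpace.proj (𝕜 := ℝ) i).hasFDerivAt.comp_hasDerivAt (0 : ℝ) hu
  have h := HasD.sum (s := Finset.univ) fun i _ => (hα.contr_const (stdVec i)).smul (hi i)
  rw [Finset.sum_add_distrib, (isLinear_contr α').sum_coord, (isLinear_contr (α 0)).sum_coord] at h
  have e : ∀ t, GForm.contr (u t) (α t) = ∑ i, u t i • GForm.contr (stdVec i) (α t) := fun t =>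
    ((isLinear_contr (α t)).sum_coord (u t)).symm
  simp only [e] at h ⊢
  exact h

theorem HasD.alt {F : ℝ → Euc m → GForm m} {F' : Euc m → GForm m}
    (hF : ∀ i, HasD (fun t => F t (stdVec i)) (F' (stdVec i))) :
    HasD (fun t => alt (F t)) (alt F') := fun k => by
  cases k with
  | zero => exact hasDerivAt_const _ _
  | succ k =>
    simp only [alt_eq_clm]
    exact HasDerivAt.fun_sum fun i _ =>
      (coordWedgeCLM k i).hasFDerivAt.comp_hasDerivAt (0 : ℝ) (hF i k)

theorem HasD.der {K : ℝ → Euc m →L[ℝ] Euc m} {K' : Euc m →L[ℝ] Euc m} {α : ℝ → GForm m}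
    {α' : GForm m} (hK : HasDerivAt K K' 0) (hα : HasD α α') :
    HasD (fun t => der (K t) (α t)) (der (K 0) α' + der K' (α 0)) := by
  simp only [der_def]
  rw [← alt_add]
  refine HasD.alt (F := fun t w => GForm.contr (K t w) (α t))
    (F' := fun w => GForm.contr (K 0 w) α' + GForm.contr (K' w) (α 0)) fun i => HasD.contr ?_ hα
  have h := hK.clm_apply (hasDerivAt_const (0 : ℝ) (stdVec i))
  rw [_root_.map_zero, add_zero] at h
  exact h

theorem HasD.wedgeTwo {A : ℝ → Euc m →ₗ[ℝ] Euc m →ₗ[ℝ] ℝ} {A' : Euc m →ₗ[ℝ] Euc m →ₗ[ℝ] ℝ}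
    {α : ℝ → GForm m} {α' : GForm m}
    (hA : ∀ v w, HasDerivAt (fun t => A t v w) (A' v w) 0) (hα : HasD α α') :
    HasD (fun t => wedgeTwo (A t) (α t)) (wedgeTwo (A 0) α' + wedgeTwo A' (α 0)) := by
  have h : HasD (fun t => GForm.wedgeTwo (A t) (α t)) ((1 / 2 : ℂ) • GForm.alt fun v =>
      GForm.alt fun w => (A 0 v w) • α' + (A' v w) • α 0) :=
    HasD.const_smul _ (HasD.alt fun i => HasD.alt fun j => HasD.smul (hA _ _) hα)
  convert h using 1
  simp only [wedgeTwo_def, alt_add]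
  exact (smul_add _ _ _).symm

end GForm

/-! ### Derivatives of determinants and inverse matrices -/

/-- Jacobi's formula. The product rule replaces one column of A at a time by the column of A', and
Cramer's rule expresses these determinants by the adjugate. -/
theorem hasDerivAt_det {n : ℕ} {A : ℝ → Matrix (Fin n) (Fin n) ℝ} {A' : Matrix (Fin n) (Fin n) ℝ}
    (hA : ∀ i j, HasDerivAt (fun t => A t i j) (A' i j) 0) (h0 : (A 0).det ≠ 0) :
    HasDerivAt (fun t => (A t).det) ((A 0).det * ∑ i, ∑ j, (A 0)⁻¹ i j * A' j i) 0 := by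
  have h1 : HasDerivAt (fun t => (A t).det) (∑ i, ((A 0).updateCol i fun j => A' j i).det) 0 := by
    simp only [Matrix.det_apply]
    rw [Finset.sum_comm]
    refine HasDerivAt.fun_sum fun σ _ => ?_
    have h := (HasDerivAt.fun_finsetProd (u := Finset.univ) (f := fun i t => A t (σ i) i)
      (f' := fun i => A' (σ i) i) (x := (0 : ℝ)) (fun i _ => hA (σ i) i)).fun_const_smul
      (Equiv.Perm.sign σ)
    convert h using 1
    rw [Finset.smul_sum]
    refine Finset.sum_congr rfl fun i _ => congrArg (Equiv.Perm.sign σ • ·) ?_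
    rw [← Finset.prod_erase_mul _ _ (Finset.mem_univ i), smul_eq_mul, Matrix.updateCol_self]
    congr 1
    refine Finset.prod_congr rfl fun j hj => ?_
    rw [Matrix.updateCol_ne (Finset.ne_of_mem_erase hj)]
  convert h1 using 1
  rw [Finset.mul_sum]
  refine Finset.sum_congr rfl fun i _ => ?_
  rw [← Matrix.cramer_apply, Matrix.cramer_eq_adjugate_mulVec]
  simp only [Matrix.mulVec, dotProduct, Matrix.inv_def, Ring.inverse_eq_inv', Matrix.smul_apply,
    smul_eq_mul, Finset.mul_sum]
  refine Finset.sum_congr rfl fun j _ => ?_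
  field_simp

theorem deriv_matrix_inv {n : ℕ} {A B : ℝ → Matrix (Fin n) (Fin n) ℝ}
    {A' B' : Matrix (Fin n) (Fin n) ℝ} (hA : ∀ i j, HasDerivAt (fun t => A t i j) (A' i j) 0)
    (hB : ∀ i j, HasDerivAt (fun t => B t i j) (B' i j) 0) (h : ∀ᶠ t in nhds 0, A t * B t = 1) :
    B' = -(B 0 * A' * B 0) := by
  have h0 : A 0 * B 0 = 1 := h.self_of_nhds
  have h1 : A 0 * B' + A' * B 0 = 0 := by
    ext i j
    have h2 : HasDerivAt (fun t => (A t * B t) i j) ((A 0 * B' + A' * B 0) i j) 0 := by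
      simp only [Matrix.mul_apply, Matrix.add_apply, ← Finset.sum_add_distrib]
      refine HasDerivAt.fun_sum fun l _ => ?_
      rw [add_comm]
      exact (hA i l).mul (hB l j)
    have h3 : HasDerivAt (fun t => (A t * B t) i j) 0 0 :=
      (hasDerivAt_const (0 : ℝ) ((1 : Matrix (Fin n) (Fin n) ℝ) i j)).congr_of_eventuallyEq
        (h.mono fun t ht => by simp only [ht])
    exact h2.unique h3
  have h2 : B 0 * A 0 = 1 := mul_eq_one_comm.mp h0
  have h3 := congrArg (B 0 * ·) h1
  simp only [mul_add, ← mul_assoc, h2, one_mul, mul_zero] at h3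
  rw [eq_neg_iff_add_eq_zero, h3]

namespace GForm

variable {m : ℕ}

/-! ### Derivatives of contractions with a metric -/

section Curve

variable {g : ℝ → Euc m →L[ℝ] Euc m →L[ℝ] ℝ} {Γ : Euc m →ₗ[ℝ] Euc m}

variable (g Γ) in
/-- A smooth curve of scalar products whose derivative at `0` is given by an endomorphism. -/
structure MetricCurve : Prop where
  smooth : ContDiffAt ℝ ∞ g 0
  metric : ∀ᶠ t in nhds 0, IsMetric (g t)
  deriv : ∀ v w, HasDerivAt (fun t => g t v w) (g 0 (Γ v) w + g 0 v (Γ w)) 0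

theorem MetricCurve.hasDerivAt_inv (hg : MetricCurve g Γ) (i j : Fin m) :
    HasDerivAt (fun t => (gramMatrix (g t) (stdVec (m := m)))⁻¹ i j)
      (-∑ a, ∑ b, (gramMatrix (g 0) (stdVec (m := m)))⁻¹ i a *
        (g 0 (Γ (stdVec a)) (stdVec b) + g 0 (stdVec a) (Γ (stdVec b))) *
        (gramMatrix (g 0) (stdVec (m := m)))⁻¹ b j) 0 := by
  have h1 : ∀ i j, HasDerivAt (fun t => (gramMatrix (g t) (stdVec (m := m)))⁻¹ i j)
      (_root_.deriv (fun t => (gramMatrix (g t) (stdVec (m := m)))⁻¹ i j) 0) 0 := fun i j =>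
    ((contDiffAt_gram_inv hg.smooth hg.metric.self_of_nhds i j).differentiableAt
      (by simp)).hasDerivAt
  have h2 := deriv_matrix_inv (A := fun t => gramMatrix (g t) (stdVec (m := m)))
    (A' := Matrix.of fun i j => g 0 (Γ (stdVec i)) (stdVec j) + g 0 (stdVec i) (Γ (stdVec j)))
    (B' := Matrix.of fun i j => _root_.deriv (fun t => (gramMatrix (g t) (stdVec (m := m)))⁻¹ i j) 0)
    (fun i j => hg.deriv _ _) h1
    (hg.metric.mono fun t ht =>
      Matrix.mul_nonsing_inv _ (isUnit_iff_ne_zero.mpr (gram_posDef ht).det_pos.ne'))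
  convert h1 i j using 1
  have h3 := congrFun (congrFun h2 i) j
  simp only [Matrix.of_apply] at h3
  rw [h3, Matrix.neg_apply, Matrix.mul_apply, Finset.sum_comm]
  simp only [Matrix.mul_apply, Finset.sum_mul, Matrix.of_apply]

/-- The inverse metric has derivative -G⁻¹ G' G⁻¹, and G' is Γ inserted in either argument of g. By
the reproducing property this amounts to -Γ in each argument of B. -/
theorem MetricCurve.hasDerivAt_tr (hg : MetricCurve g Γ) {B : ℝ → Euc m → Euc m → ℂ}
    {B' : Euc m → Euc m → ℂ}
    (hB : ∀ i j, HasDerivAt (fun t => B t (stdVec i) (stdVec j)) (B' (stdVec i) (stdVec j)) 0)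
    (h1 : ∀ v, IsLinearMap ℝ fun u => B 0 u v) (h2 : ∀ u, IsLinearMap ℝ fun v => B 0 u v) :
    HasDerivAt (fun t => tr (g t) (B t))
      (tr (g 0) fun u v => B' u v - B 0 (Γ u) v - B 0 u (Γ v)) 0 := by
  have hm := hg.metric.self_of_nhds
  have h : HasDerivAt (fun t => tr (g t) (B t)) _ 0 :=
    HasDerivAt.fun_sum (u := Finset.univ) fun i _ => HasDerivAt.fun_sum (u := Finset.univ)
      fun j _ => (hg.hasDerivAt_inv i j).smul (hB i j)
  convert h using 1
  have e1 : tr (g 0) (fun u v => B 0 (Γ u) v) + tr (g 0) (fun u v => B 0 u (Γ v)) =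
      tr (g 0) fun u a => tr (g 0) fun b v =>
        (g 0 (Γ a) b + g 0 a (Γ b)) • B 0 u v := by
    have e2 : tr (g 0) (fun u a => tr (g 0) fun b v => g 0 (Γ a) b • B 0 u v) =
        tr (g 0) (fun u v => B 0 u (Γ v)) := by
      refine tr_congr fun i j => ?_
      rw [tr_swap hm (fun v b => g 0 (Γ (stdVec j)) b • B 0 (stdVec i) v)]
      exact tr_contract' hm (h2 _) _
    have e3 : tr (g 0) (fun u a => tr (g 0) fun b v => g 0 a (Γ b) • B 0 u v) =
        tr (g 0) (fun u v => B 0 (Γ u) v) := by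
      rw [tr_tr_comm]
      refine tr_congr fun i j => ?_
      simp only [fun a => hm.symm a (Γ (stdVec i))]
      exact tr_contract' hm (h1 _) _
    rw [← e2, ← e3, add_comm, ← tr_add]
    refine tr_congr fun i j => ?_
    rw [← tr_add]
    simp only [add_smul]
  rw [tr_sub, tr_sub, sub_sub, e1]
  simp only [GForm.tr, Finset.sum_add_distrib, neg_smul, Finset.sum_neg_distrib, sub_eq_add_neg]
  congr 2
  refine Finset.sum_congr rfl fun i _ => ?_
  simp only [Finset.sum_smul, Finset.smul_sum]
  conv_rhs => rw [Finset.sum_comm]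
  refine Finset.sum_congr rfl fun a _ => ?_
  conv_rhs => rw [Finset.sum_comm]
  refine Finset.sum_congr rfl fun b _ => Finset.sum_congr rfl fun j _ => ?_
  simp only [smul_smul]
  congr 1
  ring

/-- Compatibility of the connection with the metric, extended from vectors to forms: α' - `der Γ` α
is the covariant derivative of α along the curve. -/
theorem MetricCurve.hasDerivAt_innDeg (hg : MetricCurve g Γ) (k : ℕ) {α β : ℝ → GForm m}
    {α' β' : GForm m} (hα : HasD α α') (hβ : HasD β β') :
    HasDerivAt (fun t => innDeg (g t) k (α t) (β t))
      (innDeg (g 0) k (α' - der Γ (α 0)) (β 0) + innDeg (g 0) k (α 0) (β' - der Γ (β 0))) 0 := by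
  induction k generalizing α β α' β' with
  | zero =>
    have h : ∀ {α : ℝ → GForm m} {α' : GForm m}, HasD α α' →
        HasDerivAt (fun t => α t 0 ![]) (α' 0 ![]) 0 := fun {α α'} hα =>
      (ContinuousAlternatingMap.apply ℝ (Euc m) ℂ (![] : Fin 0 → Euc m)).hasFDerivAt.comp_hasDerivAt
        (0 : ℝ) (hα 0)
    simp only [innDeg_zero, Pi.sub_apply, der_zero_apply, sub_zero]
    exact (h hα).mul (Complex.conjCLE.toContinuousLinearMap.hasFDerivAt.comp_hasDerivAt (0 : ℝ) (h hβ))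
  | succ k ih =>
    have h := hg.hasDerivAt_tr
      (B' := fun u v => innDeg (g 0) k (contr u α' - der Γ (contr u (α 0))) (contr v (β 0)) +
        innDeg (g 0) k (contr u (α 0)) (contr v β' - der Γ (contr v (β 0))))
      (B := fun t u v => innDeg (g t) k (contr u (α t)) (contr v (β t)))
      (fun i j => ih (hα.contr_const (stdVec i)) (hβ.contr_const (stdVec j)))
      (fun v => isLinear_innDeg_left (isLinear_contr (α 0)) k (contr v (β 0)))
      (fun v => isLinear_innDeg_right (isLinear_contr (β 0)) k (contr v (α 0)))
    simp only [innDeg_succ]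
    rw [← mul_add, ← tr_add]
    refine (h.const_mul (k + 1 : ℂ)⁻¹).congr_deriv
      (congrArg ((k + 1 : ℂ)⁻¹ * ·) (tr_congr fun i j => ?_))
    simp only [_root_.map_sub, contr_der]
    simp only [sub_eq_add_neg, innDeg_add_left, innDeg_add_right, innDeg_neg_left,
      innDeg_neg_right, neg_add]
    ring

theorem MetricCurve.hasDerivAt_inn (hg : MetricCurve g Γ) {α β : ℝ → GForm m}
    {α' β' : GForm m} (hα : HasD α α') (hβ : HasD β β') :
    HasDerivAt (fun t => inn (g t) (α t) (β t))
      (inn (g 0) (α' - der Γ (α 0)) (β 0) + inn (g 0) (α 0) (β' - der Γ (β 0))) 0 := by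
  simp only [inn_def, ← Finset.sum_add_distrib]
  exact HasDerivAt.fun_sum fun k _ => hg.hasDerivAt_innDeg k hα hβ

/-- Each of the two terms of the derivative of g contributes the trace of Γ to Jacobi's formula; the
square root halves the total. -/
theorem MetricCurve.hasDerivAt_sqrt_det (hg : MetricCurve g Γ) :
    HasDerivAt (fun t => √(gramMatrix (g t) (stdVec (m := m))).det)
      (√(gramMatrix (g 0) (stdVec (m := m))).det * ∑ i, Γ (stdVec i) i) 0 := by
  have hm := hg.metric.self_of_nhds
  have hpos := (gram_posDef hm).det_pos
  have h := (hasDerivAt_det (A := fun t => gramMatrix (g t) (stdVec (m := m)))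
    (A' := Matrix.of fun i j => g 0 (Γ (stdVec i)) (stdVec j) + g 0 (stdVec i) (Γ (stdVec j)))
    (fun i j => hg.deriv _ _) hpos.ne').sqrt hpos.ne'
  convert h using 1
  have e : ∑ i, ∑ j, (gramMatrix (g 0) (stdVec (m := m)))⁻¹ i j *
      (Matrix.of fun i j => g 0 (Γ (stdVec i)) (stdVec j) + g 0 (stdVec i) (Γ (stdVec j))) j i =
      2 * ∑ i, Γ (stdVec i) i := by
    have e1 : tr (g 0) (fun u v => g 0 (Γ u) v) = ∑ i, Γ (stdVec i) i := by
      have : ∀ u v, g 0 (Γ u) v = ∑ i, g 0 (stdVec i) v • (Γ u) i := by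
        intro u v
        conv_lhs => rw [← GForm.sum_coord (Γ u)]
        simp [mul_comm]
      simp only [this, tr_sum]
      refine Finset.sum_congr rfl fun i _ => ?_
      exact tr_contract' hm (f := fun u => Γ u i) ⟨fun x y => by simp, fun c x => by simp⟩ _
    have e2 : tr (g 0) (fun u v => g 0 u (Γ v)) = ∑ i, Γ (stdVec i) i := by
      rw [← e1, ← tr_swap hm]
      exact tr_congr fun i j => hm.symm _ _
    have e3 : tr (g 0) (fun u v => g 0 (Γ v) u + g 0 v (Γ u)) = 2 * ∑ i, Γ (stdVec i) i := by
      rw [tr_swap hm (fun u v => g 0 (Γ u) v + g 0 u (Γ v)), tr_add, e1, e2, two_mul]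
    exact e3
  rw [e]
  have := Real.mul_self_sqrt hpos.le
  have hs : √(gramMatrix (g 0) (stdVec (m := m))).det ≠ 0 := (Real.sqrt_pos.mpr hpos).ne'
  field_simp
  rw [sq, this, mul_comm]

end Curve

end GForm

namespace GForm

variable {m : ℕ}

theorem tr_smul {X : Type*} [AddCommGroup X] [Module ℝ X] (g : Euc m →L[ℝ] Euc m →L[ℝ] ℝ) (c : ℝ)
    (B : Euc m → Euc m → X) : tr g (fun u v => c • B u v) = c • tr g B := by
  simp only [tr, Finset.smul_sum, smul_comm c]

/-! ### The Levi-Civita connection of a metric on an open subset of `ℝᵐ` -/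

section Christoffel

/-- The Christoffel symbols, from the value and the derivative of the metric at a point. -/
def christoffel (g : Euc m →L[ℝ] Euc m →L[ℝ] ℝ)
    (g' : Euc m →L[ℝ] Euc m →L[ℝ] Euc m →L[ℝ] ℝ) : Euc m →ₗ[ℝ] Euc m →ₗ[ℝ] Euc m :=
  LinearMap.mk₂ ℝ
    (fun v X => tr g fun a b => ((1 / 2 : ℝ) * (g' v X a + g' X v a - g' a v X)) • b)
    (fun v w X => by
      rw [← tr_add]
      refine tr_congr fun i j => ?_
      rw [← add_smul]
      congr 1
      simp only [_root_.map_add, _root_.add_apply]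
      ring)
    (fun c v X => by
      rw [← tr_smul]
      refine tr_congr fun i j => ?_
      rw [smul_smul]
      congr 1
      simp only [_root_.map_smul, _root_.smul_apply, smul_eq_mul]
      ring)
    (fun v w X => by
      rw [← tr_add]
      refine tr_congr fun i j => ?_
      rw [← add_smul]
      congr 1
      simp only [_root_.map_add, _root_.add_apply]
      ring)
    (fun c v X => by
      rw [← tr_smul]
      refine tr_congr fun i j => ?_
      rw [smul_smul]
      congr 1
      simp only [_root_.map_smul, _root_.smul_apply, smul_eq_mul]
      ring)

variable {g : Euc m →L[ℝ] Euc m →L[ℝ] ℝ} {g' : Euc m →L[ℝ] Euc m →L[ℝ] Euc m →L[ℝ] ℝ}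

theorem christoffel_symm (h : ∀ v X Y, g' v X Y = g' v Y X) (v X : Euc m) :
    christoffel g g' v X = christoffel g g' X v := by
  simp only [christoffel, LinearMap.mk₂_apply]
  refine tr_congr fun i j => ?_
  rw [h _ v X]
  congr 1
  ring

/-- The Koszul formula: pairing with Y lowers the index that the trace in the definition has raised.
-/
theorem inner_christoffel (hg : IsMetric g) (v X Y : Euc m) : g (christoffel g g' v X) Y =
    (1 / 2 : ℝ) * (g' v X Y + g' X v Y - g' Y v X) := by
  have h := map_tr (g := g) ((g.flip Y : Euc m →L[ℝ] ℝ) : Euc m →ₗ[ℝ] ℝ) fun a b =>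
    ((1 / 2 : ℝ) * (g' v X a + g' X v a - g' a v X)) • b
  refine (show _ = _ from h).trans ?_
  have e : ∀ a b, ((g.flip Y : Euc m →L[ℝ] ℝ) : Euc m →ₗ[ℝ] ℝ)
      (((1 / 2 : ℝ) * (g' v X a + g' X v a - g' a v X)) • b) =
      g Y b • ((1 / 2 : ℝ) * (g' v X a + g' X v a - g' a v X)) := by
    intro a b
    rw [_root_.map_smul, smul_eq_mul, smul_eq_mul, mul_comm]
    congr 1
    exact hg.symm _ _
  simp only [e]
  exact tr_contract' hg (f := fun a => (1 / 2 : ℝ) * (g' v X a + g' X v a - g' a v X))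
    ⟨fun a b => by simp only [_root_.map_add, _root_.add_apply]; ring,
      fun c a => by simp only [_root_.map_smul, _root_.smul_apply, smul_eq_mul]; ring⟩ Y

theorem christoffel_metric (hg : IsMetric g) (h : ∀ v X Y, g' v X Y = g' v Y X) (v X Y : Euc m) :
    g (christoffel g g' v X) Y + g X (christoffel g g' v Y) = g' v X Y := by
  rw [hg.symm X, inner_christoffel hg, inner_christoffel hg, h v Y X]
  ring

end Christoffel

/-! ### Derivatives of fields of forms -/

/-- The derivative of a field of forms in the direction of `v`. -/
def pd (α : Euc m → GForm m) (y v : Euc m) : GForm m := fun k => fderiv ℝ (fun z => α z k) y v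

theorem isLinear_pd (α : Euc m → GForm m) (y : Euc m) : IsLinearMap ℝ (pd α y) :=
  ⟨fun v w => funext fun k => (fderiv ℝ (fun z => α z k) y).map_add v w,
    fun c v => funext fun k => (fderiv ℝ (fun z => α z k) y).map_smul c v⟩

theorem pd_congr {α β : Euc m → GForm m} {y : Euc m} (h : α =ᶠ[nhds y] β) (v : Euc m) :
    pd α y v = pd β y v := by
  funext k
  have : (fun z => α z k) =ᶠ[nhds y] fun z => β z k := h.mono fun z hz => by simp only [hz]
  exact congrArg (fun A : Euc m →L[ℝ] Euc m [⋀^Fin k]→L[ℝ] ℂ => A v) this.fderiv_eq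

theorem hasDerivAt_line {X : Type*} [NormedAddCommGroup X] [NormedSpace ℝ X] {f : Euc m → X}
    {y : Euc m} (hf : DifferentiableAt ℝ f y) (v : Euc m) :
    HasDerivAt (fun t : ℝ => f (y + t • v)) (fderiv ℝ f y v) 0 :=
  hf.hasFDerivAt.hasLineDerivAt v

theorem contDiffAt_line {X : Type*} [NormedAddCommGroup X] [NormedSpace ℝ X] {f : Euc m → X}
    {y : Euc m} (hf : ContDiffAt ℝ ∞ f y) (v : Euc m) :
    ContDiffAt ℝ ∞ (fun t : ℝ => f (y + t • v)) 0 := by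
  have h : ContDiffAt ℝ ∞ (fun t : ℝ => y + t • v) 0 := by fun_prop
  refine ContDiffAt.comp (0 : ℝ) ?_ h
  simpa using hf

theorem tendsto_line (y v : Euc m) : Filter.Tendsto (fun t : ℝ => y + t • v) (nhds 0) (nhds y) := by
  have h : Continuous fun t : ℝ => y + t • v := by fun_prop
  simpa using h.tendsto 0

theorem SmoothAt.hasD {α : Euc m → GForm m} {y : Euc m} (hα : SmoothAt α y) (v : Euc m) :
    HasD (fun t => α (y + t • v)) (pd α y v) := fun k =>
  hasDerivAt_line ((hα k).differentiableAt (by simp)) v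

theorem SmoothAt.pd_eq {α : Euc m → GForm m} {y : Euc m} (hα : SmoothAt α y) {v : Euc m}
    {α' : GForm m} (h : HasD (fun t => α (y + t • v)) α') : pd α y v = α' := (hα.hasD v).unique h

theorem SmoothAt.pd {α : Euc m → GForm m} {y : Euc m} (hα : SmoothAt α y) (v : Euc m) :
    SmoothAt (fun z => GForm.pd α z v) y := fun k =>
  ((hα k).fderiv_right (m := ∞) (by simp)).clm_apply contDiffAt_const

/-- The exterior derivative. -/
def dd (α : Euc m → GForm m) (y : Euc m) : GForm m := alt (pd α y)

theorem SmoothAt.dd {α : Euc m → GForm m} {y : Euc m} (hα : SmoothAt α y) :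
    SmoothAt (dd α) y := SmoothAt.alt fun i => hα.pd (stdVec i)

theorem dd_succ (α : Euc m → GForm m) (y : Euc m) (k : ℕ) :
    dd α y (k + 1) = extDeriv (fun z => α z k) y :=
  alt_eq_alternatize _ fun _ => rfl

theorem dd_const_smul {α : Euc m → GForm m} {y : Euc m} (c : ℂ) (hα : SmoothAt α y) :
    dd (fun z => c • α z) y = c • dd α y := by
  rw [dd, dd, ← alt_smul]
  exact alt_congr fun i => (hα.const_smul c).pd_eq ((hα.hasD _).const_smul c)

theorem dd_congr {α β : Euc m → GForm m} {y : Euc m} (h : α =ᶠ[nhds y] β) : dd α y = dd β y :=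
  alt_congr fun _ => pd_congr h _

end GForm

/-! ### The Levi-Civita derivative of forms -/

namespace GForm

variable {m : ℕ} {g : Euc m → Euc m →L[ℝ] Euc m →L[ℝ] ℝ} {J : Euc m → Euc m →L[ℝ] Euc m}
  {y : Euc m}

/-- A smooth almost Hermitian structure on a neighbourhood of `y`. -/
structure HermAt (g : Euc m → Euc m →L[ℝ] Euc m →L[ℝ] ℝ) (J : Euc m → Euc m →L[ℝ] Euc m)
    (y : Euc m) : Prop where
  smooth_g : ContDiffAt ℝ ∞ g y
  smooth_J : ContDiffAt ℝ ∞ J y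
  metric : ∀ᶠ z in nhds y, IsMetric (g z)
  J_J : ∀ᶠ z in nhds y, ∀ v, J z (J z v) = -v
  skew : ∀ᶠ z in nhds y, ∀ v w, g z (J z v) w = -g z v (J z w)

/-- The Christoffel symbols of a metric at a point. -/
def chr (g : Euc m → Euc m →L[ℝ] Euc m →L[ℝ] ℝ) (y : Euc m) : Euc m →ₗ[ℝ] Euc m →ₗ[ℝ] Euc m :=
  christoffel (g y) (fderiv ℝ g y)

/-- The covariant derivative of a field of forms. -/
def nab (g : Euc m → Euc m →L[ℝ] Euc m →L[ℝ] ℝ) (α : Euc m → GForm m) (y v : Euc m) : GForm m :=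
  pd α y v - der (chr g y v) (α y)

/-- The covariant derivative of a field of endomorphisms. -/
def covEnd (g : Euc m → Euc m →L[ℝ] Euc m →L[ℝ] ℝ) (J : Euc m → Euc m →L[ℝ] Euc m) (y : Euc m) :
    Euc m →ₗ[ℝ] Euc m →ₗ[ℝ] Euc m :=
  LinearMap.mk₂ ℝ (fun v X => fderiv ℝ J y v X - J y (chr g y v X) + chr g y v (J y X))
    (fun v w X => by simp only [_root_.map_add, _root_.add_apply, LinearMap.add_apply]; abel)
    (fun c v X => by
      simp only [_root_.map_smul, _root_.smul_apply, LinearMap.smul_apply, smul_add, smul_sub])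
    (fun v w X => by simp only [_root_.map_add]; abel)
    (fun c v X => by simp only [_root_.map_smul, smul_add, smul_sub])

theorem covEnd_apply (v X : Euc m) : covEnd g J y v X =
    fderiv ℝ J y v X - J y (chr g y v X) + chr g y v (J y X) := rfl

/-- The formal adjoint of the exterior derivative. -/
def dstar (g : Euc m → Euc m →L[ℝ] Euc m →L[ℝ] ℝ) (α : Euc m → GForm m) (y : Euc m) : GForm m :=
  -tr (g y) fun u v => contr u (nab g α y v)

theorem isLinear_der_left (T : Euc m →ₗ[ℝ] Euc m →ₗ[ℝ] Euc m) (α : GForm m) :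
    IsLinearMap ℝ fun v => der (T v) α :=
  ⟨fun v w => by rw [_root_.map_add, der_add], fun c v => by rw [_root_.map_smul, der_smul]⟩

theorem isLinear_nab (α : Euc m → GForm m) : IsLinearMap ℝ (nab g α y) :=
  ((isLinear_pd α y).mk' _ - (isLinear_der_left (chr g y) (α y)).mk' _).isLinear

theorem nab_congr {α β : Euc m → GForm m} (h : α =ᶠ[nhds y] β) (v : Euc m) :
    nab g α y v = nab g β y v := by rw [nab, nab, pd_congr h, h.self_of_nhds]

theorem dstar_congr {α β : Euc m → GForm m} (h : α =ᶠ[nhds y] β) : dstar g α y = dstar g β y := by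
  simp only [dstar, nab_congr h]

theorem fderiv_metric_symm (h : HermAt g J y) (v X Y : Euc m) :
    fderiv ℝ g y v X Y = fderiv ℝ g y v Y X := by
  have hd := hasDerivAt_line (h.smooth_g.differentiableAt (by simp)) v
  have h1 : ∀ X Y, HasDerivAt (fun t : ℝ => g (y + t • v) X Y) (fderiv ℝ g y v X Y) 0 := by
    intro X Y
    simpa using (hd.clm_apply (hasDerivAt_const (0 : ℝ) X)).clm_apply (hasDerivAt_const (0 : ℝ) Y)
  refine (h1 X Y).unique ((h1 Y X).congr_of_eventuallyEq ?_)
  filter_upwards [(tendsto_line y v).eventually h.metric] with t ht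
  exact ht.symm X Y

theorem chr_symm (h : HermAt g J y) (v X : Euc m) : chr g y v X = chr g y X v :=
  christoffel_symm (fderiv_metric_symm h) v X

theorem HermAt.hasDerivAt_metric (h : HermAt g J y) (v X Y : Euc m) :
    HasDerivAt (fun t : ℝ => g (y + t • v) X Y)
      (g y (chr g y v X) Y + g y X (chr g y v Y)) 0 := by
  have hd := hasDerivAt_line (h.smooth_g.differentiableAt (by simp)) v
  rw [chr, christoffel_metric h.metric.self_of_nhds (fderiv_metric_symm h)]
  simpa using (hd.clm_apply (hasDerivAt_const (0 : ℝ) X)).clm_apply (hasDerivAt_const (0 : ℝ) Y)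

theorem HermAt.metricCurve (h : HermAt g J y) (v : Euc m) :
    MetricCurve (fun t : ℝ => g (y + t • v)) (chr g y v) where
  smooth := contDiffAt_line h.smooth_g v
  metric := (tendsto_line y v).eventually h.metric
  deriv X Y := by simpa using h.hasDerivAt_metric v X Y

/-- The connection is torsion-free, so its coefficients disappear in the alternation. -/
theorem dd_eq_alt_nab (h : HermAt g J y) (α : Euc m → GForm m) : dd α y = alt (nab g α y) := by
  have : alt (nab g α y) = alt (pd α y) - alt fun v => der (chr g y v) (α y) := alt_sub _ _
  rw [this, alt_der_of_symm _ (chr_symm h), sub_zero, dd]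

/-! ### The divergence theorem at a point -/

theorem isLinear_coord_smul (i : Fin m) (α : GForm m) :
    IsLinearMap ℝ fun w : Euc m => w i • α :=
  isLinear_smul (EuclideanSpace.proj (𝕜 := ℝ) i : Euc m →L[ℝ] ℝ).toLinearMap α

theorem SmoothAt.coord_wedge {α : Euc m → GForm m} (hα : SmoothAt α y) (i : Fin m) :
    SmoothAt (fun z => GForm.alt fun w : Euc m => w i • α z) y :=
  SmoothAt.alt (F := fun z w => w i • α z) fun _ => SmoothAt.smul contDiffAt_const hα

/-- The product rule for the metric connection. The coordinate covector `w i` is not parallel, and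
its covariant derivative gives the middle term. -/
theorem HermAt.hasDerivAt_flux (h : HermAt g J y) {α β : Euc m → GForm m} (hα : SmoothAt α y)
    (hβ : SmoothAt β y) (i : Fin m) (v : Euc m) :
    HasDerivAt (fun t : ℝ => inn (g (y + t • v)) (alt fun w : Euc m => w i • α (y + t • v))
        (β (y + t • v)))
      (inn (g y) (alt fun w : Euc m => w i • nab g α y v) (β y) -
        inn (g y) (alt fun w : Euc m => (chr g y v w) i • α y) (β y) +
        inn (g y) (alt fun w : Euc m => w i • α y) (nab g β y v)) 0 := by
  have h1 : HasD (fun t : ℝ => alt fun w : Euc m => w i • α (y + t • v))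
      (alt fun w : Euc m => w i • pd α y v) := by
    refine HasD.alt (F := fun t w => w i • α (y + t • v)) (F' := fun w => w i • pd α y v)
      fun j => ?_
    simp only [real_smul_eq]
    exact (hα.hasD v).const_smul _
  have h2 := (h.metricCurve v).hasDerivAt_inn h1 (hβ.hasD v)
  refine h2.congr_deriv ?_
  simp only [zero_smul, add_zero]
  have e : (alt fun w : Euc m => w i • pd α y v) - der (chr g y v) (alt fun w : Euc m => w i • α y) =
      (alt fun w : Euc m => w i • nab g α y v) - alt fun w : Euc m => (chr g y v w) i • α y := by
    rw [der_alt _ (isLinear_coord_smul i (α y)), ← alt_sub, ← alt_sub]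
    refine alt_congr fun j => ?_
    rw [map_real_smul, nab, smul_sub, sub_add_eq_sub_sub]
  rw [e, _root_.map_sub, LinearMap.sub_apply]
  rfl

/-- The density of the volume in coordinates. -/
def volDensity (g : Euc m → Euc m →L[ℝ] Euc m →L[ℝ] ℝ) (y : Euc m) : ℝ :=
  √(gramMatrix (g y) (stdVec (m := m))).det

theorem HermAt.contDiffAt_volDensity (h : HermAt g J y) : ContDiffAt ℝ ∞ (volDensity g) y :=
  (contDiffAt_det (contDiffAt_gram h.smooth_g)).sqrt
    (gram_posDef h.metric.self_of_nhds).det_pos.ne'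

theorem HermAt.hasDerivAt_volDensity (h : HermAt g J y) (v : Euc m) :
    HasDerivAt (fun t : ℝ => volDensity g (y + t • v))
      (volDensity g y * ∑ i, chr g y v (stdVec i) i) 0 := by
  simpa [volDensity] using (h.metricCurve v).hasDerivAt_sqrt_det

/-- The `i`-th component of the vector field `inn (θ ∧ α) β`, as a function of the covector `θ`,
times the density of the volume. -/
def flux (g : Euc m → Euc m →L[ℝ] Euc m →L[ℝ] ℝ) (α β : Euc m → GForm m) (i : Fin m)
    (z : Euc m) : ℂ :=
  (volDensity g z : ℂ) * inn (g z) (alt fun w : Euc m => w i • α z) (β z)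

theorem HermAt.contDiffAt_flux (h : HermAt g J y) {α β : Euc m → GForm m} (hα : SmoothAt α y)
    (hβ : SmoothAt β y) (i : Fin m) : ContDiffAt ℝ ∞ (flux g α β i) y :=
  (Complex.ofRealCLM.contDiff.contDiffAt.comp y h.contDiffAt_volDensity).mul
    ((hα.coord_wedge i).inn h.smooth_g h.metric.self_of_nhds hβ)

/-- The covariant derivative distributes over the coordinate covector, α and β. The last two give dα
and -d*β; the derivative of the covector cancels against that of the volume density. -/
theorem HermAt.divergence (h : HermAt g J y) {α β : Euc m → GForm m} (hα : SmoothAt α y)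
    (hβ : SmoothAt β y) : ∑ i, fderiv ℝ (flux g α β i) y (stdVec i) =
      (volDensity g y : ℂ) * (inn (g y) (dd α y) (β y) - inn (g y) (α y) (dstar g β y)) := by
  have hm := h.metric.self_of_nhds
  have e : ∀ i, fderiv ℝ (flux g α β i) y (stdVec i) =
      (volDensity g y : ℂ) * ((∑ j, chr g y (stdVec i) (stdVec j) j : ℝ) *
          inn (g y) (alt fun w : Euc m => w i • α y) (β y) +
        (inn (g y) (alt fun w : Euc m => w i • nab g α y (stdVec i)) (β y) -
        inn (g y) (alt fun w : Euc m => (chr g y (stdVec i) w) i • α y) (β y) +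
        inn (g y) (alt fun w : Euc m => w i • α y) (nab g β y (stdVec i)))) := by
    intro i
    refine (hasDerivAt_line ((h.contDiffAt_flux hα hβ i).differentiableAt (by simp))
      (stdVec i)).unique ?_
    have h2 := (h.hasDerivAt_volDensity (stdVec i)).ofReal_comp.mul
      (h.hasDerivAt_flux hα hβ i (stdVec i))
    refine h2.congr_deriv ?_
    simp only [zero_smul, add_zero]
    push_cast
    ring
  simp only [e]
  rw [← Finset.mul_sum]
  congr 1
  simp only [Finset.sum_add_distrib, Finset.sum_sub_distrib]
  have e1 : ∑ i, inn (g y) (alt fun w : Euc m => w i • nab g α y (stdVec i)) (β y) =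
      inn (g y) (dd α y) (β y) := by
    rw [dd_eq_alt_nab h, ← LinearMap.sum_apply, ← _root_.map_sum, ← alt_sum]
    simp only [(isLinear_nab (g := g) (y := y) α).sum_coord]
  have e2 : ∑ i, inn (g y) (alt fun w : Euc m => w i • α y) (nab g β y (stdVec i)) =
      -inn (g y) (α y) (dstar g β y) := by
    rw [dstar, _root_.map_neg, neg_neg, inn_tr_right, ← tr_swap hm]
    simp only [inn_alt (isLinear_coord_smul _ (α y)), inn_real_smul_left]
    rw [← tr_sum]
    refine tr_congr fun a b => ?_
    have h3 := (isLinear_inn_right (g := g y) (isLinear_contr_comp (stdVec b)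
      (isLinear_nab (g := g) (y := y) β)) (α y)).sum_coord (stdVec a)
    rw [← h3]
    exact Finset.sum_congr rfl fun i _ => (Complex.real_smul).symm
  -- The cancellation rests on the symmetry of the Christoffel symbols: the sum over i of the i-th
  -- component of Γ(e_i, e_j) is the trace of Γ(e_j, ·).
  have e3 : ∑ i, inn (g y) (alt fun w : Euc m => (chr g y (stdVec i) w) i • α y) (β y) =
      ∑ i, ((∑ j, chr g y (stdVec i) (stdVec j) j : ℝ) : ℂ) *
        inn (g y) (alt fun w : Euc m => w i • α y) (β y) := by
    simp only [← inn_real_smul_left, ← alt_smul]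
    rw [← LinearMap.sum_apply, ← LinearMap.sum_apply, ← _root_.map_sum, ← _root_.map_sum,
      ← alt_sum, ← alt_sum]
    congr 2
    refine alt_congr fun j => ?_
    simp only [← rmul_smul]
    have hs : ∀ c : Fin m → ℝ, ∑ i, c i • α y = (∑ i, c i) • α y := fun c =>
      (Finset.sum_smul (f := c) (x := α y)).symm
    rw [hs, hs]
    congr 1
    simp [chr_symm h _ (stdVec j)]
  rw [e1, e2, e3]
  ring

end GForm

namespace GForm

variable {m : ℕ}

/-! ### The torsion operator -/

section Torsion

variable {g : Euc m →L[ℝ] Euc m →L[ℝ] ℝ} {J : Euc m →L[ℝ] Euc m}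
  {K : Euc m →ₗ[ℝ] Euc m →ₗ[ℝ] Euc m}

/-- The bilinear form `(X, Y) ↦ g (T X, Y)`. -/
def endForm (g : Euc m →L[ℝ] Euc m →L[ℝ] ℝ) (T : Euc m →ₗ[ℝ] Euc m) : Euc m →ₗ[ℝ] Euc m →ₗ[ℝ] ℝ :=
  LinearMap.mk₂ ℝ (fun X Y => g (T X) Y)
    (fun v w X => by simp only [_root_.map_add, _root_.add_apply])
    (fun c v X => by simp only [_root_.map_smul, _root_.smul_apply])
    (fun v w X => by simp only [_root_.map_add])
    (fun c v X => by simp only [_root_.map_smul])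

theorem endForm_apply (T : Euc m →ₗ[ℝ] Euc m) (X Y : Euc m) : endForm g T X Y = g (T X) Y := rfl

theorem isLinear_wedge_endForm (K : Euc m →ₗ[ℝ] Euc m →ₗ[ℝ] Euc m) (α : GForm m) :
    IsLinearMap ℝ fun v => wedgeTwo (endForm g (K v)) α :=
  ⟨fun v w => by
    rw [← wedgeTwo_add]
    congr 2
    ext i j
    simp [endForm_apply],
  fun c v => by
    rw [← wedgeTwo_smul]
    congr 2
    ext i j
    simp [endForm_apply]⟩

variable (g) in
/-- The operator by which the covariant derivative `K` of the almost complex structure enters the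
commutation relations. -/
def tors (K : Euc m →ₗ[ℝ] Euc m →ₗ[ℝ] Euc m) (α : GForm m) : GForm m :=
  tr g (fun u v => contr u (wedgeTwo (endForm g (K v)) α)) - alt fun w => der (K w) α

theorem tors_const_smul (c : ℂ) (α : GForm m) : tors g K (c • α) = c • tors g K α := by
  simp only [tors, _root_.map_smul, tr_smul_complex, alt_smul, smul_sub]

theorem tors_neg (α : GForm m) : tors g (-K) α = -tors g K α := by
  have e1 : ∀ v, wedgeTwo (endForm g ((-K) v)) α = -wedgeTwo (endForm g (K v)) α := fun v => by
    have := (isLinear_wedge_endForm (g := g) K α).map_neg v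
    simp only [_root_.map_neg] at this
    exact this
  have e2 : ∀ v, der ((-K) v) α = -der (K v) α := fun v => by
    have := (isLinear_der_left K α).map_neg v
    simp only [_root_.map_neg] at this
    exact this
  simp only [tors, e1, e2, _root_.map_neg, tr_neg, alt_neg]
  abel

/-- The commutator with `der J` inserts J in three places. In the first term these are the two
arguments of the two-form and the traced vector; in the second, the commutator of J with `K w`
counts twice and the alternated vector once. By `h1` and `h2` each insertion replaces K by K ∘ J. -/
theorem der_tors (hg : IsMetric g) (hJ : ∀ v w, g (J v) w = -g v (J w))
    (h1 : ∀ v X, K v (J X) = -J (K v X)) (h2 : ∀ v X, K (J v) X = K v (J X)) (α : GForm m) :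
    der J (tors g K α) = tors g K (der J α) + (3 : ℂ) • tors g (K ∘ₗ J.toLinearMap) α := by
  have e1 : ∀ v, der J (wedgeTwo (endForm g (K v)) α) =
      (2 : ℂ) • wedgeTwo (endForm g (K (J v))) α + wedgeTwo (endForm g (K v)) (der J α) := by
    intro v
    rw [der_wedgeTwo]
    congr 1
    have : (2 : ℂ) • wedgeTwo (endForm g (K (J v))) α =
        (2 : ℝ) • wedgeTwo (endForm g (K (J v))) α := by
      rw [real_smul_eq]
      norm_num
    rw [this, ← wedgeTwo_smul]
    congr 2
    ext X Y
    simp only [LinearMap.add_apply, LinearMap.compl₁₂_apply, LinearMap.id_apply, endForm_apply,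
      LinearMap.smul_apply, smul_eq_mul, ContinuousLinearMap.coe_coe, h2]
    have := hJ (K v X) Y
    simp only [h1, _root_.map_neg, _root_.neg_apply] at this ⊢
    linarith
  have e2 : tr g (fun u v => contr (J u) (wedgeTwo (endForm g (K v)) α)) =
      -tr g (fun u v => contr u (wedgeTwo (endForm g (K (J v))) α)) :=
    tr_skew hg (K := J) hJ (B := fun u v => contr u (wedgeTwo (endForm g (K v)) α))
      (fun v => isLinear_contr _) (fun u => isLinear_contr_comp u (isLinear_wedge_endForm K α))
  have e3 : ∀ w, der J (der (K w) α) = der (K w) (der J α) + (2 : ℂ) • der (K (J w)) α := by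
    intro w
    rw [← sub_eq_iff_eq_add', der_comm]
    have : (2 : ℂ) • der (K (J w)) α = (2 : ℝ) • der (K (J w)) α := by
      rw [real_smul_eq]
      norm_num
    rw [this, ← der_smul]
    congr 2
    ext X Y
    simp [h1, h2, two_mul, sub_eq_add_neg]
  have e4 : ∀ u v, der J (contr u (wedgeTwo (endForm g (K v)) α)) =
      contr u (wedgeTwo (endForm g (K v)) (der J α)) +
      (2 : ℂ) • contr u (wedgeTwo (endForm g (K (J v))) α) -
        contr (J u) (wedgeTwo (endForm g (K v)) α) := by
    intro u v
    have := contr_der J u (wedgeTwo (endForm g (K v)) α)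
    rw [e1, _root_.map_add, _root_.map_smul] at this
    rw [add_comm (contr u _), this]
    simp
  have e5 : der J (alt fun w => der (K w) α) =
      (alt fun w => der (K w) (der J α)) + (3 : ℂ) • alt fun w => der (K (J w)) α := by
    rw [der_alt _ (isLinear_der_left K α), ← alt_smul, ← alt_add]
    refine alt_congr fun i => ?_
    rw [e3]
    module
  rw [tors, _root_.map_sub, e5, map_tr_complex]
  simp only [e4, tr_sub, tr_add, tr_smul_complex, e2]
  simp only [tors, LinearMap.comp_apply, ContinuousLinearMap.coe_coe]
  module

/-- Applying `der_tors` to K and to K ∘ J, where (K ∘ J) ∘ J = -K, shows that the double commutator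
of `der J` with the torsion operator is -9 times the latter. Between weights w and w' this double
commutator is the scalar -(w' - w)², so only shifts by ±3 survive. -/
theorem weight_tors (hg : IsMetric g) (hJJ : ∀ v, J (J v) = -v)
    (hJ : ∀ v w, g (J v) w = -g v (J w)) (h1 : ∀ v X, K v (J X) = -J (K v X))
    (h2 : ∀ v X, K (J v) X = K v (J X)) {w w' : ℤ} (hw : (w' - w) ^ 2 ≠ 9) (α : GForm m) :
    weight J w' (tors g K (weight J w α)) = 0 := by
  set β := weight J w α with hβ
  have e1 := der_tors hg hJ h1 h2 β
  have e2 := der_tors hg hJ (K := K ∘ₗ J.toLinearMap) (fun v X => h1 (J v) X)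
    (fun v X => h2 (J v) X) β
  have e3 : (K ∘ₗ J.toLinearMap) ∘ₗ J.toLinearMap = -K := by
    ext v X : 2
    simp [hJJ]
  rw [e3, tors_neg] at e2
  have e4 : der J β = (Complex.I * w) • β := der_weight hJJ w α
  rw [e4, tors_const_smul] at e1 e2
  have e5 := congrArg (weight J w') e1
  have e6 := congrArg (weight J w') e2
  rw [weight_der hJJ, _root_.map_add, _root_.map_smul, _root_.map_smul] at e5 e6
  rw [_root_.map_neg] at e6
  set a := weight J w' (tors g K β)
  set b := weight J w' (tors g (K ∘ₗ J.toLinearMap) β)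
  have h7 : (Complex.I * (w' - w)) • a = (3 : ℂ) • b := by
    have : (Complex.I * (w' - w)) • a = (Complex.I * w') • a - (Complex.I * w) • a := by module
    rw [this, e5]
    module
  have h8 : (Complex.I * (w' - w)) • b = (-3 : ℂ) • a := by
    have : (Complex.I * (w' - w)) • b = (Complex.I * w') • b - (Complex.I * w) • b := by module
    rw [this, e6]
    module
  have h9 : (Complex.I * (w' - w) * (Complex.I * (w' - w)) + 9 : ℂ) • a = 0 := by
    rw [cadd_smul, cmul_smul, h7, smul_comm, h8]
    module
  refine eq_zero_of_smul_eq_zero ?_ h9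
  intro h0
  apply hw
  have : (((w' - w) ^ 2 : ℤ) : ℂ) = (9 : ℤ) := by
    push_cast
    linear_combination -h0 + ((w' : ℂ) - w) ^ 2 * Complex.I_mul_I
  exact_mod_cast this

/-- The covariant derivative `K` of an almost complex structure satisfies `K (J v) = K v ∘ J` if
the alternation of `(X, Y, Z) ↦ g (K X Y, Z)` has no components of type `(2, 1)` and `(1, 2)`. -/
theorem cov_J_of_type (hg : IsMetric g) (hJJ : ∀ v, J (J v) = -v)
    (hJ : ∀ v w, g (J v) w = -g v (J w)) (h1 : ∀ v X, K v (J X) = -J (K v X))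
    (hK : ∀ v X Y, g (K v X) Y = -g (K v Y) X)
    (hψ : ∀ X Y Z, g (K (J X) (J Y)) Z + g (K (J Y) Z) (J X) + g (K Z (J X)) (J Y) =
      -(g (K X Y) Z + g (K Y Z) X + g (K Z X) Y)) (v X : Euc m) : K (J v) X = K v (J X) := by
  have hA : ∀ v X Y, g (K v (J X)) Y = g (K v X) (J Y) := by
    intro v X Y
    rw [h1, _root_.map_neg, _root_.neg_apply, hJ, neg_neg]
  -- The vanishing of C is the claim, up to replacing X by J X. The hypothesis on types makes C
  -- symmetric in the first two arguments, while `hK` and `h1` make it skew in the last two.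
  -- Alternating the two symmetries six times gives C = -C, as in the uniqueness of the Levi-Civita
  -- connection.
  set C : Euc m → Euc m → Euc m → ℝ := fun X Y Z => g (K X Y) Z + g (K (J X) (J Y)) Z with hC
  have c1 : ∀ X Y Z, C X Y Z = C Y X Z := by
    intro X Y Z
    have a1 := hψ X Y Z
    have a2 := hA Z X (J Y)
    rw [hJJ, _root_.map_neg] at a2
    have a3 := hK Y Z X
    have a4 := hK (J Y) Z (J X)
    simp only [hC]
    linarith
  have c2 : ∀ X Y Z, C X Y Z = -C X Z Y := by
    intro X Y Z
    have a1 := hK X Y Z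
    have a2 := hK (J X) (J Y) Z
    have a3 := hA (J X) Z Y
    simp only [hC]
    linarith
  have c3 : ∀ X Y Z, C X Y Z = 0 := by
    intro X Y Z
    have b1 := c1 X Y Z
    have b2 := c2 Y X Z
    have b3 := c1 Y Z X
    have b4 := c2 Z Y X
    have b5 := c1 Z X Y
    have b6 := c2 X Z Y
    linarith
  have c4 : ∀ Z, g (K (J v) X - K v (J X)) Z = 0 := by
    intro Z
    have := c3 v (J X) Z
    simp only [hC, hJJ, _root_.map_neg, _root_.neg_apply] at this
    rw [_root_.map_sub, _root_.sub_apply]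
    linarith
  by_contra hne
  have := hg.pos _ (sub_ne_zero.mpr hne)
  rw [c4] at this
  exact lt_irrefl _ this

end Torsion

end GForm

namespace GForm

variable {m : ℕ} {g : Euc m → Euc m →L[ℝ] Euc m →L[ℝ] ℝ} {J : Euc m → Euc m →L[ℝ] Euc m}
  {y : Euc m}

/-! ### The covariant derivative of the almost complex structure -/

theorem HermAt.hasDerivAt_J (h : HermAt g J y) (v X : Euc m) :
    HasDerivAt (fun t : ℝ => J (y + t • v) X) (fderiv ℝ J y v X) 0 := by
  simpa using (hasDerivAt_line (h.smooth_J.differentiableAt (by simp)) v).clm_apply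
    (hasDerivAt_const (0 : ℝ) X)

/-- Differentiation of J² = -1. -/
theorem HermAt.covEnd_J (h : HermAt g J y) (v X : Euc m) :
    covEnd g J y v (J y X) = -J y (covEnd g J y v X) := by
  have hJJ := h.J_J.self_of_nhds
  have h1 : HasDerivAt (fun t : ℝ => J (y + t • v) (J (y + t • v) X))
      (fderiv ℝ J y v (J y X) + J y (fderiv ℝ J y v X)) 0 := by
    simpa using (hasDerivAt_line (h.smooth_J.differentiableAt (by simp)) v).clm_apply
      (h.hasDerivAt_J v X)
  have h2 : HasDerivAt (fun t : ℝ => J (y + t • v) (J (y + t • v) X)) 0 0 := by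
    refine (hasDerivAt_const (0 : ℝ) (-X)).congr_of_eventuallyEq ?_
    filter_upwards [(tendsto_line y v).eventually h.J_J] with t ht
    exact ht X
  have h3 := h1.unique h2
  rw [covEnd_apply, covEnd_apply, _root_.map_add, _root_.map_sub, hJJ, hJJ, _root_.map_neg,
    eq_neg_of_add_eq_zero_left h3]
  abel

theorem HermAt.hasDerivAt_omega (h : HermAt g J y) (v X Y : Euc m) :
    HasDerivAt (fun t : ℝ => g (y + t • v) (J (y + t • v) X) Y)
      (g y (J y (chr g y v X)) Y + g y (J y X) (chr g y v Y) + g y (covEnd g J y v X) Y) 0 := by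
  have hd := hasDerivAt_line (h.smooth_g.differentiableAt (by simp)) v
  have h1 : HasDerivAt (fun t : ℝ => g (y + t • v) (J (y + t • v) X) Y)
      (fderiv ℝ g y v (J y X) Y + g y (fderiv ℝ J y v X) Y) 0 := by
    simpa using (hd.clm_apply (h.hasDerivAt_J v X)).clm_apply (hasDerivAt_const (0 : ℝ) Y)
  refine h1.congr_deriv ?_
  have h2 := christoffel_metric h.metric.self_of_nhds (fderiv_metric_symm h) v (J y X) Y
  change g y (chr g y v (J y X)) Y + g y (J y X) (chr g y v Y) = _ at h2
  rw [← h2, covEnd_apply]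
  simp only [_root_.map_add, _root_.map_sub, _root_.add_apply, _root_.sub_apply]
  ring

/-- Differentiation of the skew symmetry of ω. -/
theorem HermAt.covEnd_skew (h : HermAt g J y) (v X Y : Euc m) :
    g y (covEnd g J y v X) Y = -g y (covEnd g J y v Y) X := by
  have hm := h.metric.self_of_nhds
  have hs := h.skew.self_of_nhds
  have h1 : HasDerivAt (fun t : ℝ => g (y + t • v) (J (y + t • v) X) Y) _ 0 :=
    ((h.hasDerivAt_omega v Y X).neg).congr_of_eventuallyEq (by
      filter_upwards [(tendsto_line y v).eventually h.metric,
        (tendsto_line y v).eventually h.skew] with t ht1 ht2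
      rw [ht2, ht1.symm X]
      rfl)
  have h2 := (h.hasDerivAt_omega v X Y).unique h1
  have a1 := hs (chr g y v X) Y
  have a2 := hs (chr g y v Y) X
  have a3 := hm.symm (chr g y v X) (J y Y)
  have a4 := hm.symm (chr g y v Y) (J y X)
  linarith

/-- The Hermitian form as a field of operators. -/
def wedgeOmega (g : Euc m → Euc m →L[ℝ] Euc m →L[ℝ] ℝ) (J : Euc m → Euc m →L[ℝ] Euc m)
    (α : Euc m → GForm m) (z : Euc m) : GForm m := wedgeTwo (kahlerForm (g z) (J z)) (α z)

/-- The derivation induced by the almost complex structure, as a field of operators. -/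
def derJ (J : Euc m → Euc m →L[ℝ] Euc m) (α : Euc m → GForm m) (z : Euc m) : GForm m :=
  der (J z) (α z)

theorem SmoothAt.wedgeOmega (h : HermAt g J y) {α : Euc m → GForm m} (hα : SmoothAt α y) :
    SmoothAt (wedgeOmega g J α) y :=
  hα.wedgeTwo (A := fun z => kahlerForm (g z) (J z)) fun _ _ =>
    (h.smooth_g.clm_apply (h.smooth_J.clm_apply contDiffAt_const)).clm_apply contDiffAt_const

theorem SmoothAt.derJ (h : HermAt g J y) {α : Euc m → GForm m} (hα : SmoothAt α y) :
    SmoothAt (derJ J α) y := SmoothAt.der h.smooth_J hα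

/-- Leibniz rule, with ∇ω = g((∇J) ·, ·) because the metric is parallel. -/
theorem nab_wedgeOmega (h : HermAt g J y) {α : Euc m → GForm m} (hα : SmoothAt α y) (v : Euc m) :
    nab g (wedgeOmega g J α) y v = wedgeTwo (kahlerForm (g y) (J y)) (nab g α y v) +
      wedgeTwo (endForm (g y) (covEnd g J y v)) (α y) := by
  set S := (kahlerForm (g y) (J y)).compl₁₂ (chr g y v) .id +
    (kahlerForm (g y) (J y)).compl₁₂ .id (chr g y v) with hS
  have h1 : HasD (fun t : ℝ => wedgeOmega g J α (y + t • v)) (wedgeTwo (kahlerForm (g y) (J y))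
      (pd α y v) + wedgeTwo (S + endForm (g y) (covEnd g J y v)) (α y)) := by
    have h2 := HasD.wedgeTwo (A := fun t : ℝ => kahlerForm (g (y + t • v)) (J (y + t • v)))
      (A' := S + endForm (g y) (covEnd g J y v))
      (fun X Y => h.hasDerivAt_omega v X Y) (hα.hasD v)
    simp only [zero_smul, add_zero] at h2
    exact h2
  rw [nab, (SmoothAt.wedgeOmega h hα).pd_eq h1, wedgeOmega, der_wedgeTwo, nab, _root_.map_sub,
    wedgeTwo_add]
  abel

theorem nab_derJ (h : HermAt g J y) {α : Euc m → GForm m} (hα : SmoothAt α y) (v : Euc m) :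
    nab g (derJ J α) y v = der (J y) (nab g α y v) + der (covEnd g J y v) (α y) := by
  have h1 : HasD (fun t : ℝ => derJ J α (y + t • v)) (der (J y) (pd α y v) +
      der (fderiv ℝ J y v) (α y)) := by
    have h2 := HasD.der (hasDerivAt_line (h.smooth_J.differentiableAt (by simp)) v) (hα.hasD v)
    simp only [zero_smul, add_zero] at h2
    exact h2
  have h3 : covEnd g J y v = (fderiv ℝ J y v : Euc m →ₗ[ℝ] Euc m) -
      ((J y).toLinearMap ∘ₗ chr g y v - chr g y v ∘ₗ (J y).toLinearMap) := by
    ext X : 1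
    simp only [covEnd_apply, LinearMap.sub_apply, LinearMap.comp_apply,
      ContinuousLinearMap.coe_coe]
    abel
  rw [nab, (SmoothAt.derJ h hα).pd_eq h1, derJ, h3, der_sub, ← der_comm, nab, _root_.map_sub]
  abel

theorem HermAt.kahlerForm_skew (h : HermAt g J y) (v w : Euc m) :
    kahlerForm (g y) (J y) v w = -kahlerForm (g y) (J y) w v := by
  rw [kahlerForm_apply, kahlerForm_apply, h.skew.self_of_nhds, h.metric.self_of_nhds.symm v]

/-- The commutator of the Lefschetz operator with the adjoint of the exterior derivative, up to
the torsion. -/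
theorem wedgeOmega_dstar (h : HermAt g J y) {α : Euc m → GForm m} (hα : SmoothAt α y) :
    wedgeTwo (kahlerForm (g y) (J y)) (dstar g α y) - dstar g (wedgeOmega g J α) y =
      dd (derJ J α) y - der (J y) (dd α y) + tors (g y) (covEnd g J y) (α y) := by
  have hm := h.metric.self_of_nhds
  have hs := h.skew.self_of_nhds
  have hn := isLinear_nab (g := g) (y := y) α
  -- The alternation of w ↦ ∇_{Jw} α is the common first-order part of both commutators: it arises
  -- here from the contraction of ω, and in `e3` from J acting on the covector in dα. What is left
  -- involves only ∇J and makes up `tors`.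
  have e1 : tr (g y) (fun u v => alt fun w => kahlerForm (g y) (J y) u w • nab g α y v) =
      -alt fun w => nab g α y (J y w) := by
    have e2 : tr (g y) (fun u v => alt fun w => kahlerForm (g y) (J y) u w • nab g α y v) =
        alt fun w => tr (g y) fun u v => kahlerForm (g y) (J y) u w • nab g α y v := by
      simp only [tr, alt_sum, alt_smul]
    rw [e2, ← alt_neg]
    refine alt_congr fun i => ?_
    have e3 : ∀ u v, kahlerForm (g y) (J y) u (stdVec i) • nab g α y v =
        -(g y (J y (stdVec i)) u • nab g α y v) := by
      intro u v
      rw [kahlerForm_apply, hs, hm.symm u, rneg_smul]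
    simp only [e3, tr_neg]
    exact congrArg Neg.neg (tr_contract hm hn (J y (stdVec i)))
  have e2 : dd (derJ J α) y = (alt fun w => der (J y) (nab g α y w)) +
      alt fun w => der (covEnd g J y w) (α y) := by
    rw [dd_eq_alt_nab h, ← alt_add]
    exact alt_congr fun i => nab_derJ h hα _
  have e3 : der (J y) (dd α y) = (alt fun w => der (J y) (nab g α y w)) +
      alt fun w => nab g α y (J y w) := by
    rw [dd_eq_alt_nab h, der_alt _ hn, ← alt_add]
    rfl
  have e4 : dstar g (wedgeOmega g J α) y = wedgeTwo (kahlerForm (g y) (J y)) (dstar g α y) +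
      (alt fun w => nab g α y (J y w)) -
      tr (g y) fun u v => contr u (wedgeTwo (endForm (g y) (covEnd g J y v)) (α y)) := by
    rw [dstar, dstar, _root_.map_neg, map_tr_complex]
    simp only [nab_wedgeOmega h hα, _root_.map_add, contr_wedgeTwo _ h.kahlerForm_skew, tr_add, e1]
    abel
  rw [e2, e3, e4, tors]
  abel

end GForm

namespace GForm

variable {m : ℕ} {g : Euc m → Euc m →L[ℝ] Euc m →L[ℝ] ℝ} {J : Euc m → Euc m →L[ℝ] Euc m}
  {y : Euc m}

/-! ### The components of the exterior derivative and of its adjoint -/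

/-- The component of the exterior derivative which raises the weight by `s`. -/
def delS (J : Euc m → Euc m →L[ℝ] Euc m) (s : ℤ) (α : Euc m → GForm m) (y : Euc m) : GForm m :=
  ∑ w ∈ Finset.Icc (-(m + 1) : ℤ) (m + 1),
    weight (J y) (w + s) (dd (fun z => weight (J z) w (α z)) y)

/-- The formal adjoint of `delS J s`. -/
def delStarS (g : Euc m → Euc m →L[ℝ] Euc m →L[ℝ] ℝ) (J : Euc m → Euc m →L[ℝ] Euc m) (s : ℤ)
    (α : Euc m → GForm m) (y : Euc m) : GForm m :=
  ∑ w ∈ Finset.Icc (-(m + 1) : ℤ) (m + 1),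
    weight (J y) w (dstar g (fun z => weight (J z) (w + s) (α z)) y)

theorem SmoothAt.delS {α : Euc m → GForm m} (hJ : ContDiffAt ℝ ∞ J y) (hα : SmoothAt α y) (s : ℤ) :
    SmoothAt (delS J s α) y :=
  SmoothAt.sum fun w _ => SmoothAt.weight hJ (SmoothAt.dd (hα.weight hJ w)) (w + s)

theorem delS_congr {α β : Euc m → GForm m} (h : α =ᶠ[nhds y] β) (s : ℤ) :
    delS J s α y = delS J s β y := by
  refine Finset.sum_congr rfl fun w _ => congrArg _ (dd_congr ?_)
  exact h.mono fun z hz => by simp only [hz]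

/-- The margin of one at both ends of the range makes room for a shift of the weight by s. -/
theorem sum_Icc_shift {X : Type*} [AddCommMonoid X] {N s : ℤ} (hs : |s| ≤ 1) {f : ℤ → X}
    (hf : ∀ w, N < |w| → f w = 0) :
    ∑ w ∈ Finset.Icc (-(N + 1)) (N + 1), f (w + s) = ∑ w ∈ Finset.Icc (-(N + 1)) (N + 1), f w := by
  have hs' := abs_le.mp hs
  rw [← finsum_eq_sum_of_support_subset, ← finsum_eq_sum_of_support_subset]
  · exact finsum_comp_equiv (Equiv.addRight s)
  · intro w hw
    have : ¬ N < |w| := fun h => hw (hf w h)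
    have := abs_le.mp (not_lt.mp this)
    simp only [Finset.coe_Icc, Set.mem_Icc]
    constructor <;> linarith
  · intro w hw
    have : ¬ N < |w + s| := fun h => hw (hf _ h)
    have := abs_le.mp (not_lt.mp this)
    simp only [Finset.coe_Icc, Set.mem_Icc]
    constructor <;> linarith

theorem dd_zero : dd (fun _ => (0 : GForm m)) y = 0 := by
  have : ∀ v, pd (fun _ => (0 : GForm m)) y v = 0 := fun v => by
    funext k
    simp [pd]
  rw [dd, show pd (fun _ => (0 : GForm m)) y = fun _ => 0 from funext this, alt_zero_fun]

/-- The form ω has type (1,1): `der J` annihilates it since J is skew, so multiplication by ω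
commutes with `der J`. -/
theorem wedgeTwo_kahlerForm_weight (hJJ : ∀ v, J y (J y v) = -v)
    (hJ : ∀ v w, g y (J y v) w = -g y v (J y w)) (w : ℤ) (α : GForm m) :
    weight (J y) w (wedgeTwo (kahlerForm (g y) (J y)) α) =
      wedgeTwo (kahlerForm (g y) (J y)) (weight (J y) w α) := by
  refine weight_comm_of_comm hJJ _ (fun α => ?_) w α
  rw [der_wedgeTwo]
  have : (kahlerForm (g y) (J y)).compl₁₂ (J y : Euc m →ₗ[ℝ] Euc m) .id +
      (kahlerForm (g y) (J y)).compl₁₂ .id (J y : Euc m →ₗ[ℝ] Euc m) = (0 : ℝ) • kahlerForm (g y) (J y) := by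
    ext a b
    simp [kahlerForm_apply, hJ]
  rw [this, wedgeTwo_smul, rzero_smul, zero_add]

/-- The Kähler identity for the commutator with the Lefschetz operator. -/
theorem HermAt.wedgeOmega_delStarS (h : HermAt g J y)
    (ht : ∀ v X, covEnd g J y (J y v) X = covEnd g J y v (J y X)) {s : ℤ} (hs : |s| ≤ 1)
    {α : Euc m → GForm m} (hα : SmoothAt α y) :
    wedgeTwo (kahlerForm (g y) (J y)) (delStarS g J s α y) - delStarS g J s (wedgeOmega g J α) y =
      (Complex.I * s) • delS J (-s) α y := by
  have hm := h.metric.self_of_nhds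
  have hJJ := h.J_J.self_of_nhds
  have hsk := h.skew.self_of_nhds
  have hs2 : s ^ 2 ≠ 9 := by
    have := sq_le_sq' (by linarith [(abs_le.mp hs).1]) (abs_le.mp hs).2
    linarith
  have e1 : delS J (-s) α y = ∑ w ∈ Finset.Icc (-(m + 1) : ℤ) (m + 1),
      weight (J y) w (dd (fun z => weight (J z) (w + s) (α z)) y) := by
    have := sum_Icc_shift (N := m) hs
      (f := fun w => weight (J y) (w - s) (dd (fun z => weight (J z) w (α z)) y)) fun w hw => by
        simp only [weight_eq_zero _ hw, dd_zero, _root_.map_zero]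
    rw [delS]
    simp only [← sub_eq_add_neg]
    rw [← this]
    simp only [add_sub_cancel_right]
  rw [e1, delStarS, delStarS, _root_.map_sum, ← Finset.sum_sub_distrib, Finset.smul_sum]
  refine Finset.sum_congr rfl fun w _ => ?_
  set β : Euc m → GForm m := fun z => weight (J z) (w + s) (α z) with hβ
  have hβs : SmoothAt β y := hα.weight h.smooth_J _
  have e2 : dstar g (fun z => weight (J z) (w + s) (wedgeOmega g J α z)) y =
      dstar g (wedgeOmega g J β) y := by
    refine dstar_congr ?_
    filter_upwards [h.J_J, h.skew] with z h2 h3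
    exact wedgeTwo_kahlerForm_weight h2 h3 _ _
  -- On weight w + s the operator `der J` is a scalar. In weight w its commutator with d is
  -- therefore √-1 ((w + s) - w) = √-1 s times d.
  have e3 : dd (derJ J β) y = (Complex.I * ((w + s : ℤ) : ℂ)) • dd β y := by
    rw [← dd_const_smul _ hβs]
    refine dd_congr ?_
    filter_upwards [h.J_J] with z h2
    exact der_weight h2 _ _
  have e4 := wedgeOmega_dstar h hβs
  rw [e2, ← wedgeTwo_kahlerForm_weight hJJ hsk, ← _root_.map_sub, e4, e3, _root_.map_add,
    _root_.map_sub, _root_.map_smul, weight_der hJJ]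
  -- The shift from w + s to w is neither 3 nor -3, so the torsion does not contribute.
  have e5 : weight (J y) w (tors (g y) (covEnd g J y) (β y)) = 0 :=
    weight_tors hm hJJ hsk h.covEnd_J ht (by simpa using hs2) (α y)
  rw [e5]
  push_cast
  module

/-- The flux whose divergence is the defect of adjointness of `delS` and `delStarS`. -/
def fluxS (g : Euc m → Euc m →L[ℝ] Euc m →L[ℝ] ℝ) (J : Euc m → Euc m →L[ℝ] Euc m) (s : ℤ)
    (α β : Euc m → GForm m) (i : Fin m) (z : Euc m) : ℂ :=
  ∑ w ∈ Finset.Icc (-(m + 1) : ℤ) (m + 1),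
    flux g (fun z => weight (J z) w (α z)) (fun z => weight (J z) (w + s) (β z)) i z

theorem HermAt.contDiffAt_fluxS (h : HermAt g J y) (s : ℤ) {α β : Euc m → GForm m}
    (hα : SmoothAt α y) (hβ : SmoothAt β y) (i : Fin m) : ContDiffAt ℝ ∞ (fluxS g J s α β i) y :=
  ContDiffAt.sum fun w _ => h.contDiffAt_flux (hα.weight h.smooth_J w)
    (hβ.weight h.smooth_J (w + s)) i

theorem HermAt.divergence_fluxS (h : HermAt g J y) (s : ℤ) {α β : Euc m → GForm m}
    (hα : SmoothAt α y) (hβ : SmoothAt β y) : ∑ i, fderiv ℝ (fluxS g J s α β i) y (stdVec i) =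
      (volDensity g y : ℂ) *
        (inn (g y) (delS J s α y) (β y) - inn (g y) (α y) (delStarS g J s β y)) := by
  have hm := h.metric.self_of_nhds
  have hJJ := h.J_J.self_of_nhds
  have hsk := h.skew.self_of_nhds
  have e1 : ∀ i, fderiv ℝ (fluxS g J s α β i) y (stdVec i) =
      ∑ w ∈ Finset.Icc (-(m + 1) : ℤ) (m + 1), fderiv ℝ (flux g (fun z => weight (J z) w (α z))
        (fun z => weight (J z) (w + s) (β z)) i) y (stdVec i) := by
    intro i
    have : fluxS g J s α β i = fun z => ∑ w ∈ Finset.Icc (-(m + 1) : ℤ) (m + 1),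
      flux g (fun z => weight (J z) w (α z)) (fun z => weight (J z) (w + s) (β z)) i z := rfl
    rw [this, fderiv_fun_sum fun w _ => (h.contDiffAt_flux (hα.weight h.smooth_J w)
      (hβ.weight h.smooth_J (w + s)) i).differentiableAt (by simp), _root_.sum_apply]
  simp only [e1]
  rw [Finset.sum_comm]
  simp only [h.divergence (hα.weight h.smooth_J _) (hβ.weight h.smooth_J _)]
  rw [← Finset.mul_sum, Finset.sum_sub_distrib, delS, delStarS, _root_.map_sum, _root_.map_sum,
    LinearMap.sum_apply]
  simp only [inn_weight hm hJJ hsk]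

/-- The flux whose divergence is the defect of adjointness of `delS J (-s)` and
`√-1 s [delS J s, Λ]`. -/
def adjFlux (g : Euc m → Euc m →L[ℝ] Euc m →L[ℝ] ℝ) (J : Euc m → Euc m →L[ℝ] Euc m) (s : ℤ)
    (α β : Euc m → GForm m) (i : Fin m) (z : Euc m) : ℂ :=
  (-Complex.I * s) * (conj (fluxS g J s β (wedgeOmega g J α) i z) -
    conj (fluxS g J s (fun z => lam (g z) (J z) (β z)) α i z))

theorem HermAt.contDiffAt_adjFlux (h : HermAt g J y) (s : ℤ) {α β : Euc m → GForm m}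
    (hα : SmoothAt α y) (hβ : SmoothAt β y) (i : Fin m) :
    ContDiffAt ℝ ∞ (adjFlux g J s α β i) y := by
  have hc : ∀ {f : Euc m → ℂ}, ContDiffAt ℝ ∞ f y → ContDiffAt ℝ ∞ (fun z => conj (f z)) y :=
    fun hf => Complex.conjCLE.contDiff.contDiffAt.comp y hf
  exact contDiffAt_const.mul ((hc (h.contDiffAt_fluxS s hβ (SmoothAt.wedgeOmega h hα) i)).sub
    (hc (h.contDiffAt_fluxS s (SmoothAt.lam h.smooth_g h.metric.self_of_nhds h.smooth_J hβ) hα i)))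

/-- As s² = 1, the Kähler identity expresses `delS J (-s) α` as -√-1 s times the commutator of L
with `delStarS`. Moving L across the product costs nothing, while moving `delStarS` costs a
divergence, once for the pair (β, ω ∧ α) and once for (Λβ, α). The conjugations arise because `delS`
then acts on the second argument of the product. -/
theorem HermAt.divergence_adjFlux (h : HermAt g J y)
    (ht : ∀ v X, covEnd g J y (J y v) X = covEnd g J y v (J y X)) {s : ℤ} (hs : |s| = 1)
    {α β : Euc m → GForm m} (hα : SmoothAt α y) (hβ : SmoothAt β y) :
    ∑ i, fderiv ℝ (adjFlux g J s α β i) y (stdVec i) =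
      (volDensity g y : ℂ) * (inn (g y) (delS J (-s) α y) (β y) - inn (g y) (α y)
        ((Complex.I * s) • (delS J s (fun z => lam (g z) (J z) (β z)) y -
          lam (g y) (J y) (delS J s β y)))) := by
  have hm := h.metric.self_of_nhds
  have hβl : SmoothAt (fun z => lam (g z) (J z) (β z)) y :=
    SmoothAt.lam h.smooth_g hm h.smooth_J hβ
  have hαl := SmoothAt.wedgeOmega h hα
  have d : ∀ {a b : Euc m → GForm m} (ha : SmoothAt a y) (hb : SmoothAt b y) (i : Fin m),
      DifferentiableAt ℝ (fluxS g J s a b i) y := fun ha hb i =>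
    (h.contDiffAt_fluxS s ha hb i).differentiableAt (by simp)
  have e1 : ∀ i, fderiv ℝ (adjFlux g J s α β i) y (stdVec i) = (-Complex.I * s) *
      (conj (fderiv ℝ (fluxS g J s β (wedgeOmega g J α) i) y (stdVec i)) -
        conj (fderiv ℝ (fluxS g J s (fun z => lam (g z) (J z) (β z)) α i) y (stdVec i))) := by
    intro i
    have hc : ∀ {f : Euc m → ℂ} (hf : DifferentiableAt ℝ f y),
        HasFDerivAt (fun z => conj (f z))
          (Complex.conjCLE.toContinuousLinearMap.comp (fderiv ℝ f y)) y := fun hf =>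
      Complex.conjCLE.toContinuousLinearMap.hasFDerivAt.comp y hf.hasFDerivAt
    have := ((hc (d hβ hαl i)).sub (hc (d hβl hα i))).const_mul (-Complex.I * s)
    exact congrArg (fun A : Euc m →L[ℝ] ℂ => A (stdVec i)) this.fderiv
  simp only [e1]
  rw [← Finset.mul_sum, Finset.sum_sub_distrib, ← _root_.map_sum, ← _root_.map_sum,
    h.divergence_fluxS s hβ hαl, h.divergence_fluxS s hβl hα]
  have e2 := congrArg (fun γ => inn (g y) γ (β y)) (h.wedgeOmega_delStarS ht hs.le hα)
  simp only [_root_.map_sub, LinearMap.sub_apply, _root_.map_smul, LinearMap.smul_apply,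
    inn_wedgeTwo hm, smul_eq_mul] at e2
  simp only [_root_.map_mul, _root_.map_sub, Complex.conj_ofReal, inn_conj hm, wedgeOmega,
    inn_wedgeTwo hm, LinearMap.map_smulₛₗ, smul_eq_mul, Complex.conj_I, map_intCast]
  have hs2 : (s : ℂ) * s = 1 := by
    have h1 := sq_abs s
    rw [hs] at h1
    have : s * s = 1 := by linarith
    exact_mod_cast this
  linear_combination (volDensity g y : ℂ) * (-Complex.I * s) * e2 +
    (volDensity g y : ℂ) * (-(s : ℂ) * s * Complex.I_sq + hs2) * inn (g y) (delS J (-s) α y) (β y)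

end GForm

namespace GForm

variable {m : ℕ} {g : Euc m → Euc m →L[ℝ] Euc m →L[ℝ] ℝ} {J : Euc m → Euc m →L[ℝ] Euc m}
  {y : Euc m}

/-! ### The condition on the torsion -/

theorem rsmul_zero (c : ℝ) : c • (0 : GForm m) = 0 := by
  funext k
  ext u
  exact smul_zero c

/-- The function `1` as a form. -/
def one : GForm m
  | 0 => ContinuousAlternatingMap.constOfIsEmpty ℝ (Euc m) (Fin 0) (1 : ℂ)
  | _ + 1 => 0

theorem contr_one (v : Euc m) : contr v (one : GForm m) = 0 := by
  funext k
  ext u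
  rw [contr_apply_apply]
  rfl

theorem der_one (K : Euc m →ₗ[ℝ] Euc m) : der K (one : GForm m) = 0 := by
  simp only [der_def, contr_one]
  exact alt_zero_fun

theorem nab_one (v : Euc m) : nab g (fun _ => (one : GForm m)) y v = 0 := by
  rw [nab, der_one, sub_zero]
  funext k
  simp [pd]

theorem der_wedgeOmega_one (hJ : ∀ v w, g y (J y v) w = -g y v (J y w)) :
    der (J y) (wedgeOmega g J (fun _ => one) y) = 0 := by
  rw [wedgeOmega, der_wedgeTwo, der_one, _root_.map_zero, add_zero]
  have : (kahlerForm (g y) (J y)).compl₁₂ (J y : Euc m →ₗ[ℝ] Euc m) .id +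
      (kahlerForm (g y) (J y)).compl₁₂ .id (J y : Euc m →ₗ[ℝ] Euc m) =
        (0 : ℝ) • kahlerForm (g y) (J y) := by
    ext a b
    simp [kahlerForm_apply, hJ]
  rw [this, wedgeTwo_smul, rzero_smul]

theorem weight_of_der_eq_zero {J : Euc m →L[ℝ] Euc m} (hJJ : ∀ v, J (J v) = -v) {α : GForm m}
    (h : der J α = 0) (w : ℤ) : weight J w α = if w = 0 then α else 0 := by
  have h1 : ∀ w ≠ 0, weight J w α = 0 := by
    intro w hw
    have h2 := weight_der hJJ w α
    rw [h, _root_.map_zero] at h2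
    exact eq_zero_of_smul_eq_zero (mul_ne_zero Complex.I_ne_zero (Int.cast_ne_zero.mpr hw)) h2.symm
  split_ifs with hw
  · subst hw
    conv_rhs => rw [← sum_weight J m le_rfl α]
    rw [Finset.sum_eq_single 0 (fun w _ hw => h1 w hw) (by simp)]
  · exact h1 w hw

/-- Since ω has weight 0, a single summand of `delS` survives. -/
theorem delS_wedgeOmega_one (h : HermAt g J y) (s : ℤ) :
    delS J s (wedgeOmega g J fun _ => one) y =
      weight (J y) s (dd (wedgeOmega g J fun _ => one) y) := by
  rw [delS, Finset.sum_eq_single 0, zero_add]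
  · congr 1
    refine dd_congr ?_
    filter_upwards [h.J_J, h.skew] with z h1 h2
    rw [weight_of_der_eq_zero h1 (der_wedgeOmega_one h2), if_pos rfl]
  · intro w _ hw
    rw [dd_congr (β := fun _ => 0), dd_zero, _root_.map_zero]
    filter_upwards [h.J_J, h.skew] with z h1 h2
    rw [weight_of_der_eq_zero h1 (der_wedgeOmega_one h2), if_neg hw]
  · simp
    omega

/-- A three-form has weights ±1 and ±3 only, and (±3 √-1)² = -9. -/
theorem der_der_degree_three {J : Euc m →L[ℝ] Euc m} (hJJ : ∀ v, J (J v) = -v) {Ψ : GForm m}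
    (h1 : weight J 1 Ψ 3 = 0) (h2 : weight J (-1) Ψ 3 = 0) :
    der J (der J Ψ) 3 = (-9 : ℂ) • Ψ 3 := by
  have e1 : der J (der J Ψ) + (9 : ℂ) • Ψ =
      ∑ w ∈ Finset.Icc (-m : ℤ) m, (9 - (w : ℂ) ^ 2) • weight J w Ψ := by
    conv_lhs => rw [← sum_weight J m le_rfl Ψ]
    rw [_root_.map_sum, _root_.map_sum, Finset.smul_sum, ← Finset.sum_add_distrib]
    refine Finset.sum_congr rfl fun w _ => ?_
    rw [der_weight hJJ, _root_.map_smul, der_weight hJJ, ← cmul_smul, ← cadd_smul]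
    congr 1
    linear_combination (w : ℂ) ^ 2 * Complex.I_sq
  have e2 : (der J (der J Ψ) + (9 : ℂ) • Ψ) 3 = 0 := by
    rw [e1, Finset.sum_apply]
    refine Finset.sum_eq_zero fun w _ => ?_
    change (9 - (w : ℂ) ^ 2) • weight J w Ψ 3 = 0
    by_cases hw : w = 1 ∨ w = -1
    · have : weight J w Ψ 3 = 0 := by rcases hw with rfl | rfl <;> assumption
      rw [this]
      ext u
      exact mul_zero _
    · by_cases hw3 : w = 3 ∨ w = -3
      · have : (9 - (w : ℂ) ^ 2) = 0 := by rcases hw3 with rfl | rfl <;> norm_num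
        rw [this]
        ext u
        exact zero_mul _
      · have : weight J w Ψ 3 = 0 := by
          rw [weight_apply]
          refine Finset.sum_eq_zero fun p hp => if_neg ?_
          have := Finset.mem_range.mp hp
          push_cast
          omega
        rw [this]
        ext u
        exact mul_zero _
  have e3 : der J (der J Ψ) 3 + (9 : ℂ) • Ψ 3 = 0 := e2
  rw [eq_neg_of_add_eq_zero_left e3]
  exact (neg_smul (9 : ℂ) (Ψ 3)).symm

/-- By torsion-freeness dω is the alternation of ∇ω; each contraction either consumes the alternated
covector or a slot of ∇ω. -/
theorem contr_contr_contr_dd_omega (h : HermAt g J y) (X Y Z : Euc m) :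
    contr Z (contr Y (contr X (dd (wedgeOmega g J fun _ => one) y))) =
      (g y (covEnd g J y X Y) Z + g y (covEnd g J y Y Z) X + g y (covEnd g J y Z X) Y) •
        (one : GForm m) := by
  set F : Euc m → GForm m := fun w => wedgeTwo (endForm (g y) (covEnd g J y w)) one with hF
  have hFl : IsLinearMap ℝ F := isLinear_wedge_endForm _ _
  have e1 : dd (wedgeOmega g J fun _ => one) y = alt F := by
    rw [dd_eq_alt_nab h]
    refine alt_congr fun i => ?_
    rw [nab_wedgeOmega h (SmoothAt.const one), nab_one, _root_.map_zero, zero_add]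
  have e2 : ∀ w X Y, contr Y (contr X (F w)) = g y (covEnd g J y w X) Y • (one : GForm m) := by
    intro w X Y
    rw [contr_wedgeTwo _ (fun a b => h.covEnd_skew w a b), contr_one, _root_.map_zero, add_zero,
      contr_alt (isLinear_smul (endForm (g y) (covEnd g J y w) X) one)]
    simp only [map_real_smul, contr_one]
    have : (alt fun u => endForm (g y) (covEnd g J y w) X u • (0 : GForm m)) = 0 :=
      (alt_congr fun i => rsmul_zero _).trans alt_zero_fun
    rw [this, sub_zero, endForm_apply]
  have e3 : ∀ w X Y Z, contr Z (contr Y (contr X (F w))) = 0 := by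
    intro w X Y Z
    rw [e2, map_real_smul, contr_one, rsmul_zero]
  rw [e1, contr_alt hFl, _root_.map_sub, contr_alt (isLinear_contr_comp X hFl), _root_.map_sub,
    _root_.map_sub, contr_alt (isLinear_contr_comp Y (isLinear_contr_comp X hFl))]
  simp only [e3]
  rw [alt_zero_fun]
  simp only [e2]
  rw [h.covEnd_skew Y X Z]
  module

/-- The type condition on the differential of the Hermitian form gives the symmetry of the
covariant derivative of the almost complex structure which is needed for the Kähler identities. -/
theorem HermAt.covEnd_comp (h : HermAt g J y) (h1 : delS J 1 (wedgeOmega g J fun _ => one) y 3 = 0)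
    (h2 : delS J (-1) (wedgeOmega g J fun _ => one) y 3 = 0) (v X : Euc m) :
    covEnd g J y (J y v) X = covEnd g J y v (J y X) := by
  have hm := h.metric.self_of_nhds
  have hJJ := h.J_J.self_of_nhds
  have hsk := h.skew.self_of_nhds
  rw [delS_wedgeOmega_one h] at h1 h2
  have h3 := der_der_degree_three hJJ h1 h2
  set Ψ := dd (wedgeOmega g J fun _ => one) y with hΨ
  set ψ : Euc m → Euc m → Euc m → ℝ := fun X Y Z =>
    g y (covEnd g J y X Y) Z + g y (covEnd g J y Y Z) X + g y (covEnd g J y Z X) Y with hψ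
  have t0 : ∀ (Φ : GForm m) (X Y Z : Euc m), contr Z (contr Y (contr X Φ)) 0 ![] =
      Φ 3 (Fin.cons X (Fin.cons Y (Fin.cons Z ![]))) := fun Φ X Y Z => rfl
  have t1 : ∀ X Y Z, contr Z (contr Y (contr X Ψ)) 0 ![] = ψ X Y Z := by
    intro X Y Z
    rw [hΨ, contr_contr_contr_dd_omega h]
    change (ψ X Y Z : ℝ) • (1 : ℂ) = _
    simp
  have t2 : ∀ (Φ : GForm m) (X Y Z : Euc m), contr Z (contr Y (contr X (der (J y) Φ))) 0 ![] =
      contr Z (contr Y (contr (J y X) Φ)) 0 ![] + contr Z (contr (J y Y) (contr X Φ)) 0 ![] +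
        contr (J y Z) (contr Y (contr X Φ)) 0 ![] := by
    intro Φ X Y Z
    simp only [contr_der, _root_.map_add, Pi.add_apply, ContinuousAlternatingMap.add_apply,
      der_zero_apply, add_zero, ContinuousLinearMap.coe_coe]
    ring
  -- In the square of `der J`, both J fall into the same slot in three ways, each giving -ψ, and
  -- each pair of distinct slots occurs twice. Equating the total with -9 ψ gives the relation.
  have t3 : ∀ X Y Z, ψ (J y X) (J y Y) Z + ψ (J y X) Y (J y Z) + ψ X (J y Y) (J y Z) =
      -3 * ψ X Y Z := by
    intro X Y Z
    have a1 : contr Z (contr Y (contr X (der (J y) (der (J y) Ψ)))) 0 ![] =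
        (-9 : ℂ) * contr Z (contr Y (contr X Ψ)) 0 ![] := by
      rw [t0, h3, t0]
      rfl
    have hn : ∀ X Y Z, ψ (-X) Y Z = -ψ X Y Z ∧ ψ X (-Y) Z = -ψ X Y Z ∧ ψ X Y (-Z) = -ψ X Y Z := by
      intro X Y Z
      simp only [hψ, _root_.map_neg, LinearMap.neg_apply, _root_.neg_apply]
      refine ⟨?_, ?_, ?_⟩ <;> ring
    simp only [t2, t1, hJJ, (hn _ _ _).1, (hn _ _ _).2.1, (hn _ _ _).2.2] at a1
    have a2 : (-ψ X Y Z + ψ (J y X) (J y Y) Z + ψ (J y X) Y (J y Z) +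
        (ψ (J y X) (J y Y) Z + -ψ X Y Z + ψ X (J y Y) (J y Z)) +
        (ψ (J y X) Y (J y Z) + ψ X (J y Y) (J y Z) + -ψ X Y Z) : ℝ) = -9 * ψ X Y Z := by
      apply Complex.ofReal_injective
      push_cast
      push_cast at a1
      exact a1
    linarith
  refine cov_J_of_type hm hJJ hsk h.covEnd_J h.covEnd_skew (fun X Y Z => ?_) v X
  have hn : ∀ X Y Z, ψ (-X) Y Z = -ψ X Y Z ∧ ψ X (-Y) Z = -ψ X Y Z ∧ ψ X Y (-Z) = -ψ X Y Z := by
    intro X Y Z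
    simp only [hψ, _root_.map_neg, LinearMap.neg_apply, _root_.neg_apply]
    refine ⟨?_, ?_, ?_⟩ <;> ring
  -- The relation at (X, Y, Z) and the one at (JX, JY, Z) share two terms with opposite signs;
  -- adding them gives 4 ψ(X, Y, Z) = -4 ψ(JX, JY, Z).
  have b1 := t3 X Y Z
  have b2 := t3 (J y X) (J y Y) Z
  simp only [hJJ, (hn _ _ _).1, (hn _ _ _).2.1] at b2
  change ψ (J y X) (J y Y) Z = -ψ X Y Z
  linarith

end GForm

namespace GForm

variable {m : ℕ} {T : Euc m →L[ℝ] Euc m}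

/-! ### Pull-back under a linear map -/

/-- The pull-back of forms under a linear map. -/
def pull (T : Euc m →L[ℝ] Euc m) : GForm m →ₗ[ℂ] GForm m where
  toFun α k := (α k).compContinuousLinearMap T
  map_add' _ _ := rfl
  map_smul' _ _ := rfl

theorem pull_apply (α : GForm m) (k : ℕ) : pull T α k = (α k).compContinuousLinearMap T := rfl

theorem pull_apply_apply (α : GForm m) (k : ℕ) (u : Fin k → Euc m) :
    pull T α k u = α k fun i => T (u i) := rfl

theorem contr_pull (v : Euc m) (α : GForm m) : contr v (pull T α) = pull T (contr (T v) α) := by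
  funext k
  ext u
  rw [contr_apply_apply, pull_apply_apply, pull_apply_apply, contr_apply_apply]
  congr 1
  funext i
  refine Fin.cases rfl (fun i => rfl) i

theorem typePart_pull {J J' : Euc m →L[ℝ] Euc m} (hT : ∀ v, T (J' v) = J (T v)) {k : ℕ} (p : ℕ)
    (a : Euc m [⋀^Fin k]→L[ℝ] ℂ) : typePart J' p (a.compContinuousLinearMap T) =
      (typePart J p a).compContinuousLinearMap T := by
  ext u
  rw [ContinuousAlternatingMap.compContinuousLinearMap_apply, typePart_apply, typePart_apply]
  refine Finset.sum_congr rfl fun S _ => ?_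
  split_ifs
  · refine Finset.sum_congr rfl fun R _ => congrArg (Complex.I ^ R.card * ·) ?_
    rw [ContinuousAlternatingMap.compContinuousLinearMap_apply]
    refine congrArg a (funext fun i => ?_)
    simp only [Function.comp_apply]
    split_ifs <;> simp [hT]
  · rfl

theorem alt_pull {F : Euc m → GForm m} (hF : IsLinearMap ℝ F) :
    pull T (alt F) = alt fun w => pull T (F (T w)) := by
  have h : IsLinearMap ℝ fun w => pull T (F (T w)) :=
    ⟨fun v w => by rw [_root_.map_add, hF.map_add, _root_.map_add],
      fun c v => by rw [_root_.map_smul, hF.map_smul, map_real_smul]⟩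
  funext k
  cases k with
  | zero => rfl
  | succ k =>
    ext u
    rw [pull_apply_apply, alt_apply hF, alt_apply h]
    rfl

theorem wedgeTwo_pull (A : Euc m →ₗ[ℝ] Euc m →ₗ[ℝ] ℝ) (α : GForm m) :
    pull T (wedgeTwo A α) = wedgeTwo (A.compl₁₂ T.toLinearMap T.toLinearMap) (pull T α) := by
  rw [wedgeTwo_def, wedgeTwo_def, _root_.map_smul, alt_pull (isLinear_alt_smul A α)]
  congr 2
  funext v
  rw [alt_pull (isLinear_smul (A (T v)) α)]
  congr 1

variable {g g' : Euc m →L[ℝ] Euc m →L[ℝ] ℝ}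

theorem tr_comm_tr {X : Type*} [AddCommGroup X] [Module ℝ X]
    (B : Euc m → Euc m → Euc m → Euc m → X) : tr g' (fun u v => tr g fun a b => B u v a b) =
      tr g (fun a b => tr g' fun u v => B u v a b) := by
  have h : ∀ (g : Euc m →L[ℝ] Euc m →L[ℝ] ℝ) (C : Euc m → Euc m → X),
      tr g C = ∑ p : Fin m × Fin m,
        (gramMatrix g (stdVec (m := m)))⁻¹ p.1 p.2 • C (stdVec p.1) (stdVec p.2) := fun g C => by
    rw [tr, Fintype.sum_prod_type]
  simp only [h, Finset.smul_sum]
  rw [Finset.sum_comm]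
  exact Finset.sum_congr rfl fun p _ => Finset.sum_congr rfl fun q _ => smul_comm _ _ _

/-- The reproducing property for g inserts a second trace; after the exchange, the reproducing
property for g' removes the first one. The two Gram matrices need not be compared. -/
theorem tr_pull {X : Type*} [AddCommGroup X] [Module ℝ X] (hg : IsMetric g) (hg' : IsMetric g')
    (hT : Function.Surjective T) (h : ∀ v w, g' v w = g (T v) (T w)) {B : Euc m → Euc m → X}
    (h1 : ∀ v, IsLinearMap ℝ fun u => B u v) (h2 : ∀ u, IsLinearMap ℝ fun v => B u v) :
    tr g' (fun u v => B (T u) (T v)) = tr g B := by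
  have e1 : ∀ a b, B a b = tr g fun c d => g a c • B d b := fun a b =>
    (tr_contract hg (h1 b) a).symm
  have e2 : tr g' (fun u v => B (T u) (T v)) =
      tr g' fun u v => tr g fun c d => g (T u) c • B d (T v) :=
    tr_congr fun i j => e1 _ _
  rw [e2, tr_comm_tr, ← tr_swap hg B]
  refine tr_congr fun i j => ?_
  obtain ⟨c, hc⟩ := hT (stdVec i)
  have e3 : ∀ u, g (T u) (stdVec i) = g' c u := fun u => by rw [← hc, h, hg.symm]
  simp only [e3]
  have h3 : IsLinearMap ℝ fun v => B (stdVec j) (T v) :=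
    ⟨fun v w => by rw [_root_.map_add, (h2 _).map_add],
      fun r v => by rw [_root_.map_smul, (h2 _).map_smul]⟩
  rw [tr_contract hg' h3 c, hc]

theorem lam_pull (hg : IsMetric g) (hg' : IsMetric g') (hT : Function.Surjective T)
    (h : ∀ v w, g' v w = g (T v) (T w)) {J J' : Euc m →L[ℝ] Euc m}
    (hJ : ∀ v, T (J' v) = J (T v)) (α : GForm m) :
    pull T (lam g J α) = lam g' J' (pull T α) := by
  rw [lam_def, lam_def, _root_.map_smul, map_tr_complex]
  simp only [contr_pull, hJ]
  rw [tr_pull hg hg' hT h (B := fun u v => pull T (contr (J u) (contr v α)))]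
  · intro v
    exact ⟨fun a b => by
        rw [_root_.map_add, (isLinear_contr (contr v α)).map_add, _root_.map_add],
      fun c a => by
        rw [_root_.map_smul, (isLinear_contr (contr v α)).map_smul, map_real_smul]⟩
  · intro u
    exact ⟨fun a b => by rw [(isLinear_contr α).map_add, _root_.map_add, _root_.map_add],
      fun c a => by rw [(isLinear_contr α).map_smul, map_real_smul, map_real_smul]⟩

/-- A two-form as a wedge with the constant function. -/
theorem wedgeTwo_one_two (A : Euc m →ₗ[ℝ] Euc m →ₗ[ℝ] ℝ) (hA : ∀ v w, A v w = -A w v)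
    (u : Fin 2 → Euc m) : wedgeTwo A (one : GForm m) 2 u = A (u 0) (u 1) := by
  have h : contr (u 1) (contr (u 0) (wedgeTwo A one)) = A (u 0) (u 1) • (one : GForm m) := by
    rw [contr_wedgeTwo A hA, contr_one, _root_.map_zero, add_zero,
      contr_alt (isLinear_smul (A (u 0)) one)]
    simp only [map_real_smul, contr_one, rsmul_zero]
    rw [alt_zero_fun, sub_zero]
  have h2 := congrArg (fun α : GForm m => α 0 ![]) h
  have h3 : wedgeTwo A (one : GForm m) 2 u =
      contr (u 1) (contr (u 0) (wedgeTwo A one)) 0 ![] := by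
    rw [contr_apply_apply, contr_apply_apply]
    congr 1
    funext i
    fin_cases i <;> rfl
  rw [h3]
  refine h2.trans ?_
  change (A (u 0) (u 1) : ℝ) • (1 : ℂ) = _
  simp

theorem wedgeTwo_one_of_ne (A : Euc m →ₗ[ℝ] Euc m →ₗ[ℝ] ℝ) {k : ℕ} (hk : k ≠ 2) :
    wedgeTwo A (one : GForm m) k = 0 := by
  have h : ∀ (F : Euc m → GForm m) (k : ℕ), (∀ i, F (stdVec i) k = 0) → alt F (k + 1) = 0 := by
    intro F k hF
    rw [alt_eq_clm]
    exact Finset.sum_eq_zero fun i _ => by rw [hF, _root_.map_zero]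
  rw [wedgeTwo_def]
  have h1 : alt (fun v => alt fun w => A v w • (one : GForm m)) k = 0 := by
    match k, hk with
    | 0, _ => rfl
    | 1, _ => exact h _ 0 fun i => rfl
    | k + 3, _ =>
      refine h _ (k + 2) fun i => h _ (k + 1) fun j => ?_
      ext u
      exact smul_zero _
  rw [Pi.smul_apply, h1]
  ext u
  exact mul_zero _

end GForm

namespace GForm

section Manifold

variable {m : ℕ} {M : Type*} [TopologicalSpace M] [ChartedSpace (EuclideanSpace ℝ (Fin m)) M]
  {e : OpenPartialHomeomorph M (EuclideanSpace ℝ (Fin m))} {y : Euc m}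

/-! ### Forms in charts -/

/-- The value of a form at a point. -/
def val (α : TotalForm m M) (x : M) : GForm m := fun k => α k x

/-- The derivative of the inverse of a chart. -/
def dInv (e : OpenPartialHomeomorph M (EuclideanSpace ℝ (Fin m))) (y : Euc m) : Euc m →L[ℝ] Euc m :=
  mfderiv (𝓡 m) (𝓡 m) e.symm y

/-- The derivative of a chart. -/
def dChart (e : OpenPartialHomeomorph M (EuclideanSpace ℝ (Fin m))) (x : M) : Euc m →L[ℝ] Euc m :=
  mfderiv (𝓡 m) (𝓡 m) e x

/-- A form in a chart. -/
def loc (e : OpenPartialHomeomorph M (EuclideanSpace ℝ (Fin m))) (α : TotalForm m M)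
    (y : Euc m) : GForm m := fun k => (α k).inChart e y

theorem loc_eq_pull (α : TotalForm m M) (y : Euc m) :
    loc e α y = pull (dInv e y) (val α (e.symm y)) := rfl

theorem isSmooth_iff (α : TotalForm m M) : α.IsSmooth ↔
    ∀ e ∈ IsManifold.maximalAtlas (𝓡 m) ∞ M, ∀ y ∈ e.target, SmoothAt (loc e α) y := by
  constructor
  · intro h e he y hy k
    exact (h k e he).contDiffAt (e.open_target.mem_nhds hy)
  · intro h k e he y hy
    exact (h e he y hy k).contDiffWithinAt

theorem isSmooth_of_loc {β : TotalForm m M}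
    (F : OpenPartialHomeomorph M (EuclideanSpace ℝ (Fin m)) → Euc m → GForm m)
    (h : ∀ e ∈ IsManifold.maximalAtlas (𝓡 m) ∞ M, ∀ y ∈ e.target,
      loc e β y = F e y ∧ SmoothAt (F e) y) : β.IsSmooth :=
  (isSmooth_iff β).mpr fun e he y hy => (h e he y hy).2.congr (by
    filter_upwards [e.open_target.mem_nhds hy] with z hz
    exact (h e he z hz).1)

theorem mdifferentiable_of_mem (he : e ∈ IsManifold.maximalAtlas (𝓡 m) ∞ M) :
    e.MDifferentiable (𝓡 m) (𝓡 m) :=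
  ⟨(contMDiffOn_of_mem_maximalAtlas he).mdifferentiableOn (by simp),
    (contMDiffOn_symm_of_mem_maximalAtlas he).mdifferentiableOn (by simp)⟩

theorem dChart_dInv (he : e ∈ IsManifold.maximalAtlas (𝓡 m) ∞ M) (hy : y ∈ e.target) (v : Euc m) :
    dChart e (e.symm y) (dInv e y v) = v := by
  have h := (mdifferentiable_of_mem he).comp_symm_deriv hy
  exact congrArg (fun A : Euc m →L[ℝ] Euc m => A v) h

theorem dInv_dChart (he : e ∈ IsManifold.maximalAtlas (𝓡 m) ∞ M) (hy : y ∈ e.target) (v : Euc m) :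
    dInv e y (dChart e (e.symm y) v) = v := by
  have h := (mdifferentiable_of_mem he).symm_comp_deriv (e.map_target hy)
  have h2 : dInv e (e (e.symm y)) (dChart e (e.symm y) v) = v :=
    congrArg (fun A : Euc m →L[ℝ] Euc m => A v) h
  rwa [e.right_inv hy] at h2

variable [IsManifold (𝓡 m) ∞ M]

/-! ### The structure in charts -/

/-- The metric at a point. -/
def gAt (H : AlmostHermitianStructure m M) (x : M) : Euc m →L[ℝ] Euc m →L[ℝ] ℝ := H.g.inner x

/-- The almost complex structure at a point. -/
def JAt (H : AlmostHermitianStructure m M) (x : M) : Euc m →L[ℝ] Euc m := H.J x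

theorem isMetric_gAt (H : AlmostHermitianStructure m M) (x : M) : IsMetric (gAt H x) :=
  ⟨H.g.symm x, H.g.pos x⟩

theorem JAt_JAt (H : AlmostHermitianStructure m M) (x : M) (v : Euc m) :
    JAt H x (JAt H x v) = -v := H.J_J x v

theorem gAt_skew (H : AlmostHermitianStructure m M) (x : M) (v w : Euc m) :
    gAt H x (JAt H x v) w = -gAt H x v (JAt H x w) := by
  have h : gAt H x (JAt H x v) (JAt H x (JAt H x w)) = gAt H x v (JAt H x w) :=
    H.g_J_J x v (JAt H x w)
  rw [JAt_JAt, _root_.map_neg] at h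
  linarith

/-- The metric in a chart. -/
def gLoc (H : AlmostHermitianStructure m M)
    (e : OpenPartialHomeomorph M (EuclideanSpace ℝ (Fin m))) (y : Euc m) :
    Euc m →L[ℝ] Euc m →L[ℝ] ℝ :=
  (gAt H (e.symm y)).bilinearComp (dInv e y) (dInv e y)

/-- The almost complex structure in a chart. -/
def JLoc (H : AlmostHermitianStructure m M)
    (e : OpenPartialHomeomorph M (EuclideanSpace ℝ (Fin m))) (y : Euc m) : Euc m →L[ℝ] Euc m :=
  (dChart e (e.symm y)).comp ((JAt H (e.symm y)).comp (dInv e y))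

theorem gLoc_apply (H : AlmostHermitianStructure m M) (v w : Euc m) :
    gLoc H e y v w = gAt H (e.symm y) (dInv e y v) (dInv e y w) := rfl

theorem dInv_JLoc (H : AlmostHermitianStructure m M)
    (he : e ∈ IsManifold.maximalAtlas (𝓡 m) ∞ M) (hy : y ∈ e.target) (v : Euc m) :
    dInv e y (JLoc H e y v) = JAt H (e.symm y) (dInv e y v) := dInv_dChart he hy _

theorem isMetric_gLoc (H : AlmostHermitianStructure m M)
    (he : e ∈ IsManifold.maximalAtlas (𝓡 m) ∞ M) (hy : y ∈ e.target) : IsMetric (gLoc H e y) where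
  symm v w := (isMetric_gAt H (e.symm y)).symm (dInv e y v) (dInv e y w)
  pos v hv := by
    refine (isMetric_gAt H (e.symm y)).pos (dInv e y v) fun h0 => hv ?_
    rw [← dChart_dInv he hy v, h0]
    exact (dChart e (e.symm y)).map_zero

/-- The tangent map of the inverse chart is smooth; it is applied to a constant vector field. -/
theorem contMDiffAt_dInv (he : e ∈ IsManifold.maximalAtlas (𝓡 m) ∞ M) (hy : y ∈ e.target)
    (v : Euc m) : ContMDiffAt (𝓡 m) ((𝓡 m).prod (𝓡 m)) ∞ (fun z : Euc m =>
      (Bundle.TotalSpace.mk' (Euc m) (E := fun x : M => TangentSpace (𝓡 m) x) (e.symm z)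
        (dInv e z v))) y := by
  have h1 := (contMDiffOn_symm_of_mem_maximalAtlas he).contMDiffOn_tangentMapWithin
    (m := ∞) (by simp) e.open_target.uniqueMDiffOn
  have h2 : ContMDiffAt (𝓡 m) ((𝓡 m).prod (𝓡 m)) ∞ (fun z : Euc m =>
      (Bundle.TotalSpace.mk' (Euc m) (E := fun x : Euc m => TangentSpace (𝓡 m) x) z v)) y :=
    contMDiffAt_vectorSpace_iff_contDiffAt.mpr contDiffAt_const
  have h3 := (h1.contMDiffAt (x := Bundle.TotalSpace.mk' (Euc m)
    (E := fun x : Euc m => TangentSpace (𝓡 m) x) y v)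
    ((e.open_target.preimage (FiberBundle.continuous_proj _ _)).mem_nhds hy)).comp y h2
  refine h3.congr_of_eventuallyEq ?_
  filter_upwards [e.open_target.mem_nhds hy] with z hz
  simp only [Function.comp_apply, tangentMapWithin, Bundle.TotalSpace.mk']
  rw [mfderivWithin_of_isOpen e.open_target hz]
  rfl

theorem contDiffAt_gAt (H : AlmostHermitianStructure m M) {x : Euc m → M}
    {v w : Euc m → Euc m}
    (hx : ContMDiffAt (𝓡 m) (𝓡 m) ∞ x y)
    (hv : ContMDiffAt (𝓡 m) ((𝓡 m).prod (𝓡 m)) ∞ (fun z : Euc m =>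
      (Bundle.TotalSpace.mk' (Euc m) (E := fun x : M => TangentSpace (𝓡 m) x) (x z) (v z))) y)
    (hw : ContMDiffAt (𝓡 m) ((𝓡 m).prod (𝓡 m)) ∞ (fun z : Euc m =>
      (Bundle.TotalSpace.mk' (Euc m) (E := fun x : M => TangentSpace (𝓡 m) x) (x z) (w z))) y) :
    ContDiffAt ℝ ∞ (fun z => gAt H (x z) (v z) (w z)) y := by
  have : ContMDiffAt (𝓡 m) ((𝓡 m).prod 𝓘(ℝ)) ∞ (fun z => Bundle.TotalSpace.mk' ℝ
      (E := Bundle.Trivial M ℝ) (x z) (H.g.inner (x z) (v z) (w z))) y := by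
    apply ContMDiffAt.clm_bundle_apply₂ (F₁ := Euc m) (F₂ := Euc m)
    · exact H.g.contMDiff.contMDiffAt.comp y hx
    · exact hv
    · exact hw
  simp only [Bundle.contMDiffAt_totalSpace] at this
  exact this.2.contDiffAt

theorem contMDiffAt_JAt (H : AlmostHermitianStructure m M) {x : Euc m → M} {v : Euc m → Euc m}
    (hx : ContMDiffAt (𝓡 m) (𝓡 m) ∞ x y)
    (hv : ContMDiffAt (𝓡 m) ((𝓡 m).prod (𝓡 m)) ∞ (fun z : Euc m =>
      (Bundle.TotalSpace.mk' (Euc m) (E := fun x : M => TangentSpace (𝓡 m) x) (x z) (v z))) y) :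
    ContMDiffAt (𝓡 m) ((𝓡 m).prod (𝓡 m)) ∞ (fun z : Euc m =>
      (Bundle.TotalSpace.mk' (Euc m) (E := fun x : M => TangentSpace (𝓡 m) x) (x z)
        (JAt H (x z) (v z)))) y := by
  apply ContMDiffAt.clm_bundle_apply (F₁ := Euc m) (F₂ := Euc m)
    (E₁ := fun x : M => TangentSpace (𝓡 m) x) (E₂ := fun x : M => TangentSpace (𝓡 m) x)
    (ϕ := fun z => H.J (x z))
  · exact H.contMDiff_J.contMDiffAt.comp y hx
  · exact hv

theorem contDiffAt_of_apply {X : Type*} [NormedAddCommGroup X] [NormedSpace ℝ X]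
    {f : Euc m → Euc m →L[ℝ] X} (h : ∀ v, ContDiffAt ℝ ∞ (fun z => f z v) y) :
    ContDiffAt ℝ ∞ f y := by
  have e : f = fun z => ∑ i, (ContinuousLinearMap.smulRightL ℝ (Euc m) X
      (EuclideanSpace.proj i)) (f z (stdVec i)) := by
    funext z
    ext v
    rw [_root_.sum_apply]
    exact (IsLinearMap.sum_coord (F := fun v => f z v)
      ⟨(f z).map_add, fun c => (f z).map_smul c⟩ v).symm
  rw [e]
  exact ContDiffAt.sum fun i _ => (ContinuousLinearMap.smulRightL ℝ (Euc m) X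
    (EuclideanSpace.proj i)).contDiff.contDiffAt.comp y (h _)

theorem contDiffAt_gLoc (H : AlmostHermitianStructure m M)
    (he : e ∈ IsManifold.maximalAtlas (𝓡 m) ∞ M) (hy : y ∈ e.target) :
    ContDiffAt ℝ ∞ (gLoc H e) y := by
  have hx := contMDiffAt_symm_of_mem_maximalAtlas he hy
  refine contDiffAt_of_apply fun v => contDiffAt_of_apply fun w => ?_
  exact contDiffAt_gAt H hx (contMDiffAt_dInv he hy v) (contMDiffAt_dInv he hy w)

theorem contDiffAt_JLoc (H : AlmostHermitianStructure m M)
    (he : e ∈ IsManifold.maximalAtlas (𝓡 m) ∞ M) (hy : y ∈ e.target) :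
    ContDiffAt ℝ ∞ (JLoc H e) y := by
  have hx := contMDiffAt_symm_of_mem_maximalAtlas he hy
  refine contDiffAt_of_apply fun v => ?_
  -- Raising an index recovers J v from the scalar functions g (J v, e_a), whose smoothness follows
  -- from that of the sections g and J.
  have h1 : ContDiffAt ℝ ∞ (fun z => tr (gLoc H e z) fun a b =>
      gAt H (e.symm z) (JAt H (e.symm z) (dInv e z v)) (dInv e z a) • b) y := by
    refine ContDiffAt.sum fun i _ => ContDiffAt.sum fun j _ => ?_
    have h2 := contDiffAt_gAt H hx (contMDiffAt_JAt H hx (contMDiffAt_dInv he hy v))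
      (contMDiffAt_dInv he hy (stdVec i))
    exact (contDiffAt_gram_inv (contDiffAt_gLoc H he hy) (isMetric_gLoc H he hy) i j).smul
      (h2.smul (contDiffAt_const (c := stdVec j)))
  refine h1.congr_of_eventuallyEq ?_
  filter_upwards [e.open_target.mem_nhds hy] with z hz
  have h2 := tr_contract (isMetric_gLoc H he hz) (f := fun a : Euc m => a)
    ⟨fun _ _ => rfl, fun _ _ => rfl⟩ (JLoc H e z v)
  simp only [gLoc_apply, dInv_JLoc H he hz] at h2
  exact h2.symm

theorem hermAt_loc (H : AlmostHermitianStructure m M)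
    (he : e ∈ IsManifold.maximalAtlas (𝓡 m) ∞ M) (hy : y ∈ e.target) :
    HermAt (gLoc H e) (JLoc H e) y where
  smooth_g := contDiffAt_gLoc H he hy
  smooth_J := contDiffAt_JLoc H he hy
  metric := (e.open_target.mem_nhds hy |> Filter.eventually_of_mem <| fun z hz =>
    isMetric_gLoc H he hz)
  J_J := by
    filter_upwards [e.open_target.mem_nhds hy] with z hz v
    rw [← dChart_dInv he hz (JLoc H e z (JLoc H e z v)), dInv_JLoc H he hz, dInv_JLoc H he hz,
      JAt_JAt, _root_.map_neg, dChart_dInv he hz]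
  skew := by
    filter_upwards [e.open_target.mem_nhds hy] with z hz v w
    rw [gLoc_apply, gLoc_apply, dInv_JLoc H he hz, dInv_JLoc H he hz, gAt_skew]

end Manifold

end GForm

namespace GForm

section Manifold

variable {m : ℕ} {M : Type*} [TopologicalSpace M] [ChartedSpace (EuclideanSpace ℝ (Fin m)) M]
  {e : OpenPartialHomeomorph M (EuclideanSpace ℝ (Fin m))} {y : Euc m}

/-! ### The exterior derivative in charts -/

theorem inChart_transition {c : OpenPartialHomeomorph M (EuclideanSpace ℝ (Fin m))} {k : ℕ}
    (he : e ∈ IsManifold.maximalAtlas (𝓡 m) ∞ M) (hc : c ∈ IsManifold.maximalAtlas (𝓡 m) ∞ M)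
    (hy : y ∈ e.target) (hyc : e.symm y ∈ c.source) (α : DiffForm m M k) :
    α.inChart e y = (α.inChart c (c (e.symm y))).compContinuousLinearMap
      (fderiv ℝ (fun z => c (e.symm z)) y) := by
  have h1 : fderiv ℝ (fun z => c (e.symm z)) y = (dChart c (e.symm y)).comp (dInv e y) := by
    have h2 := mfderiv_comp y ((mdifferentiable_of_mem hc).mdifferentiableAt hyc)
      ((mdifferentiable_of_mem he).mdifferentiableAt_symm hy)
    rw [mfderiv_eq_fderiv] at h2
    exact h2
  have h2 : ∀ x ∈ c.source, ∀ v, dInv c (c x) (dChart c x v) = v := by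
    intro x hx v
    have := dInv_dChart hc (c.map_source hx) v
    rwa [c.left_inv hx] at this
  have h3 : ∀ x ∈ c.source, α.inChart c (c x) =
      (α x : Euc m [⋀^Fin k]→L[ℝ] ℂ).compContinuousLinearMap (dInv c (c x)) := by
    intro x hx
    have h4 : ∀ x' : M, x' = x → (α x' : Euc m [⋀^Fin k]→L[ℝ] ℂ) = α x := by
      rintro x' rfl
      rfl
    exact congrArg (fun a : Euc m [⋀^Fin k]→L[ℝ] ℂ =>
      a.compContinuousLinearMap (dInv c (c x))) (h4 _ (c.left_inv hx))
  rw [h3 _ hyc, h1]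
  ext u
  refine congrArg (α (e.symm y) : Euc m [⋀^Fin k]→L[ℝ] ℂ) (funext fun i => ?_)
  exact (h2 _ hyc (dInv e y (u i))).symm

theorem contDiffAt_transition {c : OpenPartialHomeomorph M (EuclideanSpace ℝ (Fin m))}
    (he : e ∈ IsManifold.maximalAtlas (𝓡 m) ∞ M) (hc : c ∈ IsManifold.maximalAtlas (𝓡 m) ∞ M)
    (hy : y ∈ e.target) (hyc : e.symm y ∈ c.source) :
    ContDiffAt ℝ ∞ (fun z => c (e.symm z)) y :=
  ((contMDiffAt_of_mem_maximalAtlas hc hyc).comp y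
    (contMDiffAt_symm_of_mem_maximalAtlas he hy)).contDiffAt

variable [IsManifold (𝓡 m) ∞ M] (H : AlmostHermitianStructure m M)

/-- `DiffForm.extD` uses at each point the chart preferred there. Naturality of the exterior
derivative under the transition map makes the result independent of this choice. -/
theorem inChart_extD {k : ℕ} (he : e ∈ IsManifold.maximalAtlas (𝓡 m) ∞ M) (hy : y ∈ e.target)
    {α : DiffForm m M k} (hα : ∀ c ∈ IsManifold.maximalAtlas (𝓡 m) ∞ M, ∀ z ∈ c.target,
      DifferentiableAt ℝ (α.inChart c) z) :
    α.extD.inChart e y = extDeriv (α.inChart e) y := by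
  set c := chartAt (EuclideanSpace ℝ (Fin m)) (e.symm y) with hc
  have hcm : c ∈ IsManifold.maximalAtlas (𝓡 m) ∞ M :=
    IsManifold.chart_mem_maximalAtlas (e.symm y)
  have hyc : e.symm y ∈ c.source := mem_chart_source _ _
  have hev : α.inChart e =ᶠ[nhds y] fun z => (α.inChart c (c (e.symm z))).compContinuousLinearMap
      (fderiv ℝ (fun z => c (e.symm z)) z) := by
    filter_upwards [e.open_target.mem_nhds hy, (e.symm.continuousAt hy).preimage_mem_nhds
      (c.open_source.mem_nhds hyc)] with z hz1 hz2
    exact inChart_transition he hcm hz1 hz2 α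
  have h1 : extDeriv (α.inChart e) y = _ := hev.extDeriv_eq
  have h5 : extDeriv (fun z => (α.inChart c (c (e.symm z))).compContinuousLinearMap
      (fderiv ℝ (fun z => c (e.symm z)) z)) y = _ :=
    extDeriv_pullback (f := fun z => c (e.symm z)) (x := y) (r := ∞)
      (hα c hcm _ (c.map_source hyc)) (contDiffAt_transition he hcm hy hyc)
      (by simpa using ENat.LEInfty.out)
  rw [h1, h5]
  have h2 : fderiv ℝ (fun z => c (e.symm z)) y = (dChart c (e.symm y)).comp (dInv e y) := by
    have h2 := mfderiv_comp y ((mdifferentiable_of_mem hcm).mdifferentiableAt hyc)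
      ((mdifferentiable_of_mem he).mdifferentiableAt_symm hy)
    rw [mfderiv_eq_fderiv] at h2
    exact h2
  rw [h2]
  rfl

/-! ### The operators in charts -/

theorem val_lefschetz (α : TotalForm m M) (x : M) :
    val (H.lefschetz α) x = wedgeTwo (kahlerForm (gAt H x) (JAt H x)) (val α x) := by
  funext k
  match k with
  | 0 =>
    change (0 : Euc m [⋀^Fin 0]→L[ℝ] ℂ) = _
    rw [wedgeTwo_def]
    ext u
    exact (mul_zero _).symm
  | 1 =>
    change (0 : Euc m [⋀^Fin 1]→L[ℝ] ℂ) = _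
    have h : (alt fun v => alt fun w => kahlerForm (gAt H x) (JAt H x) v w • val α x) 1 = 0 := by
      rw [alt_eq_clm]
      exact Finset.sum_eq_zero fun i _ => _root_.map_zero _
    rw [wedgeTwo_def, Pi.smul_apply, h]
    ext u
    exact (mul_zero _).symm
  | k + 2 =>
    exact formWedge_eq_wedgeTwo (Nat.add_comm 2 k) (H.omega x) (kahlerForm (gAt H x) (JAt H x))
      (fun v w => rfl) (val α x)

theorem kahlerForm_loc (he : e ∈ IsManifold.maximalAtlas (𝓡 m) ∞ M) (hy : y ∈ e.target) :
    (kahlerForm (gAt H (e.symm y)) (JAt H (e.symm y))).compl₁₂ (dInv e y).toLinearMap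
      (dInv e y).toLinearMap = kahlerForm (gLoc H e y) (JLoc H e y) := by
  refine LinearMap.ext₂ fun v w => ?_
  rw [LinearMap.compl₁₂_apply, kahlerForm_apply, kahlerForm_apply, gLoc_apply, dInv_JLoc H he hy]
  rfl

theorem loc_lefschetz (he : e ∈ IsManifold.maximalAtlas (𝓡 m) ∞ M) (hy : y ∈ e.target)
    (α : TotalForm m M) :
    loc e (H.lefschetz α) y = wedgeOmega (gLoc H e) (JLoc H e) (loc e α) y := by
  rw [loc_eq_pull, val_lefschetz, wedgeTwo_pull, kahlerForm_loc H he hy]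
  rfl

/-- The adjoint of the Lefschetz operator. -/
def lamTot (α : TotalForm m M) : TotalForm m M := fun k x => lam (gAt H x) (JAt H x) (val α x) k

theorem loc_lamTot (he : e ∈ IsManifold.maximalAtlas (𝓡 m) ∞ M) (hy : y ∈ e.target)
    (α : TotalForm m M) : loc e (lamTot H α) y = lam (gLoc H e y) (JLoc H e y) (loc e α y) :=
  lam_pull (isMetric_gAt H _) (isMetric_gLoc H he hy)
    (fun v => ⟨_, dInv_dChart he hy v⟩) (gLoc_apply H) (dInv_JLoc H he hy) (val α (e.symm y))

/-! ### The components of the exterior derivative in charts -/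

theorem weight_two_mul_sub {J : Euc m →L[ℝ] Euc m} {p k : ℕ} (hp : p ≤ k) (α : GForm m) :
    weight J (2 * p - k) α k = typePart J p (α k) := by
  rw [weight_apply, Finset.sum_eq_single p, if_pos rfl]
  · intro q _ hq
    exact if_neg fun h => hq (by omega)
  · intro h
    exact absurd (Finset.mem_range.mpr (Nat.lt_succ_of_le hp)) h

theorem weight_degree_eq_zero {J : Euc m →L[ℝ] Euc m} {k : ℕ} {w : ℤ} {α : GForm m}
    (h : α k = 0) : weight J w α k = 0 := by
  rw [weight_apply]
  refine Finset.sum_eq_zero fun p _ => ?_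
  rw [h]
  have : typePart J p (0 : Euc m [⋀^Fin k]→L[ℝ] ℂ) = 0 := by
    have h0 := typePart_smul J p 0 (0 : Euc m [⋀^Fin k]→L[ℝ] ℂ)
    have h1 : (0 : ℂ) • (0 : Euc m [⋀^Fin k]→L[ℝ] ℂ) = 0 := by ext u; exact mul_zero _
    have h2 : (0 : ℂ) • typePart J p (0 : Euc m [⋀^Fin k]→L[ℝ] ℂ) = 0 := by
      ext u; exact zero_mul _
    rwa [h1, h2] at h0
  rw [this]
  split_ifs <;> rfl

/-- In degree k only the weights 2p - k occur, so the sum over weights turns into the sum over p in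
the definitions of ∂ and ∂̄. -/
theorem delS_succ (J : Euc m → Euc m →L[ℝ] Euc m) (s : ℤ) (α : Euc m → GForm m) (y : Euc m)
    (k : ℕ) : delS J s α y (k + 1) = ∑ p ∈ Finset.range (k + 1),
      weight (J y) (2 * p - k + s) (dd (fun z => weight (J z) (2 * p - k) (α z)) y) (k + 1) := by
  -- Above degree m there are no forms; below, |2p - k| ≤ m and the range of weights is large
  -- enough.
  by_cases hk : m < k + 1
  · rw [eq_zero_of_lt hk (delS J s α y (k + 1)), eq_zero_of_lt hk (∑ p ∈ _, _)]
  · rw [delS, Finset.sum_apply]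
    symm
    refine Finset.sum_of_injOn (fun p : ℕ => (2 * p - k : ℤ)) (fun p _ q _ h => ?_) (fun p hp => ?_)
      (fun w _ hw => ?_) fun p _ => rfl
    · simp only at h
      omega
    · have := Finset.mem_range.mp hp
      simp only [Finset.coe_Icc, Set.mem_Icc]
      omega
    · refine weight_degree_eq_zero ?_
      have : (fun z => weight (J z) w (α z) k) = fun _ => 0 := by
        funext z
        rw [weight_apply]
        refine Finset.sum_eq_zero fun p hp => if_neg fun h => hw ⟨p, by simpa using hp, h⟩
      rw [dd_succ, this]
      rw [extDeriv, fderiv_const_apply]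
      exact (ContinuousAlternatingMap.alternatizeUncurryFinCLM ℝ (Euc m) ℂ).map_zero

theorem delS_degree_zero (J : Euc m → Euc m →L[ℝ] Euc m) (s : ℤ) (α : Euc m → GForm m)
    (y : Euc m) : delS J s α y 0 = 0 := by
  rw [delS, Finset.sum_apply]
  exact Finset.sum_eq_zero fun w _ => weight_degree_eq_zero rfl

theorem inChart_typePart (he : e ∈ IsManifold.maximalAtlas (𝓡 m) ∞ M) (hy : y ∈ e.target)
    {k : ℕ} (p : ℕ) (α : DiffForm m M k) :
    DiffForm.inChart e (fun x => typePart (H.J x) p (α x)) y =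
      typePart (JLoc H e y) p (α.inChart e y) :=
  (typePart_pull (J := JAt H (e.symm y)) (J' := JLoc H e y) (dInv_JLoc H he hy) p
    (α (e.symm y) : Euc m [⋀^Fin k]→L[ℝ] ℂ)).symm

theorem contDiffAt_inChart_typePart (he : e ∈ IsManifold.maximalAtlas (𝓡 m) ∞ M)
    (hy : y ∈ e.target) {α : TotalForm m M} (hα : α.IsSmooth) {k p : ℕ} (hp : p ≤ k) :
    ContDiffAt ℝ ∞ (DiffForm.inChart e fun x => typePart (H.J x) p (α k x)) y := by
  have h := SmoothAt.weight (contDiffAt_JLoc H he hy) ((isSmooth_iff α).mp hα e he y hy)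
    (2 * p - k) k
  refine h.congr_of_eventuallyEq ?_
  filter_upwards [e.open_target.mem_nhds hy] with z hz
  rw [inChart_typePart H he hz, weight_two_mul_sub hp]
  rfl

theorem sum_compContinuousLinearMap {ι : Type*} (t : Finset ι) {n : ℕ}
    (f : ι → Euc m [⋀^Fin n]→L[ℝ] ℂ) (T : Euc m →L[ℝ] Euc m) :
    (∑ p ∈ t, f p).compContinuousLinearMap T = ∑ p ∈ t, (f p).compContinuousLinearMap T := by
  ext u
  simp

/-- Serves both operators: ∂ is q p = p + 1 with s = 1, and ∂̄ is q p = p with s = -1. -/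
theorem loc_delForm (he : e ∈ IsManifold.maximalAtlas (𝓡 m) ∞ M) (hy : y ∈ e.target)
    {α : TotalForm m M} (hα : α.IsSmooth) {s : ℤ} {k : ℕ} {q : ℕ → ℕ}
    (hq : ∀ p ≤ k, q p ≤ k + 1 ∧ (2 * q p - (k + 1 : ℕ) : ℤ) = 2 * p - k + s) :
    DiffForm.inChart e (fun x => ∑ p ∈ Finset.range (k + 1), typePart (H.J x) (q p)
      (DiffForm.extD (fun y => typePart (H.J y) p (α k y)) x)) y =
      delS (JLoc H e) s (loc e α) y (k + 1) := by
  have h1 : DiffForm.inChart e (fun x => ∑ p ∈ Finset.range (k + 1), typePart (H.J x) (q p)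
      (DiffForm.extD (fun y => typePart (H.J y) p (α k y)) x)) y =
      ∑ p ∈ Finset.range (k + 1), DiffForm.inChart e (fun x => typePart (H.J x) (q p)
      (DiffForm.extD (fun y => typePart (H.J y) p (α k y)) x)) y :=
    sum_compContinuousLinearMap (Finset.range (k + 1)) (fun p => typePart (JAt H (e.symm y)) (q p)
      (DiffForm.extD (fun y => typePart (H.J y) p (α k y)) (e.symm y))) (dInv e y)
  rw [h1, delS_succ]
  refine Finset.sum_congr rfl fun p hp => ?_
  have hp' : p ≤ k := Nat.lt_succ_iff.mp (Finset.mem_range.mp hp)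
  obtain ⟨hq1, hq2⟩ := hq p hp'
  rw [inChart_typePart H he hy, ← hq2, weight_two_mul_sub hq1, dd_succ,
    inChart_extD he hy fun c hc z hz =>
      (contDiffAt_inChart_typePart H hc hz hα hp').differentiableAt (by simp)]
  congr 1
  refine Filter.EventuallyEq.extDeriv_eq ?_
  filter_upwards [e.open_target.mem_nhds hy] with z hz
  rw [inChart_typePart H he hz, weight_two_mul_sub hp']
  rfl

theorem loc_del (he : e ∈ IsManifold.maximalAtlas (𝓡 m) ∞ M) (hy : y ∈ e.target)
    {α : TotalForm m M} (hα : α.IsSmooth) :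
    loc e (H.del α) y = delS (JLoc H e) 1 (loc e α) y := by
  funext k
  match k with
  | 0 =>
    rw [delS_degree_zero]
    ext u
    rfl
  | k + 1 =>
    exact loc_delForm H he hy hα (q := fun p => p + 1) fun p hp => ⟨by omega, by push_cast; ring⟩

theorem loc_delbar (he : e ∈ IsManifold.maximalAtlas (𝓡 m) ∞ M) (hy : y ∈ e.target)
    {α : TotalForm m M} (hα : α.IsSmooth) :
    loc e (H.delbar α) y = delS (JLoc H e) (-1) (loc e α) y := by
  funext k
  match k with
  | 0 =>
    rw [delS_degree_zero]
    ext u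
    rfl
  | k + 1 =>
    exact loc_delForm H he hy hα (q := fun p => p) fun p hp => ⟨by omega, by push_cast; ring⟩

/-! ### Smoothness -/

variable {α : TotalForm m M}

theorem isSmooth_lefschetz (hα : α.IsSmooth) : (H.lefschetz α).IsSmooth :=
  isSmooth_of_loc (fun e => wedgeOmega (gLoc H e) (JLoc H e) (loc e α)) fun e he y hy =>
    ⟨loc_lefschetz H he hy α, SmoothAt.wedgeOmega (hermAt_loc H he hy)
      ((isSmooth_iff α).mp hα e he y hy)⟩

theorem isSmooth_lamTot (hα : α.IsSmooth) : (lamTot H α).IsSmooth :=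
  isSmooth_of_loc (fun e y => lam (gLoc H e y) (JLoc H e y) (loc e α y)) fun e he y hy =>
    ⟨loc_lamTot H he hy α, SmoothAt.lam (contDiffAt_gLoc H he hy) (isMetric_gLoc H he hy)
      (contDiffAt_JLoc H he hy) ((isSmooth_iff α).mp hα e he y hy)⟩

end Manifold

end GForm

namespace GForm

open MeasureTheory

/-! ### Integration of compactly supported functions on an open set -/

section Integration

variable {m : ℕ} {U K : Set (Euc m)}

theorem integrableOn_of_eq_zero_off {f : Euc m → ℂ} (hU : IsOpen U) (hK : IsCompact K)
    (hKU : K ⊆ U) (hf : ContinuousOn f U) (h0 : ∀ y ∈ U \ K, f y = 0) : IntegrableOn f U :=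
  ((hf.mono hKU).integrableOn_compact hK).of_forall_sdiff_eq_zero hU.measurableSet h0

/-- The divergence theorem for compactly supported vector fields. -/
theorem integral_divergence_eq_zero {F : Fin m → Euc m → ℂ} (hU : IsOpen U) (hK : IsCompact K)
    (hKU : K ⊆ U) (hF : ∀ i, ∀ y ∈ U, ContDiffAt ℝ ∞ (F i) y) (h0 : ∀ i, ∀ y ∈ U \ K, F i y = 0) :
    ∫ y in U, ∑ i, fderiv ℝ (F i) y (stdVec i) = 0 := by
  -- Because F i vanishes on U outside the compact set K, its extension by zero is smooth on the
  -- whole space.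
  have hG0 : ∀ i, ∀ y ∉ K, U.indicator (F i) =ᶠ[nhds y] fun _ => 0 := by
    intro i y hy
    filter_upwards [hK.isClosed.isOpen_compl.mem_nhds hy] with z hz
    by_cases hzU : z ∈ U
    · rw [Set.indicator_of_mem hzU, h0 i z ⟨hzU, hz⟩]
    · exact Set.indicator_of_notMem hzU _
  have hG1 : ∀ i, ∀ y ∈ U, U.indicator (F i) =ᶠ[nhds y] F i := by
    intro i y hy
    filter_upwards [hU.mem_nhds hy] with z hz
    exact Set.indicator_of_mem hz _
  have hG : ∀ i, ContDiff ℝ ∞ (U.indicator (F i)) := by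
    intro i
    refine contDiff_iff_contDiffAt.mpr fun y => ?_
    by_cases hy : y ∈ U
    · exact (hF i y hy).congr_of_eventuallyEq (hG1 i y hy)
    · exact contDiffAt_const.congr_of_eventuallyEq (hG0 i y fun h => hy (hKU h))
  have hd0 : ∀ i, ∀ y ∉ K, fderiv ℝ (U.indicator (F i)) y (stdVec i) = 0 := by
    intro i y hy
    rw [(hG0 i y hy).fderiv_eq]
    simp
  have hint : ∀ i, Integrable fun y => fderiv ℝ (U.indicator (F i)) y (stdVec i) := by
    intro i
    refine Continuous.integrable_of_hasCompactSupport
      (((hG i).continuous_fderiv (by simp)).clm_apply continuous_const) ?_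
    exact HasCompactSupport.intro hK (hd0 i)
  have hint0 : ∀ i, ∫ y, fderiv ℝ (U.indicator (F i)) y (stdVec i) = 0 := by
    intro i
    have h1 : Integrable (U.indicator (F i)) :=
      (hG i).continuous.integrable_of_hasCompactSupport
        (HasCompactSupport.intro hK fun y hy => (hG0 i y hy).self_of_nhds)
    -- Integration by parts against the constant function 1.
    have h := integral_mul_fderiv_eq_neg_fderiv_mul_of_integrable (μ := volume)
      (f := fun _ : Euc m => (1 : ℂ)) (g := U.indicator (F i)) (v := stdVec i) (by simp)
      (by simpa using hint i) (by simpa using h1) (fun y _ => differentiableAt_const _)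
      (fun y _ => (hG i).differentiable (by simp) y)
    simpa using h
  have h1 : ∫ y in U, ∑ i, fderiv ℝ (F i) y (stdVec i) =
      ∫ y in U, ∑ i, fderiv ℝ (U.indicator (F i)) y (stdVec i) :=
    setIntegral_congr_fun hU.measurableSet fun y hy =>
      Finset.sum_congr rfl fun i _ => by rw [(hG1 i y hy).fderiv_eq]
  rw [h1, setIntegral_eq_integral_of_forall_compl_eq_zero fun y hy =>
    Finset.sum_eq_zero fun i _ => hd0 i y fun h => hy (hKU h), integral_finsetSum _ fun i _ => hint i]
  exact Finset.sum_eq_zero fun i _ => hint0 i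

end Integration

section Manifold

variable {m : ℕ} {M : Type*} [TopologicalSpace M] [ChartedSpace (EuclideanSpace ℝ (Fin m)) M]
  {e : OpenPartialHomeomorph M (EuclideanSpace ℝ (Fin m))} {y : Euc m} {K : Set (Euc m)}
  {α β : TotalForm m M}

/-! ### Forms supported in a chart -/

/-- The form `α` vanishes in the chart `e` outside `K`. -/
def VanishesOff (e : OpenPartialHomeomorph M (EuclideanSpace ℝ (Fin m))) (K : Set (Euc m))
    (α : TotalForm m M) : Prop := ∀ y ∈ e.target \ K, loc e α y = 0

theorem HasCompactSupportIn.exists_vanishesOff (h : α.HasCompactSupportIn e.source) :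
    ∃ K, IsCompact K ∧ K ⊆ e.target ∧ VanishesOff e K α := by
  obtain ⟨K, hK, hKe, h0⟩ := h
  refine ⟨e '' K, hK.image_of_continuousOn (e.continuousOn.mono hKe),
    Set.image_subset_iff.mpr fun x hx => e.map_source (hKe hx), fun y hy => ?_⟩
  funext k
  have h1 : (α k (e.symm y) : Euc m [⋀^Fin k]→L[ℝ] ℂ) = 0 :=
    h0 k _ fun h => hy.2 ⟨_, h, e.right_inv hy.1⟩
  rw [loc_eq_pull, pull_apply]
  change ContinuousAlternatingMap.compContinuousLinearMap (α k (e.symm y) :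
    Euc m [⋀^Fin k]→L[ℝ] ℂ) (dInv e y) = 0
  rw [h1]
  rfl

theorem VanishesOff.eventually (hK : IsCompact K) (h : VanishesOff e K α) (hy : y ∈ e.target \ K) :
    loc e α =ᶠ[nhds y] fun _ => 0 := by
  filter_upwards [(e.open_target.sdiff hK.isClosed).mem_nhds hy] with z hz
  exact h z hz

theorem VanishesOff.sub (hα : VanishesOff e K α) (hβ : VanishesOff e K β) :
    VanishesOff e K (α - β) := fun y hy => by
  change loc e α y - loc e β y = 0
  rw [hα y hy, hβ y hy, sub_zero]

theorem isSmooth_sub (hα : α.IsSmooth) (hβ : β.IsSmooth) : (α - β).IsSmooth :=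
  isSmooth_of_loc (fun e y => loc e α y - loc e β y) fun e he y hy =>
    ⟨rfl, ((isSmooth_iff α).mp hα e he y hy).sub ((isSmooth_iff β).mp hβ e he y hy)⟩

theorem isSmooth_const_smul (c : ℂ) (hα : α.IsSmooth) : (c • α).IsSmooth :=
  isSmooth_of_loc (fun e y => c • loc e α y) fun e he y hy =>
    ⟨rfl, ((isSmooth_iff α).mp hα e he y hy).const_smul c⟩

theorem VanishesOff.const_smul (c : ℂ) (hα : VanishesOff e K α) : VanishesOff e K (c • α) :=
  fun y hy => by
    change c • loc e α y = 0
    rw [hα y hy]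
    funext k
    ext u
    exact mul_zero c

variable [IsManifold (𝓡 m) ∞ M] {H : AlmostHermitianStructure m M}

/-! ### Operators given by a component of the exterior derivative -/

/-- The operator `D` is the component of weight `s` of the exterior derivative. -/
def IsDelS (H : AlmostHermitianStructure m M) (s : ℤ) (D : TotalForm m M → TotalForm m M) : Prop :=
  ∀ e ∈ IsManifold.maximalAtlas (𝓡 m) ∞ M, ∀ y ∈ e.target, ∀ α : TotalForm m M, α.IsSmooth →
    loc e (D α) y = delS (JLoc H e) s (loc e α) y

theorem isDelS_del : IsDelS H 1 H.del := fun _ he _ hy _ hα => loc_del H he hy hα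

theorem isDelS_delbar : IsDelS H (-1) H.delbar := fun _ he _ hy _ hα => loc_delbar H he hy hα

variable {s : ℤ} {D D' : TotalForm m M → TotalForm m M}

theorem IsDelS.isSmooth (hD : IsDelS H s D) (hα : α.IsSmooth) : (D α).IsSmooth :=
  isSmooth_of_loc (fun e => delS (JLoc H e) s (loc e α)) fun e he y hy =>
    ⟨hD e he y hy α hα, SmoothAt.delS (contDiffAt_JLoc H he hy)
      ((isSmooth_iff α).mp hα e he y hy) s⟩

theorem delS_zero (J : Euc m → Euc m →L[ℝ] Euc m) (s : ℤ) (y : Euc m) :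
    delS J s (fun _ => (0 : GForm m)) y = 0 := by
  refine Finset.sum_eq_zero fun w _ => ?_
  have : (fun z => weight (J z) w (0 : GForm m)) = fun _ => 0 := funext fun z => _root_.map_zero _
  rw [this, dd_zero, _root_.map_zero]

theorem IsDelS.vanishesOff (hD : IsDelS H s D) (he : e ∈ IsManifold.maximalAtlas (𝓡 m) ∞ M)
    (hα : α.IsSmooth) (hK : IsCompact K) (h : VanishesOff e K α) : VanishesOff e K (D α) :=
  fun y hy => by
    rw [hD e he y hy.1 α hα, delS_congr (h.eventually hK hy), delS_zero]

theorem VanishesOff.lamTot (he : e ∈ IsManifold.maximalAtlas (𝓡 m) ∞ M) (h : VanishesOff e K α) :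
    VanishesOff e K (lamTot H α) := fun y hy => by
  rw [loc_lamTot H he hy.1, h y hy, _root_.map_zero]

/-! ### The `L²` product -/

variable (H) in
/-- The integrand of the `L²` product. -/
def density (e : OpenPartialHomeomorph M (EuclideanSpace ℝ (Fin m))) (α β : TotalForm m M)
    (y : Euc m) : ℂ :=
  (volDensity (gLoc H e) y : ℂ) * inn (gLoc H e y) (loc e α y) (loc e β y)

theorem l2Pairing_eq (e : OpenPartialHomeomorph M (EuclideanSpace ℝ (Fin m)))
    (α β : TotalForm m M) : H.l2Pairing e α β = ∫ y in e.target, density H e α β y := rfl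

theorem continuousOn_density (he : e ∈ IsManifold.maximalAtlas (𝓡 m) ∞ M) (hα : α.IsSmooth)
    (hβ : β.IsSmooth) : ContinuousOn (density H e α β) e.target := fun y hy => by
  have h : ContDiffAt ℝ ∞ (density H e α β) y :=
    (Complex.ofRealCLM.contDiff.contDiffAt.comp y (hermAt_loc H he hy).contDiffAt_volDensity).mul
      (SmoothAt.inn (contDiffAt_gLoc H he hy) (isMetric_gLoc H he hy)
        ((isSmooth_iff α).mp hα e he y hy) ((isSmooth_iff β).mp hβ e he y hy))
  exact h.continuousAt.continuousWithinAt

theorem integrableOn_density (he : e ∈ IsManifold.maximalAtlas (𝓡 m) ∞ M) (hα : α.IsSmooth)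
    (hβ : β.IsSmooth) (hK : IsCompact K) (hKe : K ⊆ e.target)
    (h : VanishesOff e K α ∨ VanishesOff e K β) : IntegrableOn (density H e α β) e.target :=
  integrableOn_of_eq_zero_off e.open_target hK hKe (continuousOn_density he hα hβ) fun y hy => by
    rw [density]
    rcases h with h | h
    · rw [h y hy, _root_.map_zero, LinearMap.zero_apply, mul_zero]
    · rw [h y hy, _root_.map_zero, mul_zero]

theorem l2Pairing_conj (he : e ∈ IsManifold.maximalAtlas (𝓡 m) ∞ M) (α β : TotalForm m M) :
    conj (H.l2Pairing e α β) = H.l2Pairing e β α := by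
  rw [l2Pairing_eq, l2Pairing_eq, ← integral_conj]
  refine setIntegral_congr_fun e.open_target.measurableSet fun y hy => ?_
  simp only [density]
  rw [_root_.map_mul, Complex.conj_ofReal, inn_conj (isMetric_gLoc H he hy)]

theorem l2Pairing_smul_right (c : ℂ) (α β : TotalForm m M) :
    H.l2Pairing e α (c • β) = conj c * H.l2Pairing e α β := by
  rw [l2Pairing_eq, l2Pairing_eq, ← integral_const_mul]
  refine integral_congr_ae (Filter.Eventually.of_forall fun y => ?_)
  change (volDensity (gLoc H e) y : ℂ) * inn (gLoc H e y) (loc e α y) (c • loc e β y) = _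
  rw [LinearMap.map_smulₛₗ, smul_eq_mul]
  exact mul_left_comm _ _ _

theorem l2Pairing_sub_right (he : e ∈ IsManifold.maximalAtlas (𝓡 m) ∞ M) {γ : TotalForm m M}
    (hα : α.IsSmooth) (hβ : β.IsSmooth) (hγ : γ.IsSmooth) (hK : IsCompact K) (hKe : K ⊆ e.target)
    (h : VanishesOff e K α ∨ VanishesOff e K β ∧ VanishesOff e K γ) :
    H.l2Pairing e α (β - γ) = H.l2Pairing e α β - H.l2Pairing e α γ := by
  rw [l2Pairing_eq, l2Pairing_eq, l2Pairing_eq,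
    ← integral_sub (integrableOn_density he hα hβ hK hKe (h.imp_right And.left))
      (integrableOn_density he hα hγ hK hKe (h.imp_right And.right))]
  refine integral_congr_ae (Filter.Eventually.of_forall fun y => ?_)
  change (volDensity (gLoc H e) y : ℂ) * inn (gLoc H e y) (loc e α y) (loc e β y - loc e γ y) = _
  rw [_root_.map_sub, mul_sub]
  rfl

theorem l2Pairing_lefschetz (he : e ∈ IsManifold.maximalAtlas (𝓡 m) ∞ M) (α β : TotalForm m M) :
    H.l2Pairing e (H.lefschetz α) β = H.l2Pairing e α (lamTot H β) := by
  rw [l2Pairing_eq, l2Pairing_eq]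
  refine setIntegral_congr_fun e.open_target.measurableSet fun y hy => ?_
  simp only [density]
  rw [loc_lefschetz H he hy, loc_lamTot H he hy, wedgeOmega, inn_wedgeTwo (isMetric_gLoc H he hy)]

theorem adjFlux_eq_zero {g : Euc m → Euc m →L[ℝ] Euc m →L[ℝ] ℝ} {J : Euc m → Euc m →L[ℝ] Euc m}
    {a b : Euc m → GForm m} (h : a y = 0 ∨ b y = 0) (s : ℤ) (i : Fin m) :
    adjFlux g J s a b i y = 0 := by
  have hl : ∀ (a b : Euc m → GForm m), a y = 0 ∨ b y = 0 → fluxS g J s a b i y = 0 := by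
    intro a b h
    refine Finset.sum_eq_zero fun w _ => ?_
    rw [flux]
    rcases h with h | h
    · have h1 : (fun v : Euc m => v i • (weight (J y) w) (a y)) = fun _ => 0 := by
        funext v
        rw [h, _root_.map_zero, rsmul_zero]
      rw [h1, alt_zero_fun, _root_.map_zero, LinearMap.zero_apply, mul_zero]
    · rw [h, _root_.map_zero, _root_.map_zero, mul_zero]
  rw [adjFlux, hl b (wedgeOmega g J a), hl (fun z => lam (g z) (J z) (b z)) a, sub_self, mul_zero]
  · refine h.symm.imp (fun h => ?_) id
    rw [h, _root_.map_zero]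
  · refine h.symm.imp id fun h => ?_
    rw [wedgeOmega, h, _root_.map_zero]

/-- The adjoint of the component of weight `-s` of the exterior derivative. -/
theorem IsDelS.l2Pairing (hD : IsDelS H (-s) D) (hD' : IsDelS H s D') (hs : |s| = 1)
    (he : e ∈ IsManifold.maximalAtlas (𝓡 m) ∞ M)
    (ht : ∀ y ∈ e.target, ∀ v X, covEnd (gLoc H e) (JLoc H e) y (JLoc H e y v) X =
      covEnd (gLoc H e) (JLoc H e) y v (JLoc H e y X))
    (hα : α.IsSmooth) (hβ : β.IsSmooth) (hK : IsCompact K) (hKe : K ⊆ e.target)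
    (h : VanishesOff e K α ∨ VanishesOff e K β) :
    H.l2Pairing e (D α) β =
      H.l2Pairing e α ((Complex.I * s) • (D' (GForm.lamTot H β) - GForm.lamTot H (D' β))) := by
  have hβ' : ((Complex.I * s) • (D' (GForm.lamTot H β) - GForm.lamTot H (D' β))).IsSmooth :=
    isSmooth_const_smul _ (isSmooth_sub (hD'.isSmooth (isSmooth_lamTot H hβ))
      (isSmooth_lamTot H (hD'.isSmooth hβ)))
  rw [← sub_eq_zero, l2Pairing_eq, l2Pairing_eq, ← integral_sub]
  -- The difference of the two integrands is the divergence of `adjFlux`, which vanishes outside K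
  -- because α or β does.
  · rw [← integral_divergence_eq_zero e.open_target hK hKe
      (F := adjFlux (gLoc H e) (JLoc H e) s (loc e α) (loc e β))
      (fun i y hy => (hermAt_loc H he hy).contDiffAt_adjFlux s
        ((isSmooth_iff α).mp hα e he y hy) ((isSmooth_iff β).mp hβ e he y hy) i)
      (fun i y hy => adjFlux_eq_zero (h.imp (fun h => h y hy) fun h => h y hy) s i)]
    refine setIntegral_congr_fun e.open_target.measurableSet fun y hy => ?_
    rw [(hermAt_loc H he hy).divergence_adjFlux (ht y hy) hs
      ((isSmooth_iff α).mp hα e he y hy) ((isSmooth_iff β).mp hβ e he y hy), density, density,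
      ← mul_sub, hD e he y hy α hα]
    have h1 : loc e ((Complex.I * s) • (D' (GForm.lamTot H β) - GForm.lamTot H (D' β))) y =
        (Complex.I * s) • (loc e (D' (GForm.lamTot H β)) y - loc e (GForm.lamTot H (D' β)) y) := rfl
    rw [h1, hD' e he y hy _ (isSmooth_lamTot H hβ), loc_lamTot H he hy, hD' e he y hy β hβ,
      delS_congr (α := loc e (GForm.lamTot H β)) (Filter.eventually_of_mem
        (e.open_target.mem_nhds hy) fun z hz => loc_lamTot H he hz β)]
  · exact integrableOn_density he (hD.isSmooth hα) hβ hK hKe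
      (h.imp_left (hD.vanishesOff he hα hK))
  · exact integrableOn_density he hα hβ' hK hKe (h.imp_right fun h =>
      (((hD'.vanishesOff he (isSmooth_lamTot H hβ) hK (h.lamTot he))).sub
        ((hD'.vanishesOff he hβ hK h).lamTot he)).const_smul _)

end Manifold

end GForm

namespace GForm

open MeasureTheory

section Manifold

variable {m : ℕ} {M : Type*} [TopologicalSpace M] [ChartedSpace (EuclideanSpace ℝ (Fin m)) M]
  {e : OpenPartialHomeomorph M (EuclideanSpace ℝ (Fin m))} {y : Euc m}
  {α β γ : TotalForm m M}

theorem val_eq_zero_of_loc (he : e ∈ IsManifold.maximalAtlas (𝓡 m) ∞ M) (hy : y ∈ e.target)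
    (h : loc e α y = 0) : val α (e.symm y) = 0 := by
  have h1 : pull (dChart e (e.symm y)) (loc e α y) = val α (e.symm y) := by
    funext k
    ext u
    rw [loc_eq_pull, pull_apply_apply, pull_apply_apply]
    exact congrArg (val α (e.symm y) k) (funext fun i => dInv_dChart he hy (u i))
  rw [← h1, h]
  rfl

variable [IsManifold (𝓡 m) ∞ M] {H : AlmostHermitianStructure m M}

/-! ### The condition on the Hermitian form -/

/-- The Hermitian form as an inhomogeneous form. -/
def omegaTot (H : AlmostHermitianStructure m M) : TotalForm m M
  | 0 => 0
  | 1 => 0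
  | 2 => H.omega
  | _ + 3 => 0

theorem loc_omegaTot (he : e ∈ IsManifold.maximalAtlas (𝓡 m) ∞ M) (hy : y ∈ e.target) :
    loc e (omegaTot H) y = wedgeOmega (gLoc H e) (JLoc H e) (fun _ => one) y := by
  funext k
  rw [wedgeOmega]
  match k with
  | 0 => exact (wedgeTwo_one_of_ne _ (by omega)).symm
  | 1 => exact (wedgeTwo_one_of_ne _ (by omega)).symm
  | 2 =>
    ext u
    rw [wedgeTwo_one_two _ (hermAt_loc H he hy).kahlerForm_skew, kahlerForm_apply, gLoc_apply,
      dInv_JLoc H he hy]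
    rfl
  | k + 3 => exact (wedgeTwo_one_of_ne _ (by omega)).symm

theorem isSmooth_omegaTot : (omegaTot H).IsSmooth :=
  isSmooth_of_loc (fun e => wedgeOmega (gLoc H e) (JLoc H e) fun _ => one) fun _ he _ hy =>
    ⟨loc_omegaTot he hy, SmoothAt.wedgeOmega (hermAt_loc H he hy) (SmoothAt.const _)⟩

/-- The only place where the hypotheses on ω enter: in a chart, ω is the constant function 1
multiplied by the Hermitian form, and `HermAt.covEnd_comp` applies to it. -/
theorem covEnd_loc (hdel : H.delForm H.omega = 0) (hdelbar : H.delbarForm H.omega = 0)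
    (he : e ∈ IsManifold.maximalAtlas (𝓡 m) ∞ M) (hy : y ∈ e.target) (v X : Euc m) :
    covEnd (gLoc H e) (JLoc H e) y (JLoc H e y v) X =
      covEnd (gLoc H e) (JLoc H e) y v (JLoc H e y X) := by
  have hev : loc e (omegaTot H) =ᶠ[nhds y] wedgeOmega (gLoc H e) (JLoc H e) fun _ => one := by
    filter_upwards [e.open_target.mem_nhds hy] with z hz
    exact loc_omegaTot he hz
  have h0 : DiffForm.inChart e (0 : DiffForm m M 3) y = 0 := rfl
  refine (hermAt_loc H he hy).covEnd_comp ?_ ?_ v X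
  · rw [← delS_congr hev, ← loc_del H he hy isSmooth_omegaTot]
    exact (congrArg (fun a => DiffForm.inChart e a y) hdel).trans h0
  · rw [← delS_congr hev, ← loc_delbar H he hy isSmooth_omegaTot]
    exact (congrArg (fun a => DiffForm.inChart e a y) hdelbar).trans h0

/-! ### Existence of adjoints -/

/-- Both operators are algebraic, so the adjointness holds already for the integrands. -/
theorem isAdjoint_lamTot : H.IsAdjoint H.lefschetz (lamTot H) := fun β hβ =>
  ⟨isSmooth_lamTot H hβ, fun _ he α _ _ => l2Pairing_lefschetz he α β⟩

theorem HasCompactSupportIn.lamTot {U : Set M} (h : α.HasCompactSupportIn U) :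
    (lamTot H α).HasCompactSupportIn U := by
  obtain ⟨K, hK, hKU, h0⟩ := h
  refine ⟨K, hK, hKU, fun k x hx => ?_⟩
  have h1 : val α x = 0 := funext fun k => h0 k x hx
  rw [GForm.lamTot, h1, _root_.map_zero]
  rfl

variable {s : ℤ} {D D' : TotalForm m M → TotalForm m M}

/-- The commutator of D' with Λ is a global operator, so no local adjoints have to be glued. The
formula for the adjoint is itself one of the Kähler identities. -/
theorem IsDelS.isAdjoint (hdel : H.delForm H.omega = 0) (hdelbar : H.delbarForm H.omega = 0)
    (hD : IsDelS H (-s) D) (hD' : IsDelS H s D') (hs : |s| = 1) :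
    H.IsAdjoint D fun β => (Complex.I * s) • (D' (lamTot H β) - lamTot H (D' β)) := fun β hβ =>
  ⟨isSmooth_const_smul _ (isSmooth_sub (hD'.isSmooth (isSmooth_lamTot H hβ))
      (isSmooth_lamTot H (hD'.isSmooth hβ))), fun e he α hα hc => by
    obtain ⟨K, hK, hKe, hv⟩ := HasCompactSupportIn.exists_vanishesOff hc
    exact hD.l2Pairing hD' hs he (fun y hy => covEnd_loc hdel hdelbar he hy) hα hβ hK hKe (.inl hv)⟩

/-! ### Uniqueness of adjoints -/

theorem volDensity_pos (he : e ∈ IsManifold.maximalAtlas (𝓡 m) ∞ M) (hy : y ∈ e.target) :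
    0 < volDensity (gLoc H e) y :=
  Real.sqrt_pos.mpr (gram_posDef (isMetric_gLoc H he hy)).det_pos

variable [T2Space M]

theorem isSmooth_bump_smul {x : M} (χ : SmoothBumpFunction (𝓡 m) x) (hγ : γ.IsSmooth) :
    TotalForm.IsSmooth (fun k z => (χ z : ℂ) • γ k z : TotalForm m M) :=
  isSmooth_of_loc (fun e z => χ (e.symm z) • loc e γ z) fun e he y hy => ⟨rfl,
    SmoothAt.smul (χ.contMDiff.contMDiffAt.comp y
      (contMDiffAt_symm_of_mem_maximalAtlas he hy)).contDiffAt ((isSmooth_iff γ).mp hγ e he y hy)⟩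

/-- The test form is χ γ, with a bump function χ centred at x. The integral of χ |γ|² vanishes, so
the continuous nonnegative integrand does, and χ = 1 at x. -/
theorem eq_zero_of_l2Pairing_eq_zero (hγ : γ.IsSmooth)
    (h : ∀ e ∈ IsManifold.maximalAtlas (𝓡 m) ∞ M, ∀ α : TotalForm m M, α.IsSmooth →
      α.HasCompactSupportIn e.source → H.l2Pairing e α γ = 0) : γ = 0 := by
  funext k x
  set e := chartAt (EuclideanSpace ℝ (Fin m)) x with he_def
  have he : e ∈ IsManifold.maximalAtlas (𝓡 m) ∞ M := IsManifold.chart_mem_maximalAtlas x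
  have hx : x ∈ e.source := mem_chart_source _ x
  obtain ⟨χ⟩ : Nonempty (SmoothBumpFunction (𝓡 m) x) := inferInstance
  let α : TotalForm m M := fun k z => (χ z : ℂ) • γ k z
  have hα : α.IsSmooth := isSmooth_bump_smul χ hγ
  have hc : α.HasCompactSupportIn e.source := by
    refine ⟨tsupport χ, χ.hasCompactSupport, χ.tsupport_subset_chartAt_source, fun k z hz => ?_⟩
    have h0 : χ z = 0 := image_eq_zero_of_notMem_tsupport hz
    change (χ z : ℂ) • γ k z = 0
    ext u
    exact (congrArg (fun c : ℝ => (c : ℂ) * γ k z u) h0).trans (by simp)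
  obtain ⟨K, hK, hKe, hv⟩ := HasCompactSupportIn.exists_vanishesOff hc
  have hint := integrableOn_density (H := H) he hα hγ hK hKe (.inl hv)
  have hd : ∀ y, density H e α γ y = (χ (e.symm y) * volDensity (gLoc H e) y : ℝ) *
      inn (gLoc H e y) (loc e γ y) (loc e γ y) := by
    intro y
    have h1 : loc e α y = (χ (e.symm y) : ℂ) • loc e γ y := rfl
    rw [density, h1, map_smul, LinearMap.smul_apply, smul_eq_mul]
    push_cast
    ring
  have hnn : ∀ y ∈ e.target, 0 ≤ (density H e α γ y).re ∧
      density H e α γ y = ((density H e α γ y).re : ℂ) := by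
    intro y hy
    obtain ⟨r, hr, hr'⟩ := inn_self_nonneg (isMetric_gLoc H he hy) (loc e γ y)
    rw [hd, hr', ← Complex.ofReal_mul, Complex.ofReal_re]
    exact ⟨mul_nonneg (mul_nonneg χ.nonneg (volDensity_pos he hy).le) hr, rfl⟩
  have hz : ∫ y in e.target, (density H e α γ y).re = 0 := by
    have h1 := integral_re hint
    rw [← l2Pairing_eq, h e he α hα hc] at h1
    exact h1
  have hae := (setIntegral_eq_zero_iff_of_nonneg_ae
    ((ae_restrict_iff' e.open_target.measurableSet).mpr (.of_forall fun y hy => (hnn y hy).1))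
    hint.re).mp hz
  have heq := Measure.eqOn_open_of_ae_eq hae e.open_target
    (Complex.continuous_re.comp_continuousOn (continuousOn_density he hα hγ)) continuousOn_const
  have hy := e.map_source hx
  have h1 : density H e α γ (e x) = 0 := by
    rw [(hnn _ hy).2]
    exact congrArg Complex.ofReal (heq hy)
  rw [hd, e.left_inv hx, χ.eq_one, one_mul] at h1
  have h2 := (mul_eq_zero.mp h1).resolve_left
    (Complex.ofReal_ne_zero.mpr (volDensity_pos he hy).ne')
  have h3 := val_eq_zero_of_loc he hy (eq_zero_of_inn_self (isMetric_gLoc H he hy) h2)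
  rw [e.left_inv hx] at h3
  exact congrFun h3 k

theorem IsAdjointAt.unique {D : TotalForm m M → TotalForm m M} {γ' : TotalForm m M}
    (h : H.IsAdjointAt D β γ) (h' : H.IsAdjointAt D β γ') : γ = γ' := by
  refine sub_eq_zero.mp (eq_zero_of_l2Pairing_eq_zero (H := H) (isSmooth_sub h.1 h'.1)
    fun e he α hα hc => ?_)
  obtain ⟨K, hK, hKe, hv⟩ := HasCompactSupportIn.exists_vanishesOff hc
  rw [l2Pairing_sub_right he hα h.1 h'.1 hK hKe (.inl hv), ← h.2 e he α hα hc, ← h'.2 e he α hα hc,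
    sub_self]

theorem adjoint_eq {D : TotalForm m M → TotalForm m M} (h : H.IsAdjointAt D β γ) :
    H.adjoint D β = γ := by
  have hex : ∃ γ, H.IsAdjointAt D β γ := ⟨γ, h⟩
  rw [AlmostHermitianStructure.adjoint, dif_pos hex]
  exact IsAdjointAt.unique hex.choose_spec h

theorem isAdjoint_adjoint {D D' : TotalForm m M → TotalForm m M} (h : H.IsAdjoint D D') :
    H.IsAdjoint D (H.adjoint D) := fun β hβ => by
  rw [adjoint_eq (h β hβ)]
  exact h β hβ

/-- The commutator of the Lefschetz operator with the adjoint of a component of the exterior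
derivative. -/
theorem IsDelS.lefschetz_adjoint (hdel : H.delForm H.omega = 0)
    (hdelbar : H.delbarForm H.omega = 0) (hD : IsDelS H (-s) D) (hD' : IsDelS H s D')
    (hs : |s| = 1) {S : TotalForm m M → TotalForm m M} (hS : H.IsAdjoint D' S) (hα : α.IsSmooth) :
    H.lefschetz (S α) - S (H.lefschetz α) = (Complex.I * s) • D α := by
  have hL := isSmooth_lefschetz H hα
  have h1 := isSmooth_lefschetz H (hS α hα).1
  have h2 := (hS _ hL).1
  have h3 := isSmooth_const_smul (Complex.I * s) (hD.isSmooth hα)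
  -- The identity is tested on τ. Only τ has compact support, and with it Λτ, D' τ and D' Λτ; this
  -- justifies every integration by parts below, whatever the support of α.
  refine sub_eq_zero.mp (eq_zero_of_l2Pairing_eq_zero (H := H) (isSmooth_sub (isSmooth_sub h1 h2) h3)
    fun e he τ hτ hc => ?_)
  obtain ⟨K, hK, hKe, hv⟩ := HasCompactSupportIn.exists_vanishesOff hc
  have hA : H.l2Pairing e τ (H.lefschetz (S α)) =
      conj (H.l2Pairing e α (D' (lamTot H τ))) := by
    rw [← l2Pairing_conj he, l2Pairing_lefschetz he, l2Pairing_conj he,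
      ← (hS α hα).2 e he _ (isSmooth_lamTot H hτ) (HasCompactSupportIn.lamTot hc),
      l2Pairing_conj he]
  have hB : H.l2Pairing e τ (S (H.lefschetz α)) =
      conj (H.l2Pairing e α (lamTot H (D' τ))) := by
    rw [← (hS _ hL).2 e he τ hτ hc, ← l2Pairing_conj he, l2Pairing_lefschetz he]
  have hC : H.l2Pairing e (D α) τ = conj (Complex.I * s) *
      (H.l2Pairing e α (D' (lamTot H τ)) - H.l2Pairing e α (lamTot H (D' τ))) := by
    rw [hD.l2Pairing hD' hs he (fun y hy => covEnd_loc hdel hdelbar he hy) hα hτ hK hKe (.inr hv),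
      l2Pairing_smul_right]
    refine congrArg _ (l2Pairing_sub_right he hα (hD'.isSmooth (isSmooth_lamTot H hτ))
      (isSmooth_lamTot H (hD'.isSmooth hτ)) hK hKe (.inr ⟨?_, ?_⟩))
    · exact hD'.vanishesOff he (isSmooth_lamTot H hτ) hK (hv.lamTot he)
    · exact (hD'.vanishesOff he hτ hK hv).lamTot he
  have hs2 : (s : ℂ) * s = 1 := by
    have : s * s = 1 := by rw [← abs_mul_abs_self, hs, one_mul]
    exact_mod_cast this
  rw [l2Pairing_sub_right he hτ (isSmooth_sub h1 h2) h3 hK hKe (.inl hv),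
    l2Pairing_sub_right he hτ h1 h2 hK hKe (.inl hv), l2Pairing_smul_right,
    ← l2Pairing_conj he (D α) τ, hA, hB, hC]
  simp only [_root_.map_mul, _root_.map_sub, _root_.map_neg, Complex.conj_I, map_intCast]
  linear_combination (conj (H.l2Pairing e α (D' (lamTot H τ))) -
    conj (H.l2Pairing e α (lamTot H (D' τ)))) * (-hs2 + (s : ℂ) * s * Complex.I_mul_I)

end Manifold

end GForm

end

/-! ### The Kähler identities -/

theorem mainTheorem5 {m : ℕ} {M : Type*} [TopologicalSpace M] [T2Space M]
    [ChartedSpace (EuclideanSpace ℝ (Fin m)) M] [IsManifold (𝓡 m) ∞ M]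
    (H : AlmostHermitianStructure m M)
    (hdel : H.delForm H.omega = 0) (hdelbar : H.delbarForm H.omega = 0) :
    H.IsAdjoint H.lefschetz H.lambda ∧
    H.IsAdjoint H.del H.delStar ∧
    H.IsAdjoint H.delbar H.delbarStar ∧
    ∀ α : TotalForm m M, α.IsSmooth →
      H.lambda (H.del α) - H.del (H.lambda α) = Complex.I • H.delbarStar α ∧
      H.lambda (H.delbar α) - H.delbar (H.lambda α) = -(Complex.I • H.delStar α) ∧
      H.lefschetz (H.delStar α) - H.delStar (H.lefschetz α) = Complex.I • H.delbar α ∧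
      H.lefschetz (H.delbarStar α) - H.delbarStar (H.lefschetz α) = -(Complex.I • H.del α) := by
  have hL : H.IsAdjoint H.lefschetz H.lambda := GForm.isAdjoint_adjoint GForm.isAdjoint_lamTot
  -- The adjoint of ∂ arises from s = -1 and the commutator [∂̄, Λ], that of ∂̄ from s = 1 and [∂,
  -- Λ].
  have h1 := GForm.IsDelS.isAdjoint (H := H) (s := -1) (D := H.del) (D' := H.delbar) hdel hdelbar
    (by simpa using GForm.isDelS_del) GForm.isDelS_delbar (by simp)
  have h2 := GForm.IsDelS.isAdjoint (H := H) (s := 1) (D := H.delbar) (D' := H.del) hdel hdelbar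
    GForm.isDelS_delbar GForm.isDelS_del (by simp)
  have hdS : H.IsAdjoint H.del H.delStar := GForm.isAdjoint_adjoint h1
  have hdbS : H.IsAdjoint H.delbar H.delbarStar := GForm.isAdjoint_adjoint h2
  refine ⟨hL, hdS, hdbS, fun α hα => ?_⟩
  have e0 : ∀ β : TotalForm m M, β.IsSmooth → H.lambda β = GForm.lamTot H β := fun β hβ =>
    GForm.adjoint_eq (GForm.isAdjoint_lamTot β hβ)
  have e1 : H.delStar α = _ := GForm.adjoint_eq (h1 α hα)
  have e2 : H.delbarStar α = _ := GForm.adjoint_eq (h2 α hα)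
  have e3 := e0 α hα
  have e4 := e0 _ (GForm.isDelS_del.isSmooth (H := H) hα)
  have e5 := e0 _ (GForm.isDelS_delbar.isSmooth (H := H) hα)
  have hn : ∀ (c : ℂ) (β : TotalForm m M), (-c) • β = -(c • β) := fun c β => by
    funext k x
    ext u
    exact neg_mul _ _
  have hI : ∀ β : TotalForm m M, Complex.I • (Complex.I * (1 : ℤ)) • β = -β := fun β => by
    rw [smul_smul, Int.cast_one, mul_one, Complex.I_mul_I, hn, one_smul]
  have hI' : ∀ β : TotalForm m M, Complex.I • (Complex.I * (-1 : ℤ)) • β = β := fun β => by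
    rw [smul_smul, Int.cast_neg, Int.cast_one, mul_neg, mul_one, mul_neg, Complex.I_mul_I, neg_neg,
      one_smul]
  refine ⟨?_, ?_, ?_, ?_⟩
  -- The first two identities are the formulas for ∂̄* and ∂* multiplied by √-1; the other two are
  -- the cases s = 1 and s = -1 of the commutator with L.
  · rw [e2, e3, e4, hI, neg_sub]
  · rw [e1, e3, e5, hI', neg_sub]
  · have := GForm.IsDelS.lefschetz_adjoint (s := 1) hdel hdelbar GForm.isDelS_delbar
      GForm.isDelS_del (by simp) hdS hα
    rwa [Int.cast_one, mul_one] at this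
  · have := GForm.IsDelS.lefschetz_adjoint (s := -1) hdel hdelbar
      (by simpa using GForm.isDelS_del) GForm.isDelS_delbar (by simp) hdbS hα
    rwa [Int.cast_neg, Int.cast_one, mul_neg, mul_one, hn] at this
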